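/- Let $\mathbb{T}=\mathbb{R}/2\pi\mathbb{Z}$, and let $L^2=L^2(\mathbb{R}_x\times\mathbb{T}_y)$ be the space of real-valued square-integrable functions. Let $\mathcal{E}$ be the space of those $v\in L^2$ for which $\|v\|_{\mathcal{E}}^2=\|v\|_{L^2}^2+\|\partial_x v\|_{L^2}^2+\|\partial_x^{-1}\partial_y v\|_{L^2}^2<\infty$, where $\partial_x$ and $\partial_x^{-1}\partial_y$ are the Fourier multipliers with symbols $i\xi$ and $(i\xi)^{-1}(in)$, $(\xi,n)\in\mathbb{R}\times\mathbb{Z}$. For $k>0$ set $$\varphi_k(x)=k\cosh^{-2}\Big(\sqrt{\tfrac{k}{2}}\,x\Big),\qquad Q_k(x)=\sqrt{\tfrac{k}{2}}\tanh\Big(\sqrt{\tfrac{k}{2}}\,x\Big),$$ and let $M^k_+(w)=\partial_x w+\partial_x^{-1}\partial_y w-w^2+\frac{k}{2}$ be the Miura transform, so that for $v\in\mathcal{E}$ (the kink $Q_k$ being independent of $y$) $$M^k_+(Q_k+v)=Q_k'+\partial_x v+\partial_x^{-1}\partial_y v-(Q_k+v)^2+\tfrac{k}{2}.$$ Proposition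 3.1. Let $c>0$. For every $\varepsilon>0$ there exists $\delta>0$ such that for every $u\in L^2$ with $\|u\|_{L^2}<\delta$ there exists a unique pair $(k,v)\in(0,\infty)\times\mathcal{E}$ satisfying $$|k-c|<\varepsilon,\qquad \|v\|_{\mathcal{E}}<\varepsilon,\qquad M^k_+(Q_k+v)=\varphi_c+u\quad\text{a.e. on }\mathbb{R}\times\mathbb{T}.$$ Moreover, the map $u\mapsto(k,v)$, from the ball $\{u\in L^2:\|u\|_{L^2}<\delta\}$ to $\mathbb{R}\times\mathcal{E}$, is of class $C^1$. -/

import Mathlib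

open MeasureTheory FourierTransform
open scoped ENNReal

noncomputable section

namespace KPMiura

instance factTwoPiPos : Fact (0 < 2 * Real.pi) := ⟨Real.two_pi_pos⟩

/-- The torus `ℝ / 2πℤ`. Its `volume` is Lebesgue measure, of total mass `2π`. -/
abbrev Torus : Type := AddCircle (2 * Real.pi)

/-- The cylinder `ℝ_x × 𝕋_y`, with the product measure `dx dy` as `volume`. -/
abbrev Cyl : Type := ℝ × Torus

/-- Real-valued `L²(ℝ_x × 𝕋_y)`. -/
abbrev L2Cyl : Type := Lp ℝ 2 (volume : Measure Cyl)

/-- The `n`-th Fourier mode in `y`, at the point `x`: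
`u_n(x) = (2π)^{-1/2} ∫_𝕋 e^{-iny} u(x,y) dy`. -/
def modeFun (u : Cyl → ℝ) (n : ℤ) (x : ℝ) : ℂ :=
  ((Real.sqrt (2 * Real.pi))⁻¹ : ℝ) * ∫ y : Torus, _root_.fourier (-n) y * (u (x, y) : ℂ)

theorem lintegral_sq_lt_top (u : L2Cyl) : ∫⁻ p : Cyl, ‖u p‖ₑ ^ (2 : ℝ) < ∞ := by
  have h := (Lp.memLp u).eLpNorm_lt_top
  have := lintegral_rpow_enorm_lt_top_of_eLpNorm_lt_top (by norm_num) (by norm_num) h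
  simpa using this

theorem enorm_fourier (n : ℤ) (y : Torus) : ‖_root_.fourier n y‖ₑ = 1 := by
  rw [← ofReal_norm, fourier_apply, Circle.norm_coe, ENNReal.ofReal_one]

theorem section_memLp (u : L2Cyl) :
    ∀ᵐ x : ℝ, MemLp (fun y : Torus => u (x, y)) 2 volume := by
  have hm : AEStronglyMeasurable (u : Cyl → ℝ) ((volume : Measure ℝ).prod (volume : Measure Torus)) :=
    Lp.aestronglyMeasurable u
  have h2 : AEMeasurable (fun p : Cyl => ‖u p‖ₑ ^ (2 : ℝ))
      ((volume : Measure ℝ).prod (volume : Measure Torus)) := hm.enorm.pow_const _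
  have h3 := lintegral_sq_lt_top u
  replace h3 := (lintegral_prod _ h2).symm.trans_lt h3
  have h4 := ae_lt_top' h2.lintegral_prod_right' h3.ne
  filter_upwards [h4, hm.prodMk_left] with x hx hx'
  refine ⟨hx', ?_⟩
  rw [eLpNorm_lt_top_iff_lintegral_rpow_enorm_lt_top (by norm_num) (by norm_num)]
  simpa using hx

theorem section_integrable (u : L2Cyl) (n : ℤ) :
    ∀ᵐ x : ℝ, Integrable (fun y : Torus => _root_.fourier (-n) y * ((u (x, y) : ℝ) : ℂ)) := by
  filter_upwards [section_memLp u] with x hx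
  have h1 : Integrable (fun y : Torus => ((u (x, y) : ℝ) : ℂ)) :=
    (hx.integrable (by norm_num)).ofReal
  refine h1.bdd_mul (c := 1) (by fun_prop) (Filter.Eventually.of_forall fun y => ?_)
  rw [fourier_apply, Circle.norm_coe]

theorem memLp_modeFun (u : L2Cyl) (n : ℤ) :
    MemLp (modeFun u n) 2 (volume : Measure ℝ) := by
  have hm : AEStronglyMeasurable (u : Cyl → ℝ) ((volume : Measure ℝ).prod (volume : Measure Torus)) :=
    Lp.aestronglyMeasurable u
  have h2 : AEMeasurable (fun p : Cyl => ‖u p‖ₑ ^ (2 : ℝ))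
      ((volume : Measure ℝ).prod (volume : Measure Torus)) := hm.enorm.pow_const _
  unfold modeFun
  refine MemLp.const_mul ⟨?_, ?_⟩ _
  · have : AEStronglyMeasurable (fun p : Cyl => _root_.fourier (-n) p.2 * ((u p : ℝ) : ℂ))
        ((volume : Measure ℝ).prod (volume : Measure Torus)) := by
      refine AEStronglyMeasurable.mul ?_ ?_
      · exact (by fun_prop : Continuous fun p : Cyl => _root_.fourier (-n) p.2).aestronglyMeasurable
      · exact Complex.continuous_ofReal.comp_aestronglyMeasurable hm
    exact this.integral_prod_right'
  · rw [eLpNorm_lt_top_iff_lintegral_rpow_enorm_lt_top (by norm_num) (by norm_num)]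
    have h3 := lintegral_sq_lt_top u
    replace h3 := (lintegral_prod _ h2).symm.trans_lt h3
    set K : ℝ≥0∞ := (volume (Set.univ : Set Torus))
    have hK : K < ∞ := measure_lt_top _ _
    have key : ∀ᵐ x : ℝ, ‖∫ y : Torus, _root_.fourier (-n) y * ((u (x, y) : ℝ) : ℂ)‖ₑ ^ (2 : ℝ)
        ≤ K * ∫⁻ y : Torus, ‖u (x, y)‖ₑ ^ (2 : ℝ) := by
      filter_upwards [hm.prodMk_left] with x hx
      have e1 : ‖∫ y : Torus, _root_.fourier (-n) y * ((u (x, y) : ℝ) : ℂ)‖ₑ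
          ≤ ∫⁻ y : Torus, ‖u (x, y)‖ₑ := by
        refine (enorm_integral_le_lintegral_enorm _).trans (le_of_eq ?_)
        refine lintegral_congr fun y => ?_
        rw [enorm_mul]
        rw [enorm_fourier, one_mul, ← ofReal_norm, ← ofReal_norm, Complex.norm_real]
      have e2 : ∫⁻ y : Torus, ‖u (x, y)‖ₑ
          ≤ (∫⁻ y : Torus, ‖u (x, y)‖ₑ ^ (2 : ℝ)) ^ (1 / 2 : ℝ) * K ^ (1 / 2 : ℝ) := by
        have := ENNReal.lintegral_mul_le_Lp_mul_Lq (volume : Measure Torus)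
          Real.HolderConjugate.two_two (f := fun y => ‖u (x, y)‖ₑ) (g := fun _ => 1)
          hx.enorm aemeasurable_const
        simpa [K] using this
      calc _ ≤ ((∫⁻ y : Torus, ‖u (x, y)‖ₑ ^ (2 : ℝ)) ^ (1 / 2 : ℝ) * K ^ (1 / 2 : ℝ)) ^ (2 : ℝ) :=
            ENNReal.rpow_le_rpow (e1.trans e2) (by norm_num)
        _ = _ := by
            rw [ENNReal.mul_rpow_of_nonneg _ _ (by norm_num), ← ENNReal.rpow_mul,
              ← ENNReal.rpow_mul, mul_comm]
            norm_num
    have := (lintegral_mono_ae key).trans_lt (by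
      rw [lintegral_const_mul' _ _ hK.ne]
      exact ENNReal.mul_lt_top hK h3)
    simpa using this

theorem modeFun_add_ae (u v : L2Cyl) (n : ℤ) :
    modeFun (u + v : L2Cyl) n =ᵐ[volume] modeFun u n + modeFun v n := by
  have h0 : ∀ᵐ p ∂((volume : Measure ℝ).prod (volume : Measure Torus)),
      (u + v : L2Cyl) p = u p + v p := Lp.coeFn_add u v
  have h : ∀ᵐ x : ℝ, ∀ᵐ y : Torus, (u + v : L2Cyl) (x, y) = u (x, y) + v (x, y) :=
    Measure.ae_ae_of_ae_prod h0
  filter_upwards [h, section_integrable u n, section_integrable v n] with x hx hu hv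
  rw [Pi.add_apply, modeFun, modeFun, modeFun, ← mul_add, ← integral_add hu hv]
  congr 1
  refine integral_congr_ae ?_
  filter_upwards [hx] with y hy
  rw [hy, Complex.ofReal_add, mul_add]

theorem modeFun_smul_ae (r : ℝ) (u : L2Cyl) (n : ℤ) :
    modeFun (r • u : L2Cyl) n =ᵐ[volume] r • modeFun u n := by
  have h0 : ∀ᵐ p ∂((volume : Measure ℝ).prod (volume : Measure Torus)),
      (r • u : L2Cyl) p = r * u p := Lp.coeFn_smul r u
  have h : ∀ᵐ x : ℝ, ∀ᵐ y : Torus, (r • u : L2Cyl) (x, y) = r * u (x, y) :=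
    Measure.ae_ae_of_ae_prod h0
  filter_upwards [h] with x hx
  rw [Pi.smul_apply, modeFun, modeFun, Complex.real_smul, mul_left_comm]
  congr 1
  rw [← integral_const_mul]
  refine integral_congr_ae ?_
  filter_upwards [hx] with y hy
  rw [hy, Complex.ofReal_mul, mul_left_comm]

/-- `u ↦ u_n` as a linear map from `L²(ℝ × 𝕋)` to complex `L²(ℝ)`. -/
def mode (n : ℤ) : L2Cyl →ₗ[ℝ] Lp ℂ 2 (volume : Measure ℝ) where
  toFun u := (memLp_modeFun u n).toLp (modeFun u n)
  map_add' u v :=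
    (MemLp.toLp_congr _ ((memLp_modeFun u n).add (memLp_modeFun v n))
      (modeFun_add_ae u v n)).trans (MemLp.toLp_add _ _)
  map_smul' r u :=
    (MemLp.toLp_congr _ ((memLp_modeFun u n).const_smul r)
      (modeFun_smul_ae r u n)).trans (MemLp.toLp_const_smul _ _)

/-- The Fourier transform on the cylinder, `û(·, n) = 𝓕_x u_n ∈ L²(ℝ)`, where `𝓕_x` is the `L²`
Fourier transform with kernel `e^{-2πixζ}`. Thus the dual variable `ζ` is `ξ / 2π`. -/
def cylFourier (n : ℤ) (u : L2Cyl) : Lp ℂ 2 (volume : Measure ℝ) := 𝓕 (mode n u)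

theorem cylFourier_add (n : ℤ) (u v : L2Cyl) :
    cylFourier n (u + v) = cylFourier n u + cylFourier n v := by
  simp [cylFourier, FourierTransform.fourier_add]

theorem cylFourier_smul (n : ℤ) (r : ℝ) (u : L2Cyl) :
    cylFourier n (r • u) = (r : ℂ) • cylFourier n u := by
  have : mode n (r • u) = (r : ℂ) • mode n u := by
    rw [map_smul]; rfl
  rw [cylFourier, this, FourierTransform.fourier_smul]; rfl

/-- `a = m(D) u` in `L²`, i.e. `â(ξ, n) = m(ξ, n) û(ξ, n)` for every `n` and almost every `ξ`
(with `ξ = 2πζ`). -/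
def IsMultiplier (m : ℝ → ℤ → ℂ) (u a : L2Cyl) : Prop :=
  ∀ n : ℤ, ∀ᵐ ζ : ℝ, cylFourier n a ζ = m (2 * Real.pi * ζ) n * cylFourier n u ζ

/-- The symbol `iξ` of `∂_x`. -/
def symDx (ξ : ℝ) (_n : ℤ) : ℂ := Complex.I * ξ

/-- The symbol `(iξ)⁻¹ (in)` of `∂_x⁻¹ ∂_y`. -/
def symDxInvDy (ξ : ℝ) (n : ℤ) : ℂ := (Complex.I * ξ)⁻¹ * (Complex.I * n)

theorem IsMultiplier.add {m : ℝ → ℤ → ℂ} {u a v b : L2Cyl}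
    (h : IsMultiplier m u a) (h' : IsMultiplier m v b) : IsMultiplier m (u + v) (a + b) := by
  intro n
  rw [cylFourier_add, cylFourier_add]
  filter_upwards [h n, h' n, Lp.coeFn_add (cylFourier n a) (cylFourier n b),
    Lp.coeFn_add (cylFourier n u) (cylFourier n v)] with ζ h1 h2 h3 h4
  rw [h3, h4, Pi.add_apply, Pi.add_apply, h1, h2, mul_add]

theorem IsMultiplier.smul {m : ℝ → ℤ → ℂ} {u a : L2Cyl} (r : ℝ)
    (h : IsMultiplier m u a) : IsMultiplier m (r • u) (r • a) := by
  intro n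
  rw [cylFourier_smul, cylFourier_smul]
  filter_upwards [h n, Lp.coeFn_smul (r : ℂ) (cylFourier n a),
    Lp.coeFn_smul (r : ℂ) (cylFourier n u)] with ζ h1 h2 h3
  rw [h2, h3, Pi.smul_apply, Pi.smul_apply, h1, smul_eq_mul, smul_eq_mul, mul_left_comm]

theorem isMultiplier_zero (m : ℝ → ℤ → ℂ) : IsMultiplier m 0 0 := by
  intro n
  have h0 : cylFourier n 0 = 0 := by simpa using cylFourier_smul n 0 0
  rw [h0]
  filter_upwards [Lp.coeFn_zero ℂ 2 (volume : Measure ℝ)] with ζ h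
  rw [h]; simp

/-- The energy space `𝓔(ℝ × 𝕋)` of all `u ∈ L²` with `∂_x u ∈ L²` and `∂_x⁻¹ ∂_y u ∈ L²`.
An element is recorded as the triple `(u, ∂_x u, ∂_x⁻¹ ∂_y u)`, which `u` determines
(`EnergySpace.ext_fn` below), so that the norm inherited from `L² ⊕ L² ⊕ L²` is
`‖u‖²_𝓔 = ‖u‖² + ‖∂_x u‖² + ‖∂_x⁻¹ ∂_y u‖²` (`EnergySpace.norm_sq` below). -/
def energySubmodule : Submodule ℝ (PiLp 2 (fun _ : Fin 3 => L2Cyl)) where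
  carrier := {w | IsMultiplier symDx (w 0) (w 1) ∧ IsMultiplier symDxInvDy (w 0) (w 2)}
  add_mem' h h' := ⟨h.1.add h'.1, h.2.add h'.2⟩
  zero_mem' := ⟨isMultiplier_zero _, isMultiplier_zero _⟩
  smul_mem' r _ h := ⟨h.1.smul r, h.2.smul r⟩

/-- The energy space as a type, with the (complete) norm of `energySubmodule`. -/
abbrev EnergySpace : Type := energySubmodule

namespace EnergySpace

/-- The underlying `L²` function. -/
def fn (v : EnergySpace) : L2Cyl := (v : PiLp 2 (fun _ : Fin 3 => L2Cyl)) 0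

/-- `∂_x v`. -/
def dx (v : EnergySpace) : L2Cyl := (v : PiLp 2 (fun _ : Fin 3 => L2Cyl)) 1

/-- `∂_x⁻¹ ∂_y v`. -/
def dxInvDy (v : EnergySpace) : L2Cyl := (v : PiLp 2 (fun _ : Fin 3 => L2Cyl)) 2

theorem norm_sq (v : EnergySpace) :
    ‖v‖ ^ 2 = ‖v.fn‖ ^ 2 + ‖v.dx‖ ^ 2 + ‖v.dxInvDy‖ ^ 2 := by
  have := PiLp.norm_sq_eq_of_L2 (fun _ : Fin 3 => L2Cyl) (v : PiLp 2 (fun _ : Fin 3 => L2Cyl))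
  rw [Fin.sum_univ_three] at this
  exact this

end EnergySpace

/-- An `L²` function all of whose Fourier modes vanish is zero. -/
theorem eq_of_mode_eq {a b : L2Cyl} (h : ∀ n, mode n a = mode n b) : a = b := by
  rw [← sub_eq_zero]
  set d : L2Cyl := a - b with hd
  have hz : ∀ n, mode n d = 0 := fun n => by rw [hd, map_sub, h n, sub_self]
  have h1 : ∀ᵐ x : ℝ, ∀ n : ℤ, modeFun d n x = 0 := by
    rw [ae_all_iff]
    intro n
    have e1 : (mode n d : ℝ → ℂ) =ᵐ[volume] modeFun d n := (memLp_modeFun d n).coeFn_toLp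
    have e2 := Lp.coeFn_zero ℂ 2 (volume : Measure ℝ)
    rw [hz n] at e1
    filter_upwards [e1, e2] with x h1 h2
    rw [← h1, h2]; rfl
  have h2 : ∀ᵐ x : ℝ, ∀ᵐ y : Torus, d (x, y) = 0 := by
    filter_upwards [h1, section_memLp d] with x hx hmem
    have hmem' : MemLp (fun y : Torus => ((d (x, y) : ℝ) : ℂ)) 2
        (AddCircle.haarAddCircle : Measure Torus) := by
      have hv : MemLp (fun y : Torus => ((d (x, y) : ℝ) : ℂ)) 2 (volume : Measure Torus) :=
        hmem.ofReal
      rw [AddCircle.volume_eq_smul_haarAddCircle] at hv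
      refine MemLp.of_measure_le_smul (c := (ENNReal.ofReal (2 * Real.pi))⁻¹) ?_ ?_ hv
      · exact ENNReal.inv_ne_top.2 (by simp [Real.pi_pos])
      · rw [smul_smul, ENNReal.inv_mul_cancel (by simp [Real.pi_pos]) ENNReal.ofReal_ne_top,
          one_smul]
    have hc : ∀ n, fourierCoeff (hmem'.toLp _ : Torus → ℂ) n = 0 := by
      intro n
      rw [fourierCoeff_congr_ae hmem'.coeFn_toLp]
      have h0 := hx n
      rw [modeFun, mul_eq_zero] at h0
      have h0 := h0.resolve_left (by
        simp [Real.sqrt_eq_zero', Real.pi_pos])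
      rw [AddCircle.volume_eq_smul_haarAddCircle, integral_smul_measure] at h0
      have h0 := (smul_eq_zero.1 h0).resolve_left (by
        rw [ENNReal.toReal_ofReal Real.two_pi_pos.le]; exact Real.two_pi_pos.ne')
      simpa [fourierCoeff] using h0
    have hL : hmem'.toLp _ = 0 := by
      apply (fourierBasis (T := 2 * Real.pi)).repr.injective
      ext n
      rw [fourierBasis_repr, hc n, map_zero]; rfl
    have e3 := hmem'.coeFn_toLp
    rw [hL] at e3
    have e4 : ∀ᵐ y ∂(AddCircle.haarAddCircle : Measure Torus), d (x, y) = 0 := by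
      filter_upwards [e3, Lp.coeFn_zero ℂ 2 (AddCircle.haarAddCircle : Measure Torus)]
        with y h1 h2
      rw [h2] at h1
      rw [Pi.zero_apply] at h1
      exact_mod_cast h1.symm
    rw [AddCircle.volume_eq_smul_haarAddCircle]
    exact Measure.ae_smul_measure e4 _
  rw [Lp.eq_zero_iff_ae_eq_zero]
  have hm : AEStronglyMeasurable (d : Cyl → ℝ) ((volume : Measure ℝ).prod (volume : Measure Torus)) :=
    Lp.aestronglyMeasurable d
  have h3 : ∫⁻ p : Cyl, ‖d p‖ₑ = 0 := by
    refine (lintegral_prod _ hm.enorm).trans ?_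
    rw [lintegral_eq_zero_iff' hm.enorm.lintegral_prod_right']
    filter_upwards [h2] with x hx
    rw [Pi.zero_apply, lintegral_eq_zero_iff' (by
      exact (aemeasurable_const (b := (0 : ℝ≥0∞))).congr (by
        filter_upwards [hx] with y hy; simp [hy]))]
    filter_upwards [hx] with y hy
    simp [hy]
  replace h3 := (lintegral_eq_zero_iff' hm.enorm).1 h3
  filter_upwards [h3] with p hp
  simpa using hp

theorem IsMultiplier.unique {m : ℝ → ℤ → ℂ} {u a b : L2Cyl}
    (h : IsMultiplier m u a) (h' : IsMultiplier m u b) : a = b := by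
  refine eq_of_mode_eq fun n => ?_
  apply (Lp.fourierTransformₗᵢ ℝ ℂ).injective
  change cylFourier n a = cylFourier n b
  refine Lp.ext ?_
  filter_upwards [h n, h' n] with ζ h1 h2
  rw [h1, h2]

/-- An element of the energy space is determined by its underlying `L²` function. -/
theorem EnergySpace.ext_fn {v w : EnergySpace} (h : v.fn = w.fn) : v = w := by
  apply Subtype.ext
  ext1 i
  have hw1 := w.2.1
  have hw2 := w.2.2
  change IsMultiplier symDx w.fn w.dx at hw1
  change IsMultiplier symDxInvDy w.fn w.dxInvDy at hw2
  rw [← h] at hw1 hw2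
  fin_cases i
  · exact h
  · exact IsMultiplier.unique v.2.1 hw1
  · exact IsMultiplier.unique v.2.2 hw2

/-- The soliton profile `φ_c(x) = c cosh⁻²(√(c/2) x)`. -/
def soliton (c x : ℝ) : ℝ := c / Real.cosh (Real.sqrt (c / 2) * x) ^ 2

/-- The kink `Q_c(x) = √(c/2) tanh(√(c/2) x)`. -/
def kink (c x : ℝ) : ℝ := Real.sqrt (c / 2) * Real.tanh (Real.sqrt (c / 2) * x)

/-- The Miura transform `M^k_+(w) = ∂_x w + ∂_x⁻¹ ∂_y w - w² + k/2` of `w = q + v`, where `q` is a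
differentiable function of `x` alone (so that `∂_x⁻¹ ∂_y q = 0`) and `v` is in the energy space. -/
def miuraPlus (k : ℝ) (q : ℝ → ℝ) (v : EnergySpace) (p : Cyl) : ℝ :=
  (deriv q p.1 + v.dx p) + v.dxInvDy p - (q p.1 + v.fn p) ^ 2 + k / 2

end KPMiura

end

/-! Write k = 2a², a₀ = √(c/2), let Q be the kink of amplitude a (`kinkA`) and S = Q' (`sechA`).
Since Q' + Q² = a², the Miura transform of Q is exactly the soliton 2S, and the equation becomes
F(a, v) = σ(a) - σ(a₀) + L_a v - v² = u, where σ(a) = 2S and L_a v = ∂_x v + ∂_x⁻¹∂_y v - 2Qv. The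
square lies in L² because the energy space embeds in L⁴ (`exists_four_bound`).

Existence and C¹ dependence come from the inverse function theorem at (a₀, 0). The operator L_a is
injective (`linOp_injective`) and its range is the orthogonal complement of η = S
(`inner_linOp_eta`, `exists_linOp_eq`); the derivative p of σ at a₀ is not orthogonal to η
(`integral_dsech_mul_pos`), so (κ, v) ↦ κp + L v is an isomorphism (`augOp_bijective`). Since Q does
not depend on y, L_a acts separately on the mean in y and on the remaining modes. On the mean it is
an ordinary differential operator, bounded below. On the other modes w = ∂_x D, and pairing the
adjoint with D gives a bound from below (`norm_le_adjOp`); Lax–Milgram and the symbol ξ² - in then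
give surjectivity.

Uniqueness is harder, since ε need not be small: every solution in the given ball has to be shown
close to (a₀, 0) once u is small, and only then does the local uniqueness apply. The tool is the
Cole–Hopf substitution: with V an x-antiderivative of v, the factor ρ = e^{-V} satisfies ∂_x²ρ +
∂_yρ = -ρ(∂_x v + ∂_x⁻¹∂_y v - v²), so the square disappears.

For the amplitude, the equation is tested against e^{-V} sech(ax) sech(a₀x). Everything cancels
except (a² - a₀²) ∫ e^{-V} sech(ax) sech(a₀x) = ⟨u, e^{-V} sech(ax) sech(a₀x)⟩, which gives |a² -
a₀²| ≤ C‖u‖ (`amplitude_identity`, `exists_amplitude_bound`).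

For the smallness of v, all error terms are first absorbed in a small correction h, leaving w = v -
h with L w = κp + (h + w)². The integrals of this source over strips are bounded, which forces the
antiderivative of w to be bounded (`abs_V₀_le_of_linOp_eq`). The gauge transform r = -ρw is then
comparable to w and solves a linear equation with small source, so r is small; hence w² is small,
and the bound from below on L makes w small (`exists_gauge_bound`, `exists_norm_lt_of_miuraF_eq`).
-/

noncomputable section

open MeasureTheory FourierTransform
open scoped ENNReal

namespace KPMiura

open scoped SchwartzMap BoundedContinuousFunction
open Filter Topology

/-! ### Fourier multipliers on the line -/

/-- Complex `L²(ℝ)`. -/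
abbrev L2Line : Type := Lp ℂ 2 (volume : Measure ℝ)

/-- The L² transform agrees with the transform of tempered distributions, which is defined by
duality. The properties of L² transforms needed below are checked by testing in this form. -/
theorem integral_fourier_mul (a : L2Line) (θ : 𝓢(ℝ, ℂ)) :
    ∫ ζ, (𝓕 a : L2Line) ζ * θ ζ = ∫ x, a x * (𝓕 θ : 𝓢(ℝ, ℂ)) x := by
  have h := congrArg (fun T => T θ) (Lp.fourier_toTemperedDistribution_eq a)
  simp only [TemperedDistribution.fourier_apply, Lp.toTemperedDistribution_apply,
    smul_eq_mul] at h
  simpa only [mul_comm] using h.symm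

theorem ae_eq_zero_of_forall_schwartz {F : ℝ → ℂ} (hF : LocallyIntegrable F)
    (h : ∀ θ : 𝓢(ℝ, ℂ), ∫ ζ, F ζ * θ ζ = 0) : ∀ᵐ ζ, F ζ = 0 := by
  refine ae_eq_zero_of_integral_contDiff_smul_eq_zero hF fun g hg hgc => ?_
  have hg' : ContDiff ℝ (↑(⊤ : ℕ∞)) (fun x => (g x : ℂ)) :=
    Complex.ofRealCLM.contDiff.comp hg
  have hc : HasCompactSupport (fun x => (g x : ℂ)) := hgc.comp_left (g := fun r : ℝ => (r : ℂ)) (by simp)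
  have := h (hc.toSchwartzMap hg')
  simpa [mul_comm] using this

theorem ae_eq_of_forall_schwartz {F G : ℝ → ℂ} (hF : LocallyIntegrable F)
    (hG : LocallyIntegrable G) (hFi : ∀ θ : 𝓢(ℝ, ℂ), Integrable fun ζ => F ζ * θ ζ)
    (hGi : ∀ θ : 𝓢(ℝ, ℂ), Integrable fun ζ => G ζ * θ ζ)
    (h : ∀ θ : 𝓢(ℝ, ℂ), ∫ ζ, F ζ * θ ζ = ∫ ζ, G ζ * θ ζ) : ∀ᵐ ζ, F ζ = G ζ := by
  have := ae_eq_zero_of_forall_schwartz (hF.sub hG) fun θ => by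
    simp only [Pi.sub_apply, sub_mul]
    rw [integral_sub (hFi θ) (hGi θ), h θ, sub_self]
  filter_upwards [this] with ζ hζ
  exact sub_eq_zero.1 hζ

theorem _root_.MeasureTheory.MemLp.integrable_mul_schwartz {F : ℝ → ℂ} (hF : MemLp F 2) (θ : 𝓢(ℝ, ℂ)) :
    Integrable fun ζ => F ζ * θ ζ :=
  hF.integrable_mul (θ.memLp 2)

theorem L2Line.locallyIntegrable (a : L2Line) : LocallyIntegrable (a : ℝ → ℂ) :=
  (Lp.memLp a).locallyIntegrable (by norm_num)

/-- Multiplication of a Schwartz function by the coordinate. -/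
def mulCoord (θ : 𝓢(ℝ, ℂ)) : 𝓢(ℝ, ℂ) :=
  SchwartzMap.smulLeftCLM ℂ (fun x : ℝ => (x : ℂ)) θ

theorem mulCoord_apply (θ : 𝓢(ℝ, ℂ)) (x : ℝ) : mulCoord θ x = x * θ x := by
  rw [mulCoord, SchwartzMap.smulLeftCLM_apply]
  · rfl
  · exact Complex.ofRealCLM.hasTemperateGrowth

theorem hasDerivAt_fourier_schwartz (θ : 𝓢(ℝ, ℂ)) (x : ℝ) :
    HasDerivAt (𝓕 θ : 𝓢(ℝ, ℂ))
      ((𝓕 ((-(2 * Real.pi * Complex.I) : ℂ) • mulCoord θ) : 𝓢(ℝ, ℂ)) x) x := by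
  have h := Real.hasDerivAt_fourier (f := θ) θ.integrable
    ((mulCoord θ).integrable.congr (by
      filter_upwards with x; rw [mulCoord_apply]; simp)) x
  rw [SchwartzMap.fourier_coe, SchwartzMap.fourier_coe]
  convert! h using 2
  ext y
  simp only [smul_apply, mulCoord_apply, smul_eq_mul]
  ring

/-- Integration by parts against the Schwartz function 𝓕θ. The product and its derivative are
integrable, so there is no boundary term. -/
theorem fourier_ae_eq_of_hasDerivAt {f g : ℝ → ℂ} (hf : MemLp f 2) (hg : MemLp g 2)
    (hfg : ∀ x, HasDerivAt f (g x) x) :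
    ∀ᵐ ζ, (𝓕 (hg.toLp g) : L2Line) ζ =
      (2 * Real.pi * Complex.I * ζ) * (𝓕 (hf.toLp f) : L2Line) ζ := by
  set F : L2Line := 𝓕 (hf.toLp f)
  have hi : ∀ θ : 𝓢(ℝ, ℂ), ∀ ζ : ℝ, (2 * Real.pi * Complex.I * ζ) * F ζ * θ ζ =
      F ζ * ((2 * Real.pi * Complex.I : ℂ) • mulCoord θ) ζ := fun θ ζ => by
    simp only [smul_apply, mulCoord_apply, smul_eq_mul]; ring
  refine ae_eq_of_forall_schwartz (L2Line.locallyIntegrable _) ?_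
    (fun θ => (Lp.memLp _).integrable_mul_schwartz θ) ?_ ?_
  · exact (L2Line.locallyIntegrable F).continuous_mul (by fun_prop)
  · intro θ
    simp only [hi]
    exact (Lp.memLp _).integrable_mul_schwartz _
  · intro θ
    simp only [hi]
    rw [integral_fourier_mul, integral_fourier_mul]
    set θ' : 𝓢(ℝ, ℂ) := (-(2 * Real.pi * Complex.I) : ℂ) • mulCoord θ
    have hθ' : (2 * Real.pi * Complex.I : ℂ) • mulCoord θ = -θ' := by simp [θ']
    have e1 : ∫ x, (hg.toLp g) x * (𝓕 θ : 𝓢(ℝ, ℂ)) x = ∫ x, g x * (𝓕 θ : 𝓢(ℝ, ℂ)) x := by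
      refine integral_congr_ae ?_
      filter_upwards [hg.coeFn_toLp] with x hx
      rw [hx]
    have e2 : ∫ x, (hf.toLp f) x * (𝓕 (-θ') : 𝓢(ℝ, ℂ)) x
        = - ∫ x, f x * (𝓕 θ' : 𝓢(ℝ, ℂ)) x := by
      rw [← integral_neg]
      refine integral_congr_ae ?_
      filter_upwards [hf.coeFn_toLp] with x hx
      rw [hx]
      have : (𝓕 (-θ') : 𝓢(ℝ, ℂ)) = - 𝓕 θ' := by
        rw [← neg_one_smul ℂ θ', FourierTransform.fourier_smul]; simp
      rw [this]; simp
    rw [hθ', e1, e2]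
    have h3 := integral_eq_zero_of_hasDerivAt_of_integrable
      (f := fun x => f x * (𝓕 θ : 𝓢(ℝ, ℂ)) x)
      (f' := fun x => g x * (𝓕 θ : 𝓢(ℝ, ℂ)) x + f x * (𝓕 θ' : 𝓢(ℝ, ℂ)) x)
      (fun x => (hfg x).mul (hasDerivAt_fourier_schwartz θ x))
      ((hg.integrable_mul_schwartz _).add (hf.integrable_mul_schwartz _))
      (hf.integrable_mul_schwartz _)
    rw [integral_add (hg.integrable_mul_schwartz _) (hf.integrable_mul_schwartz _)] at h3
    exact eq_neg_of_add_eq_zero_left h3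

/-- Conjugating the kernel e^{-2πixζ} amounts to reflecting ζ. Real test functions suffice, so on
their side only the reflection is visible. This is how real-valuedness on the cylinder is expressed
in Fourier variables. -/
theorem fourier_star_ae (a : L2Line) :
    ∀ᵐ ζ, (𝓕 (star a) : L2Line) ζ = star ((𝓕 a : L2Line) (-ζ)) := by
  have hm : MemLp (fun ζ => star ((𝓕 a : L2Line) (-ζ))) 2 (volume : Measure ℝ) :=
    ((Lp.memLp (𝓕 a : L2Line)).comp_measurePreserving (Measure.measurePreserving_neg volume)).star
  have hL : LocallyIntegrable (fun ζ => star ((𝓕 a : L2Line) (-ζ))) (volume : Measure ℝ) :=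
    hm.locallyIntegrable (by norm_num)
  have key := ae_eq_zero_of_integral_contDiff_smul_eq_zero
    ((L2Line.locallyIntegrable (𝓕 (star a))).sub hL) ?_
  · filter_upwards [key] with ζ hζ
    exact sub_eq_zero.1 hζ
  intro g hg hgc
  have hg' : ContDiff ℝ (↑(⊤ : ℕ∞)) (fun x => (g x : ℂ)) := Complex.ofRealCLM.contDiff.comp hg
  have hc : HasCompactSupport (fun x => (g x : ℂ)) := hgc.comp_left (g := fun r : ℝ => (r : ℂ)) (by simp)
  set θ := hc.toSchwartzMap hg'
  have hθ : ∀ x, θ x = g x := fun x => rfl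
  have hg2 : ContDiff ℝ (↑(⊤ : ℕ∞)) (fun x => (g (-x) : ℂ)) := hg'.comp contDiff_neg
  have hc2 : HasCompactSupport (fun x => (g (-x) : ℂ)) := hc.comp_homeomorph (Homeomorph.neg ℝ)
  set θ2 := hc2.toSchwartzMap hg2
  have hθ2 : ∀ x, θ2 x = g (-x) := fun x => rfl
  have hF : ∀ x, (𝓕 θ : 𝓢(ℝ, ℂ)) x = star ((𝓕 θ2 : 𝓢(ℝ, ℂ)) x) := by
    intro x
    rw [SchwartzMap.fourier_coe, SchwartzMap.fourier_coe, Real.fourier_eq', Real.fourier_eq']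
    rw [← integral_neg_eq_self]
    rw [Complex.star_def, ← integral_conj]
    refine integral_congr_ae (Filter.Eventually.of_forall fun y => ?_)
    simp [hθ, hθ2, ← Complex.exp_conj, Complex.conj_ofNat]
  have e1 := integral_fourier_mul (star a) θ
  have e2 := integral_fourier_mul a θ2
  simp only [Pi.sub_apply, smul_sub]
  have i1 : Integrable fun x => g x • (𝓕 (star a) : L2Line) x := by
    have := (Lp.memLp (𝓕 (star a) : L2Line)).integrable_mul_schwartz θ
    simpa [hθ, mul_comm] using this
  have i2 : Integrable fun x => g x • star ((𝓕 a : L2Line) (-x)) := by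
    have := hm.integrable_mul_schwartz θ
    simpa [hθ, mul_comm] using this
  rw [integral_sub i1 i2, sub_eq_zero]
  calc ∫ x, g x • (𝓕 (star a) : L2Line) x = ∫ ζ, (𝓕 (star a) : L2Line) ζ * θ ζ := by
        refine integral_congr_ae (Filter.Eventually.of_forall fun y => ?_)
        simp [hθ, mul_comm]
    _ = star (∫ x, a x * (𝓕 θ2 : 𝓢(ℝ, ℂ)) x) := by
        rw [e1, Complex.star_def, ← integral_conj]
        refine integral_congr_ae ?_
        filter_upwards [Lp.coeFn_star a] with x hx
        rw [hx, hF]; simp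
    _ = star (∫ ζ, (𝓕 a : L2Line) ζ * θ2 ζ) := by rw [e2]
    _ = _ := by
        rw [← integral_neg_eq_self, Complex.star_def, ← integral_conj]
        refine integral_congr_ae (Filter.Eventually.of_forall fun y => ?_)
        simp [hθ2, mul_comm]

/-! ### Fourier series in `y` -/

theorem integral_torus_fourier (k : ℤ) :
    ∫ y : Torus, _root_.fourier k y = if k = 0 then (2 * Real.pi : ℂ) else 0 := by
  have h1 := orthonormal_iff_ite.1 (orthonormal_fourier (T := 2 * Real.pi)) 0 k
  rw [ContinuousMap.inner_toLp (𝕜 := ℂ) AddCircle.haarAddCircle (_root_.fourier 0) (_root_.fourier k),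
    AddCircle.integral_haarAddCircle] at h1
  simp only [_root_.fourier_zero, map_one, mul_one] at h1
  split_ifs at h1 ⊢ with h2 h3 h3
  · rw [inv_smul_eq_iff₀ Real.two_pi_pos.ne'] at h1
    rw [h1]; simp
  · exact absurd h2.symm h3
  · exact absurd h3.symm h2
  · rw [inv_smul_eq_iff₀ Real.two_pi_pos.ne'] at h1
    rw [h1]; simp

theorem modeFun_congr {u v : Cyl → ℝ} (h : u =ᵐ[volume] v) (n : ℤ) :
    modeFun u n =ᵐ[volume] modeFun v n := by
  have h' : ∀ᵐ x : ℝ, ∀ᵐ y : Torus, u (x, y) = v (x, y) := Measure.ae_ae_of_ae_prod h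
  filter_upwards [h'] with x hx
  unfold modeFun
  congr 1
  refine integral_congr_ae ?_
  filter_upwards [hx] with y hy
  rw [hy]

theorem mode_coeFn (u : L2Cyl) (n : ℤ) : (mode n u : ℝ → ℂ) =ᵐ[volume] modeFun u n :=
  (memLp_modeFun u n).coeFn_toLp

/-- The real part of `f(x) e^{iny}`. -/
def wave (n : ℤ) (f : ℝ → ℂ) (p : Cyl) : ℝ := (f p.1 * _root_.fourier n p.2).re

theorem norm_fourier_torus (n : ℤ) (y : Torus) : ‖_root_.fourier n y‖ = 1 := by
  rw [fourier_apply, Circle.norm_coe]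

theorem abs_wave_le (n : ℤ) (f : ℝ → ℂ) (p : Cyl) : |wave n f p| ≤ ‖f p.1‖ := by
  refine (Complex.abs_re_le_norm _).trans ?_
  rw [norm_mul, norm_fourier_torus, mul_one]

theorem memLp_wave {q : ℝ≥0∞} (n : ℤ) {f : ℝ → ℂ} (hf : MemLp f q) :
    MemLp (wave n f) q (volume : Measure Cyl) := by
  have h1 : MemLp (fun p : Cyl => f p.1) q (volume : Measure Cyl) :=
    hf.comp_fst (volume : Measure Torus)
  refine h1.of_le ?_ (Filter.Eventually.of_forall fun p => ?_)
  · have h2 : AEStronglyMeasurable (fun p : Cyl => _root_.fourier n p.2) (volume : Measure Cyl) :=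
      (by fun_prop : Continuous fun p : Cyl => _root_.fourier n p.2).aestronglyMeasurable
    exact Complex.continuous_re.comp_aestronglyMeasurable (h1.aestronglyMeasurable.mul h2)
  · rw [Real.norm_eq_abs]; exact abs_wave_le n f p

/-- A real part is half the sum of a number and its conjugate, so the wave occupies the modes n and
-n. For n = 0 both indicators are active and add up to twice the real part. -/
theorem modeFun_wave (n m : ℤ) (f : ℝ → ℂ) (x : ℝ) :
    modeFun (wave n f) m x = (Real.sqrt (2 * Real.pi) / 2 : ℝ) *
      ((if m = n then f x else 0) + (if m = -n then star (f x) else 0)) := by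
  have e : ∀ y : Torus, _root_.fourier (-m) y * ((wave n f (x, y) : ℝ) : ℂ) =
      (f x / 2) * _root_.fourier (n - m) y + (star (f x) / 2) * _root_.fourier (-n - m) y := by
    intro y
    have h1 : ((wave n f (x, y) : ℝ) : ℂ) =
        (f x * _root_.fourier n y + star (f x) * _root_.fourier (-n) y) / 2 := by
      rw [wave, Complex.re_eq_add_conj, map_mul, fourier_neg]; rfl
    rw [h1, sub_eq_add_neg, sub_eq_add_neg, _root_.fourier_add, _root_.fourier_add]
    ring
  have hi : ∀ k : ℤ, Integrable (fun y : Torus => _root_.fourier k y) := fun k =>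
    (map_continuous _).integrable_of_hasCompactSupport (HasCompactSupport.of_compactSpace _)
  unfold modeFun
  simp only [e]
  rw [integral_add ((hi _).const_mul _) ((hi _).const_mul _), integral_const_mul,
    integral_const_mul, integral_torus_fourier, integral_torus_fourier]
  have e1 : (n - m = 0) ↔ (m = n) := by omega
  have e2 : (-n - m = 0) ↔ (m = -n) := by omega
  simp only [e1, e2]
  have h3 : (Real.sqrt (2 * Real.pi))⁻¹ * (2 * Real.pi) = Real.sqrt (2 * Real.pi) := by
    have := Real.sqrt_pos.2 Real.two_pi_pos
    field_simp
    rw [Real.sq_sqrt Real.two_pi_pos.le]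
  have h4 : (((Real.sqrt (2 * Real.pi))⁻¹ : ℝ) : ℂ) * (2 * Real.pi) = (Real.sqrt (2 * Real.pi) : ℝ) := by
    exact_mod_cast congrArg (fun r : ℝ => (r : ℂ)) h3
  have a1 : ∀ (P : Prop) [Decidable P] (z : ℂ),
      (if P then z else 0) = (if P then 1 else 0) * z := fun P _ z => by split_ifs <;> simp
  rw [a1 (m = n) (2 * Real.pi), a1 (m = -n) (2 * Real.pi), a1 (m = n) (f x),
    a1 (m = -n) (star (f x))]
  push_cast at h4 ⊢
  linear_combination ((if m = n then 1 else 0) * f x / 2 +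
    (if m = -n then 1 else 0) * star (f x) / 2) * h4

/-- `Re (f(x) e^{iny})` as an element of `L²(ℝ × 𝕋)`. -/
def synth (n : ℤ) (f : L2Line) : L2Cyl := (memLp_wave n (Lp.memLp f)).toLp (wave n f)

theorem mode_synth (n m : ℤ) (f : L2Line) :
    mode m (synth n f) = (Real.sqrt (2 * Real.pi) / 2 : ℝ) •
      ((if m = n then f else 0) + (if m = -n then star f else 0)) := by
  refine Lp.ext ?_
  have h1 : (synth n f : Cyl → ℝ) =ᵐ[volume] wave n f := MemLp.coeFn_toLp _
  filter_upwards [mode_coeFn (synth n f) m, modeFun_congr h1 m, Lp.coeFn_star f,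
    Lp.coeFn_smul (Real.sqrt (2 * Real.pi) / 2 : ℝ)
      ((if m = n then f else 0) + (if m = -n then star f else 0)),
    Lp.coeFn_add (if m = n then f else 0) (if m = -n then star f else 0),
    Lp.coeFn_zero ℂ 2 (volume : Measure ℝ)] with x h2 h3 h4 h5 h6 h7
  rw [h2, h3, h5, modeFun_wave, Pi.smul_apply, h6, Complex.real_smul, Pi.add_apply]
  congr 2
  · split_ifs
    · rfl
    · exact h7.symm
  · split_ifs
    · exact h4.symm
    · exact h7.symm

theorem enorm_sq_eq_lintegral {α : Type*} {m : MeasurableSpace α} {μ : Measure α} {E : Type*}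
    [NormedAddCommGroup E] (f : Lp E 2 μ) : ‖f‖ₑ ^ 2 = ∫⁻ x, ‖f x‖ₑ ^ 2 ∂μ := by
  rw [Lp.enorm_def, eLpNorm_eq_lintegral_rpow_enorm_toReal (by norm_num) (by norm_num)]
  rw [← ENNReal.rpow_natCast, ← ENNReal.rpow_mul]
  simp

theorem tsum_enorm_modeFun_sq (u : L2Cyl) :
    ∀ᵐ x : ℝ, ∑' n : ℤ, ‖modeFun u n x‖ₑ ^ 2 = ∫⁻ y : Torus, ‖u (x, y)‖ₑ ^ 2 := by
  filter_upwards [section_memLp u] with x hv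
  have hvol : (volume : Measure Torus) =
      ENNReal.ofReal (2 * Real.pi) • (AddCircle.haarAddCircle : Measure Torus) :=
    AddCircle.volume_eq_smul_haarAddCircle
  have hc0 : ENNReal.ofReal (2 * Real.pi) ≠ 0 := by simp [Real.pi_pos]
  have hmem' : MemLp (fun y : Torus => ((u (x, y) : ℝ) : ℂ)) 2
      (AddCircle.haarAddCircle : Measure Torus) := by
    have hv : MemLp (fun y : Torus => ((u (x, y) : ℝ) : ℂ)) 2 (volume : Measure Torus) := hv.ofReal
    rw [hvol] at hv
    refine MemLp.of_measure_le_smul (c := (ENNReal.ofReal (2 * Real.pi))⁻¹) ?_ ?_ hv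
    · exact ENNReal.inv_ne_top.2 hc0
    · rw [smul_smul, ENNReal.inv_mul_cancel hc0 ENNReal.ofReal_ne_top, one_smul]
  have hs := hasSum_sq_fourierCoeff (hmem'.toLp _)
  have e1 : ∀ n, fourierCoeff (hmem'.toLp _ : Torus → ℂ) n =
      ((Real.sqrt (2 * Real.pi))⁻¹ : ℝ) * modeFun u n x := by
    intro n
    rw [fourierCoeff_congr_ae hmem'.coeFn_toLp, fourierCoeff, modeFun,
      AddCircle.integral_haarAddCircle, ← mul_assoc, ← Complex.ofReal_mul, ← mul_inv,
      Real.mul_self_sqrt Real.two_pi_pos.le, Complex.real_smul]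
    rfl
  have e2 : ∀ n, ‖fourierCoeff (hmem'.toLp _ : Torus → ℂ) n‖ ^ 2 =
      (2 * Real.pi)⁻¹ * ‖modeFun u n x‖ ^ 2 := by
    intro n
    rw [e1, norm_mul, Complex.norm_real, mul_pow, Real.norm_eq_abs, sq_abs, inv_pow,
      Real.sq_sqrt Real.two_pi_pos.le]
  have e3 : ∫ t : Torus, ‖(hmem'.toLp _ : Torus → ℂ) t‖ ^ 2 ∂AddCircle.haarAddCircle =
      (2 * Real.pi)⁻¹ * ∫ y : Torus, ‖u (x, y)‖ ^ 2 := by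
    refine Eq.trans ?_ (AddCircle.integral_haarAddCircle (T := 2 * Real.pi)
      (f := fun y => ‖u (x, y)‖ ^ 2))
    refine integral_congr_ae ?_
    filter_upwards [hmem'.coeFn_toLp] with y hy
    rw [hy, Complex.norm_real]
  simp only [e2, e3] at hs
  rw [hasSum_mul_left_iff (inv_ne_zero Real.two_pi_pos.ne')] at hs
  have e4 : ∫⁻ y : Torus, ‖u (x, y)‖ₑ ^ 2 = ENNReal.ofReal (∫ y : Torus, ‖u (x, y)‖ ^ 2) := by
    rw [ofReal_integral_eq_lintegral_ofReal]
    · refine lintegral_congr fun y => ?_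
      rw [ENNReal.ofReal_pow (norm_nonneg _), ofReal_norm]
    · exact (memLp_two_iff_integrable_sq_norm hv.1).1 hv
    · exact Filter.Eventually.of_forall fun y => by positivity
  rw [e4, ← hs.tsum_eq, ENNReal.ofReal_tsum_of_nonneg (fun n => by positivity) hs.summable]
  refine tsum_congr fun n => ?_
  rw [ENNReal.ofReal_pow (norm_nonneg _), ofReal_norm]

/-- Parseval on almost every circle {x} × 𝕋, then Tonelli. The factor (2π)^{-1/2} in the modes makes
the constant 1. -/
theorem tsum_enorm_mode_sq (u : L2Cyl) : ∑' n : ℤ, ‖mode n u‖ₑ ^ 2 = ‖u‖ₑ ^ 2 := by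
  have hm : AEStronglyMeasurable (u : Cyl → ℝ) ((volume : Measure ℝ).prod (volume : Measure Torus)) :=
    Lp.aestronglyMeasurable u
  calc ∑' n : ℤ, ‖mode n u‖ₑ ^ 2 = ∑' n : ℤ, ∫⁻ x, ‖modeFun u n x‖ₑ ^ 2 := by
        refine tsum_congr fun n => ?_
        rw [enorm_sq_eq_lintegral]
        refine lintegral_congr_ae ?_
        filter_upwards [mode_coeFn u n] with x hx
        rw [hx]
    _ = ∫⁻ x, ∑' n : ℤ, ‖modeFun u n x‖ₑ ^ 2 := by
        rw [lintegral_tsum]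
        exact fun n => (memLp_modeFun u n).1.enorm.pow_const _
    _ = ∫⁻ x, ∫⁻ y, ‖u (x, y)‖ₑ ^ 2 := lintegral_congr_ae (tsum_enorm_modeFun_sq u)
    _ = ∫⁻ p : Cyl, ‖u p‖ₑ ^ 2 := (lintegral_prod _ (hm.enorm.pow_const _)).symm
    _ = _ := (enorm_sq_eq_lintegral u).symm

theorem hasSum_norm_mode_sq (u : L2Cyl) : HasSum (fun n : ℤ => ‖mode n u‖ ^ 2) (‖u‖ ^ 2) := by
  have h := tsum_enorm_mode_sq u
  have h1 : ∀ n, ‖mode n u‖ₑ ^ 2 = ENNReal.ofReal (‖mode n u‖ ^ 2) := fun n => by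
    rw [ENNReal.ofReal_pow (norm_nonneg _), ofReal_norm]
  have h2 : ‖u‖ₑ ^ 2 = ENNReal.ofReal (‖u‖ ^ 2) := by
    rw [ENNReal.ofReal_pow (norm_nonneg _), ofReal_norm]
  simp only [h1, h2] at h
  have hs : Summable fun n : ℤ => ‖mode n u‖ ^ 2 := by
    refine ENNReal.summable_toReal (f := fun n => ENNReal.ofReal (‖mode n u‖ ^ 2)) ?_ |>.congr
      fun n => ENNReal.toReal_ofReal (by positivity)
    rw [h]; exact ENNReal.ofReal_ne_top
  rw [← ENNReal.ofReal_tsum_of_nonneg (fun n => by positivity) hs] at h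
  rw [ENNReal.ofReal_eq_ofReal_iff (tsum_nonneg fun n => by positivity) (by positivity)] at h
  rw [← h]; exact hs.hasSum

theorem norm_cylFourier (n : ℤ) (u : L2Cyl) : ‖cylFourier n u‖ = ‖mode n u‖ :=
  Lp.norm_fourier_eq _

theorem hasSum_norm_cylFourier_sq (u : L2Cyl) :
    HasSum (fun n : ℤ => ‖cylFourier n u‖ ^ 2) (‖u‖ ^ 2) := by
  simpa only [norm_cylFourier] using hasSum_norm_mode_sq u

/-- Polarization of the Parseval identity. -/
theorem hasSum_re_inner_mode (u v : L2Cyl) :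
    HasSum (fun n : ℤ => (inner ℂ (mode n u) (mode n v)).re) (inner ℝ u v) := by
  have h1 := hasSum_norm_mode_sq (u + v)
  have h2 := hasSum_norm_mode_sq (u - v)
  have h3 := (h1.sub h2).mul_left (1 / 4 : ℝ)
  convert! h3 using 2
  · rename_i n
    rw [map_add, map_sub, @norm_add_sq ℂ, @norm_sub_sq ℂ]
    simp only [RCLike.re_to_complex]
    ring
  · rw [@norm_add_sq ℝ, @norm_sub_sq ℝ]
    simp only [RCLike.re_to_real]
    ring

theorem hasSum_re_inner_cylFourier (u v : L2Cyl) :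
    HasSum (fun n : ℤ => (inner ℂ (cylFourier n u) (cylFourier n v)).re) (inner ℝ u v) := by
  have := hasSum_re_inner_mode u v
  convert! this using 3
  exact Lp.inner_fourier_eq _ _

theorem mode_neg (n : ℤ) (u : L2Cyl) : mode (-n) u = star (mode n u) := by
  refine Lp.ext ?_
  filter_upwards [mode_coeFn u (-n), mode_coeFn u n, Lp.coeFn_star (mode n u)] with x h1 h2 h3
  rw [h1, h3, Pi.star_apply, h2, modeFun, modeFun, Complex.star_def, map_mul, Complex.conj_ofReal,
    ← integral_conj]
  congr 1
  refine integral_congr_ae (Filter.Eventually.of_forall fun y => ?_)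
  simp only [map_mul, Complex.conj_ofReal, ← fourier_neg]

theorem cylFourier_neg_ae (n : ℤ) (u : L2Cyl) :
    ∀ᵐ ζ, cylFourier (-n) u ζ = star (cylFourier n u (-ζ)) := by
  have := fourier_star_ae (mode n u)
  rw [← mode_neg] at this
  exact this

/-- The sequence of modes as an isometry into `ℓ²(ℤ; L²(ℝ))`. -/
def modeIsometry : L2Cyl →ₗᵢ[ℝ] lp (fun _ : ℤ => L2Line) 2 where
  toFun u := ⟨fun n => mode n u, by
    refine memℓp_gen ?_
    simpa using (hasSum_norm_mode_sq u).summable⟩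
  map_add' u v := by ext1; funext n; exact map_add _ _ _
  map_smul' r u := by ext1; funext n; exact map_smul _ _ _
  norm_map' u := by
    have h := lp.norm_rpow_eq_tsum (p := 2) (by norm_num)
      (⟨fun n => mode n u, by
        refine memℓp_gen ?_
        simpa using (hasSum_norm_mode_sq u).summable⟩ : lp (fun _ : ℤ => L2Line) 2)
    simp only [ENNReal.toReal_ofNat, Real.rpow_ofNat] at h
    rw [(hasSum_norm_mode_sq u).tsum_eq] at h
    exact (pow_left_inj₀ (norm_nonneg _) (norm_nonneg _) two_ne_zero).1 h

theorem modeIsometry_apply (u : L2Cyl) (n : ℤ) :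
    (modeIsometry u : ∀ _ : ℤ, L2Line) n = mode n u := rfl

/-- The range of an isometry from a complete space is closed, so it is enough to approximate. The
wave built from c1 • a n has half of the n-th and half of the (-n)-th prescribed mode; summing over
all integers counts each mode twice, which restores the whole. -/
theorem exists_of_modes {a : ℤ → L2Line} (ha : Summable fun n => ‖a n‖ ^ 2)
    (hs : ∀ n, a (-n) = star (a n)) : ∃ u : L2Cyl, ∀ n, mode n u = a n := by
  have hmem : Memℓp a 2 := memℓp_gen (by simpa using ha)
  set A : lp (fun _ : ℤ => L2Line) 2 := ⟨a, hmem⟩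
  set c1 : ℝ := (Real.sqrt (2 * Real.pi))⁻¹ with hc1
  have hc : Real.sqrt (2 * Real.pi) / 2 * c1 = 1 / 2 := by
    have := Real.sqrt_pos.2 Real.two_pi_pos
    rw [hc1]; field_simp
  have hstar : ∀ n, star (c1 • a n) = c1 • star (a n) := fun n => by
    refine Lp.ext ?_
    filter_upwards [Lp.coeFn_star (c1 • a n), Lp.coeFn_smul c1 (a n), Lp.coeFn_star (a n),
      Lp.coeFn_smul c1 (star (a n))] with x h1 h2 h3 h4
    rw [h1, h4, Pi.star_apply, h2, Pi.smul_apply, Pi.smul_apply, h3]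
    simp
  have hterm : ∀ n, modeIsometry (synth n (c1 • a n)) =
      (1 / 2 : ℝ) • (lp.single 2 n (a n) + lp.single 2 (-n) (a (-n)) :
        lp (fun _ : ℤ => L2Line) 2) := by
    intro n
    ext1
    funext k
    rw [modeIsometry_apply, mode_synth, hstar, ← hs, lp.coeFn_smul, lp.coeFn_add, Pi.smul_apply,
      Pi.add_apply, lp.single_apply, lp.single_apply]
    have e1 : (if k = n then c1 • a n else 0) = c1 • (Pi.single n (a n) : ∀ _ : ℤ, L2Line) k := by
      by_cases h : k = n
      · subst h; simp
      · simp [h]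
    have e2 : (if k = -n then c1 • a (-n) else 0) =
        c1 • (Pi.single (-n) (a (-n)) : ∀ _ : ℤ, L2Line) k := by
      by_cases h : k = -n
      · subst h; simp
      · simp [h]
    rw [e1, e2, ← smul_add, smul_smul, hc]
  have h1 : HasSum (fun n => (lp.single 2 n (a n) : lp (fun _ : ℤ => L2Line) 2)) A :=
    lp.hasSum_single (by norm_num) A
  have h2 : HasSum (fun n => (lp.single 2 (-n) (a (-n)) : lp (fun _ : ℤ => L2Line) 2)) A :=
    (Equiv.neg ℤ).hasSum_iff.2 h1
  have h3 : HasSum (fun n => modeIsometry (synth n (c1 • a n))) A := by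
    have := (h1.add h2).const_smul (1 / 2 : ℝ)
    simp only [← hterm] at this
    convert! this using 1
    rw [← two_smul ℝ A, smul_smul]; norm_num
  have hcl : IsClosed (Set.range modeIsometry) :=
    modeIsometry.isometry.isClosedEmbedding.isClosed_range
  have hA : A ∈ Set.range modeIsometry := by
    refine hcl.mem_of_tendsto h3 (Filter.Eventually.of_forall fun s => ?_)
    exact ⟨∑ n ∈ s, synth n (c1 • a n), map_sum _ _ _⟩
  obtain ⟨u, hu⟩ := hA
  exact ⟨u, fun n => by rw [← modeIsometry_apply, hu]⟩

theorem norm_le_of_cylFourier {u v : L2Cyl} {C : ℝ} (hC : 0 ≤ C)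
    (h : ∀ n, ‖cylFourier n u‖ ≤ C * ‖cylFourier n v‖) : ‖u‖ ≤ C * ‖v‖ := by
  have h1 := hasSum_norm_cylFourier_sq u
  have h2 := (hasSum_norm_cylFourier_sq v).mul_left (C ^ 2)
  have h3 := hasSum_le (fun n => by
    have := pow_le_pow_left₀ (norm_nonneg _) (h n) 2
    rwa [mul_pow] at this) h1 h2
  rw [← mul_pow] at h3
  exact le_of_sq_le_sq h3 (by positivity)

theorem L2Line.norm_le_of_ae {f g : L2Line} {C : ℝ} (h : ∀ᵐ ζ, ‖f ζ‖ ≤ C * ‖g ζ‖) :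
    ‖f‖ ≤ C * ‖g‖ := Lp.norm_le_mul_norm_of_ae_le_mul h

theorem IsMultiplier.norm_le {m : ℝ → ℤ → ℂ} {u a : L2Cyl} (h : IsMultiplier m u a) {C : ℝ}
    (hC : 0 ≤ C) (hm : ∀ ξ n, ‖m ξ n‖ ≤ C) : ‖a‖ ≤ C * ‖u‖ := by
  refine norm_le_of_cylFourier hC fun n => L2Line.norm_le_of_ae ?_
  filter_upwards [h n] with ζ hζ
  rw [hζ, norm_mul]
  exact mul_le_mul_of_nonneg_right (hm _ _) (norm_nonneg _)

theorem exists_of_cylFourier {b : ℤ → L2Line} (ha : Summable fun n => ‖b n‖ ^ 2)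
    (hs : ∀ n, ∀ᵐ ζ, b (-n) ζ = star (b n (-ζ))) : ∃ u : L2Cyl, ∀ n, cylFourier n u = b n := by
  obtain ⟨u, hu⟩ := exists_of_modes (a := fun n => (𝓕⁻ (b n) : L2Line)) (by
    refine ha.congr fun n => ?_
    congr 1
    rw [← Lp.norm_fourier_eq (𝓕⁻ (b n) : L2Line), fourier_fourierInv_eq]) (by
    intro n
    apply (Lp.fourierTransformₗᵢ ℝ ℂ).injective
    change (𝓕 (𝓕⁻ (b (-n)) : L2Line) : L2Line) = 𝓕 (star (𝓕⁻ (b n) : L2Line))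
    refine Lp.ext ?_
    filter_upwards [fourier_star_ae (𝓕⁻ (b n) : L2Line), hs n] with ζ h1 h2
    rw [h1, fourier_fourierInv_eq, fourier_fourierInv_eq, h2])
  refine ⟨u, fun n => ?_⟩
  rw [cylFourier, hu, fourier_fourierInv_eq]

/-- Boundedness keeps the sequence in ℓ²(L²), and the symmetry of the symbol is what lets the
multiplier map real-valued functions to real-valued ones. -/
theorem exists_isMultiplier {m : ℝ → ℤ → ℂ} (hm : ∀ n, Measurable fun ξ => m ξ n) {C : ℝ}
    (hC : ∀ ξ n, ‖m ξ n‖ ≤ C) (hsymm : ∀ ξ n, m (-ξ) (-n) = star (m ξ n)) (u : L2Cyl) :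
    ∃ a, IsMultiplier m u a := by
  have hmem : ∀ n, MemLp (fun ζ : ℝ => m (2 * Real.pi * ζ) n * cylFourier n u ζ) 2 volume := by
    intro n
    refine (Lp.memLp (cylFourier n u)).of_le_mul (c := C) ?_ ?_
    · exact (((hm n).comp (measurable_const_mul _)).aestronglyMeasurable).mul
        (Lp.aestronglyMeasurable _)
    · filter_upwards with ζ
      rw [norm_mul]
      exact mul_le_mul_of_nonneg_right (hC _ _) (norm_nonneg _)
  have hco := fun n => (hmem n).coeFn_toLp
  obtain ⟨a, ha⟩ := exists_of_cylFourier (b := fun n => (hmem n).toLp _) (by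
    refine Summable.of_nonneg_of_le (fun n => by positivity) (fun n => ?_)
      ((hasSum_norm_cylFourier_sq u).summable.mul_left (C ^ 2))
    rw [← mul_pow]
    refine pow_le_pow_left₀ (norm_nonneg _) (L2Line.norm_le_of_ae ?_) 2
    filter_upwards [hco n] with ζ hζ
    rw [hζ, norm_mul]
    exact mul_le_mul_of_nonneg_right (hC _ _) (norm_nonneg _)) (by
    intro n
    have h2 := (Measure.measurePreserving_neg (volume : Measure ℝ)).quasiMeasurePreserving.ae (hco n)
    filter_upwards [hco (-n), h2, cylFourier_neg_ae n u] with ζ h1 h2 h3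
    rw [h1, h2, h3, star_mul', ← hsymm]
    congr 2
    simp)
  refine ⟨a, fun n => ?_⟩
  rw [ha n]
  exact hco n

/-! ### Weak characterizations of multipliers -/

theorem inner_synth (u : L2Cyl) (n : ℤ) (f : L2Line) :
    inner ℝ u (synth n f) = Real.sqrt (2 * Real.pi) * (inner ℂ (mode n u) f).re := by
  have h := hasSum_re_inner_mode u (synth n f)
  have hst : (inner ℂ (mode (-n) u) (star f)).re = (inner ℂ (mode n u) f).re := by
    rw [mode_neg, L2.inner_def, L2.inner_def]
    have : ∫ x, inner ℂ ((star (mode n u) : L2Line) x) ((star f : L2Line) x) =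
        star (∫ x, inner ℂ (mode n u x) (f x)) := by
      rw [Complex.star_def, ← integral_conj]
      refine integral_congr_ae ?_
      filter_upwards [Lp.coeFn_star f, Lp.coeFn_star (mode n u)] with x h1 h2
      rw [h1, h2]
      simp
    rw [this]; simp
  have e : ∀ m, (inner ℂ (mode m u) (mode m (synth n f))).re = (Real.sqrt (2 * Real.pi) / 2) *
      ((if m = n then (inner ℂ (mode n u) f).re else 0) +
        (if m = -n then (inner ℂ (mode n u) f).re else 0)) := by
    intro m
    rw [mode_synth, RCLike.real_smul_eq_coe_smul (K := ℂ), inner_smul_right, inner_add_right]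
    refine (Complex.re_ofReal_mul _ _).trans ?_
    rw [Complex.add_re]
    congr 2
    · split_ifs with h1
      · rw [h1]
      · simp
    · split_ifs with h1
      · rw [h1, hst]
      · simp
  simp only [e] at h
  have h2 := ((hasSum_ite_eq n (inner ℂ (mode n u) f).re).add
    (hasSum_ite_eq (-n) (inner ℂ (mode n u) f).re)).mul_left (Real.sqrt (2 * Real.pi) / 2)
  rw [h.unique h2]; ring

/-- `Re (θ(x) e^{iny})` for a Schwartz function `θ`. -/
def schwartzWave (n : ℤ) (θ : 𝓢(ℝ, ℂ)) : L2Cyl := synth n (θ.toLp 2)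

theorem synth_coeFn {n : ℤ} {f : ℝ → ℂ} (hf : MemLp f 2) :
    (synth n (hf.toLp f) : Cyl → ℝ) =ᵐ[volume] wave n f := by
  have h1 : (synth n (hf.toLp f) : Cyl → ℝ) =ᵐ[volume] wave n (hf.toLp f) := MemLp.coeFn_toLp _
  refine h1.trans ?_
  have h2 : ∀ᵐ p : Cyl, (hf.toLp f) p.1 = f p.1 :=
    Measure.quasiMeasurePreserving_fst.ae hf.coeFn_toLp
  filter_upwards [h2] with p hp
  rw [wave, wave, hp]

theorem schwartzWave_coeFn (n : ℤ) (θ : 𝓢(ℝ, ℂ)) :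
    (schwartzWave n θ : Cyl → ℝ) =ᵐ[volume] wave n θ := synth_coeFn (θ.memLp 2)

theorem inner_schwartzWave (u : L2Cyl) (n : ℤ) (θ : 𝓢(ℝ, ℂ)) :
    inner ℝ u (schwartzWave n θ) =
      Real.sqrt (2 * Real.pi) * (∫ ζ, star (cylFourier n u ζ) * (𝓕 θ : 𝓢(ℝ, ℂ)) ζ).re := by
  rw [schwartzWave, inner_synth, ← Lp.inner_fourier_eq, SchwartzMap.toLp_fourier_eq, L2.inner_def]
  congr 2
  refine integral_congr_ae ?_
  filter_upwards [(𝓕 θ : 𝓢(ℝ, ℂ)).coeFn_toLp 2 volume] with ζ hζ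
  rw [hζ]
  simp [cylFourier, mul_comm]

/-- The derivative of a Schwartz function. -/
abbrev sderiv (θ : 𝓢(ℝ, ℂ)) : 𝓢(ℝ, ℂ) := SchwartzMap.derivCLM ℂ ℂ θ

theorem hasDerivAt_schwartz (θ : 𝓢(ℝ, ℂ)) (x : ℝ) : HasDerivAt θ (sderiv θ x) x :=
  θ.hasDerivAt x

theorem fourier_sderiv (θ : 𝓢(ℝ, ℂ)) (ζ : ℝ) :
    (𝓕 (sderiv θ) : 𝓢(ℝ, ℂ)) ζ = (Complex.I * (2 * Real.pi * ζ : ℝ)) * (𝓕 θ : 𝓢(ℝ, ℂ)) ζ := by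
  have h := congrFun (Real.fourier_deriv (f := θ) θ.integrable
    (fun x => θ.differentiableAt) (sderiv θ).integrable) ζ
  rw [SchwartzMap.fourier_coe, SchwartzMap.fourier_coe]
  have e : (⇑(sderiv θ) : ℝ → ℂ) = deriv θ := rfl
  rw [e, h, smul_eq_mul]
  push_cast; ring

theorem fourier_smul_schwartz (z : ℂ) (θ : 𝓢(ℝ, ℂ)) (ζ : ℝ) :
    (𝓕 (z • θ) : 𝓢(ℝ, ℂ)) ζ = z * (𝓕 θ : 𝓢(ℝ, ℂ)) ζ := by
  rw [FourierTransform.fourier_smul]; rfl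

theorem integrable_temperate_mul {p : ℝ → ℂ} (hp : p.HasTemperateGrowth) {g : ℝ → ℂ}
    (hg : MemLp g 2) (θ : 𝓢(ℝ, ℂ)) : Integrable fun ζ => p ζ * g ζ * θ ζ := by
  have h := hg.integrable_mul_schwartz (SchwartzMap.smulLeftCLM ℂ p θ)
  rw [SchwartzMap.smulLeftCLM_apply hp] at h
  refine h.congr (Filter.Eventually.of_forall fun ζ => ?_)
  simp only [smul_eq_mul]; ring

theorem locallyIntegrable_temperate_mul {p : ℝ → ℂ} (hp : p.HasTemperateGrowth) {g : ℝ → ℂ}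
    (hg : MemLp g 2) : LocallyIntegrable fun ζ => p ζ * g ζ :=
  (hg.locallyIntegrable (by norm_num)).continuous_mul hp.1.continuous

theorem memLp_star_cylFourier (n : ℤ) (u : L2Cyl) :
    MemLp (fun ζ => star (cylFourier n u ζ)) 2 volume :=
  (Lp.memLp (cylFourier n u)).star

/-- Inner products of real-valued functions see only real parts of Fourier integrals. Testing with
iφ as well as φ recovers the imaginary parts. -/
theorem ae_eq_of_forall_re_schwartz {p q f g : ℝ → ℂ} (hp : p.HasTemperateGrowth)
    (hq : q.HasTemperateGrowth) (hf : MemLp f 2) (hg : MemLp g 2)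
    (h : ∀ θ : 𝓢(ℝ, ℂ), (∫ ζ, f ζ * (p ζ * (𝓕 θ : 𝓢(ℝ, ℂ)) ζ)).re =
      (∫ ζ, g ζ * (q ζ * (𝓕 θ : 𝓢(ℝ, ℂ)) ζ)).re) :
    ∀ᵐ ζ, p ζ * f ζ = q ζ * g ζ := by
  have comm : ∀ (p f : ℝ → ℂ) (φ : 𝓢(ℝ, ℂ)), ∫ ζ, f ζ * (p ζ * φ ζ) = ∫ ζ, p ζ * f ζ * φ ζ := by
    intro p f φ
    refine integral_congr_ae (Filter.Eventually.of_forall fun ζ => ?_)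
    simp only; ring
  have h1 : ∀ φ : 𝓢(ℝ, ℂ), (∫ ζ, p ζ * f ζ * φ ζ).re = (∫ ζ, q ζ * g ζ * φ ζ).re := by
    intro φ
    have := h (𝓕⁻ φ : 𝓢(ℝ, ℂ))
    rwa [FourierTransform.fourier_fourierInv_eq, comm, comm] at this
  refine ae_eq_of_forall_schwartz (locallyIntegrable_temperate_mul hp hf)
    (locallyIntegrable_temperate_mul hq hg) (integrable_temperate_mul hp hf)
    (integrable_temperate_mul hq hg) fun φ => ?_
  have e : ∀ (p f : ℝ → ℂ), ∫ ζ, p ζ * f ζ * (Complex.I • φ) ζ =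
      Complex.I * ∫ ζ, p ζ * f ζ * φ ζ := by
    intro p f
    rw [← integral_const_mul]
    refine integral_congr_ae (Filter.Eventually.of_forall fun ζ => ?_)
    simp only [smul_apply, smul_eq_mul]; ring
  have h2 := h1 (Complex.I • φ)
  rw [e, e] at h2
  simp only [Complex.mul_re, Complex.I_re, Complex.I_im] at h2
  refine Complex.ext (h1 φ) ?_
  linarith

theorem hasTemperateGrowth_ofReal : (fun ζ : ℝ => (ζ : ℂ)).HasTemperateGrowth :=
  Complex.ofRealCLM.hasTemperateGrowth

/-- `∂_x` of a wave, on the Fourier side. -/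
theorem isMultiplier_symDx_synth {f g : ℝ → ℂ} (hf : MemLp f 2) (hg : MemLp g 2)
    (hfg : ∀ x, HasDerivAt f (g x) x) (n : ℤ) :
    IsMultiplier symDx (synth n (hf.toLp f)) (synth n (hg.toLp g)) := by
  intro m
  set A : ℂ := ((Real.sqrt (2 * Real.pi) / 2 : ℝ) : ℂ) * (if m = n then 1 else 0)
  set B : ℂ := ((Real.sqrt (2 * Real.pi) / 2 : ℝ) : ℂ) * (if m = -n then 1 else 0)
  have hAB : ∀ (h : ℝ → ℂ) (x : ℝ), modeFun (wave n h) m x = A * h x + B * star (h x) := by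
    intro h x
    rw [modeFun_wave]
    simp only [A, B]
    split_ifs <;> ring
  have hm : ∀ {h : ℝ → ℂ}, MemLp h 2 → MemLp (fun x => A * h x + B * star (h x)) 2 volume :=
    fun hh => (hh.const_mul A).add (hh.star.const_mul B)
  have hd := fourier_ae_eq_of_hasDerivAt (hm hf) (hm hg) (fun x =>
    ((hfg x).const_mul A).add ((hfg x).star.const_mul B))
  have e : ∀ {h : ℝ → ℂ} (hh : MemLp h 2), mode m (synth n (hh.toLp h)) = (hm hh).toLp _ := by
    intro h hh
    refine Lp.ext ?_
    filter_upwards [mode_coeFn (synth n (hh.toLp h)) m, modeFun_congr (synth_coeFn hh) m,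
      (hm hh).coeFn_toLp] with x h1 h2 h3
    rw [h1, h2, h3, hAB]
  filter_upwards [hd] with ζ hζ
  rw [cylFourier, cylFourier, e, e, hζ, symDx]
  push_cast; ring

theorem isMultiplier_symDx_schwartzWave (n : ℤ) (θ : 𝓢(ℝ, ℂ)) :
    IsMultiplier symDx (schwartzWave n θ) (schwartzWave n (sderiv θ)) :=
  isMultiplier_symDx_synth (θ.memLp 2) ((sderiv θ).memLp 2) (hasDerivAt_schwartz θ) n

/-- The symbol `in` of `∂_y`. -/
def symDy (_ξ : ℝ) (n : ℤ) : ℂ := Complex.I * n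

theorem isMultiplier_symDy_of_mode {u a : L2Cyl}
    (h : ∀ n : ℤ, mode n a = (Complex.I * n) • mode n u) : IsMultiplier symDy u a := by
  intro n
  rw [cylFourier, h, FourierTransform.fourier_smul]
  filter_upwards [Lp.coeFn_smul (Complex.I * n : ℂ) (𝓕 (mode n u) : L2Line)] with ζ hζ
  rw [hζ]; rfl

theorem IsMultiplier.mode_symDy {u a : L2Cyl} (h : IsMultiplier symDy u a) (n : ℤ) :
    mode n a = (Complex.I * n) • mode n u := by
  apply (Lp.fourierTransformₗᵢ ℝ ℂ).injective
  change cylFourier n a = 𝓕 ((Complex.I * n) • mode n u)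
  rw [FourierTransform.fourier_smul]
  refine Lp.ext ?_
  filter_upwards [h n, Lp.coeFn_smul (Complex.I * n : ℂ) (𝓕 (mode n u) : L2Line)] with ζ h1 h2
  rw [h1, h2]; rfl

theorem isMultiplier_symDy_schwartzWave (n : ℤ) (θ : 𝓢(ℝ, ℂ)) :
    IsMultiplier symDy (schwartzWave n θ) (schwartzWave n ((Complex.I * n) • θ)) := by
  refine isMultiplier_symDy_of_mode fun m => ?_
  rw [schwartzWave, schwartzWave, mode_synth, mode_synth, smul_comm]
  congr 1
  have h1 : ((Complex.I * n) • θ).toLp 2 volume = (Complex.I * n : ℂ) • θ.toLp 2 volume := rfl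
  have h2 : star ((Complex.I * n : ℂ) • θ.toLp 2 volume) =
      -((Complex.I * n : ℂ) • star (θ.toLp 2 volume) : L2Line) := by
    refine Lp.ext ?_
    filter_upwards [Lp.coeFn_star ((Complex.I * n : ℂ) • θ.toLp 2 volume),
      Lp.coeFn_smul (Complex.I * n : ℂ) (θ.toLp 2 volume), Lp.coeFn_star (θ.toLp 2 volume),
      Lp.coeFn_smul (Complex.I * n : ℂ) (star (θ.toLp 2 volume)),
      Lp.coeFn_neg ((Complex.I * n : ℂ) • star (θ.toLp 2 volume) : L2Line)] with x a1 a2 a3 a4 a5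
    rw [a1, a5, Pi.star_apply, Pi.neg_apply, a2, a4, Pi.smul_apply, Pi.smul_apply, a3]
    simp
  rw [h1, h2, smul_add]
  congr 1
  · split_ifs with h
    · rw [h]
    · simp
  · split_ifs with h
    · rw [h]; push_cast; rw [mul_neg, neg_smul]
    · simp

theorem inner_schwartzWave_sderiv (u : L2Cyl) (n : ℤ) (θ : 𝓢(ℝ, ℂ)) :
    inner ℝ u (schwartzWave n (sderiv θ)) = Real.sqrt (2 * Real.pi) *
      (∫ ζ, star (cylFourier n u ζ) *
        ((Complex.I * (2 * Real.pi * ζ : ℝ)) * (𝓕 θ : 𝓢(ℝ, ℂ)) ζ)).re := by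
  rw [inner_schwartzWave]
  simp only [fourier_sderiv]

theorem hasTemperateGrowth_xi : (fun ζ : ℝ => ((2 * Real.pi * ζ : ℝ) : ℂ)).HasTemperateGrowth := by
  have : (fun ζ : ℝ => ((2 * Real.pi * ζ : ℝ) : ℂ)) =
      (fun _ => (2 * Real.pi : ℂ)) * fun ζ : ℝ => (ζ : ℂ) := by
    ext ζ; simp
  rw [this]
  exact (Function.HasTemperateGrowth.const _).mul hasTemperateGrowth_ofReal

/-- An `L²` distributional `x`-derivative is a Fourier derivative. -/
theorem isMultiplier_symDx_of_weak {f g : L2Cyl}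
    (h : ∀ (n : ℤ) (θ : 𝓢(ℝ, ℂ)),
      inner ℝ f (schwartzWave n (sderiv θ)) = -inner ℝ g (schwartzWave n θ)) :
    IsMultiplier symDx f g := by
  intro n
  have hp : (fun ζ : ℝ => Complex.I * ((2 * Real.pi * ζ : ℝ) : ℂ)).HasTemperateGrowth :=
    (Function.HasTemperateGrowth.const Complex.I).mul hasTemperateGrowth_xi
  have key := ae_eq_of_forall_re_schwartz (f := fun ζ => star (cylFourier n f ζ))
    (g := fun ζ => star (cylFourier n g ζ)) hp (Function.HasTemperateGrowth.const (-1))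
    (memLp_star_cylFourier n f) (memLp_star_cylFourier n g) (fun θ => by
      have h1 := h n θ
      rw [inner_schwartzWave_sderiv, inner_schwartzWave, ← mul_neg] at h1
      have h2 := mul_left_cancel₀ (Real.sqrt_pos.2 Real.two_pi_pos).ne' h1
      rw [h2, ← Complex.neg_re, ← integral_neg]
      congr 1
      refine integral_congr_ae (Filter.Eventually.of_forall fun ζ => ?_)
      simp)
  filter_upwards [key] with ζ hζ
  have := congrArg star hζ
  simp only [star_mul', Complex.star_def, Complex.conj_I, Complex.conj_ofReal, map_neg,
    map_one, Complex.conj_conj] at this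
  rw [symDx]
  linear_combination this

/-- The symbol iξ is purely imaginary, so the identity holds mode by mode under Plancherel. -/
theorem inner_eq_neg_of_symDx {f f' g g' : L2Cyl} (hf : IsMultiplier symDx f f')
    (hg : IsMultiplier symDx g g') : inner ℝ f' g = -inner ℝ f g' := by
  have h1 := hasSum_re_inner_cylFourier f' g
  have h2 := (hasSum_re_inner_cylFourier f g').neg
  refine h1.unique ?_
  convert! h2 using 2 with n
  rw [← Complex.neg_re, ← inner_neg_right, L2.inner_def, L2.inner_def]
  congr 1
  refine integral_congr_ae ?_
  filter_upwards [hf n, hg n, Lp.coeFn_neg (cylFourier n g')] with ζ e1 e2 e3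
  rw [e1, e3, Pi.neg_apply, e2, symDx]
  simp only [RCLike.inner_apply, map_mul, Complex.conj_I, Complex.conj_ofReal]
  ring

/-- `u` with `(-∂_x² ± ∂_y) u = ∂_x g` in the distributional sense belongs to the energy space. -/
theorem exists_energy_of_weak {p g : L2Cyl}
    (h : ∀ (n : ℤ) (θ : 𝓢(ℝ, ℂ)),
      inner ℝ p (schwartzWave n ((Complex.I * n) • θ)) -
        inner ℝ p (schwartzWave n (sderiv (sderiv θ))) =
      inner ℝ g (schwartzWave n (sderiv θ))) :
    ∃ v : EnergySpace, v.fn = p ∧ v.dx + v.dxInvDy = g := by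
  have hp : ∀ n : ℤ, (fun ζ : ℝ => Complex.I * n +
      ((2 * Real.pi * ζ : ℝ) : ℂ) * ((2 * Real.pi * ζ : ℝ) : ℂ)).HasTemperateGrowth := fun n =>
    (Function.HasTemperateGrowth.const (Complex.I * n)).add
      (hasTemperateGrowth_xi.mul hasTemperateGrowth_xi)
  have hq : (fun ζ : ℝ => Complex.I * ((2 * Real.pi * ζ : ℝ) : ℂ)).HasTemperateGrowth :=
    (Function.HasTemperateGrowth.const Complex.I).mul hasTemperateGrowth_xi
  have key : ∀ n : ℤ, ∀ᵐ ζ : ℝ,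
      (((2 * Real.pi * ζ : ℝ) : ℂ) ^ 2 - Complex.I * n) * cylFourier n p ζ =
        -(Complex.I * ((2 * Real.pi * ζ : ℝ) : ℂ)) * cylFourier n g ζ := by
    intro n
    have k := ae_eq_of_forall_re_schwartz (f := fun ζ => star (cylFourier n p ζ))
      (g := fun ζ => star (cylFourier n g ζ)) (hp n) hq
      (memLp_star_cylFourier n p) (memLp_star_cylFourier n g) (fun θ => by
        have h1 := h n θ
        rw [inner_schwartzWave_sderiv, inner_schwartzWave_sderiv, inner_schwartzWave,
          ← mul_sub] at h1
        rw [← mul_left_cancel₀ (Real.sqrt_pos.2 Real.two_pi_pos).ne' h1, ← Complex.sub_re,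
          ← integral_sub]
        · congr 1
          refine integral_congr_ae (Filter.Eventually.of_forall fun ζ => ?_)
          simp only [fourier_smul_schwartz, fourier_sderiv]
          linear_combination (star (cylFourier n p ζ) * ((2 * Real.pi * ζ : ℝ) : ℂ) ^ 2 *
            (𝓕 θ : 𝓢(ℝ, ℂ)) ζ) * Complex.I_sq
        · exact (memLp_star_cylFourier n p).integrable_mul_schwartz _
        · have := (memLp_star_cylFourier n p).integrable_mul_schwartz
            (𝓕 (sderiv (sderiv θ)) : 𝓢(ℝ, ℂ))
          simpa only [fourier_sderiv (sderiv θ)] using this)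
    filter_upwards [k] with ζ hζ
    have := congrArg star hζ
    simp only [star_mul', star_add, Complex.star_def, Complex.conj_I,
      Complex.conj_ofReal, map_intCast, Complex.conj_conj] at this
    linear_combination this
  have hne : ∀ (ξ : ℝ) (n : ℤ), ξ ≠ 0 → ((ξ : ℂ) ^ 2 - Complex.I * n) ≠ 0 := by
    intro ξ n hξ h0
    have := congrArg Complex.re h0
    simp only [Complex.sub_re, ← Complex.ofReal_pow, Complex.ofReal_re, Complex.mul_re,
      Complex.I_re, Complex.I_im, Complex.intCast_im, Complex.zero_re] at this
    have h2 : ξ ^ 2 = 0 := by linarith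
    exact hξ (pow_eq_zero_iff two_ne_zero |>.1 h2)
  have hnorm : ∀ (ξ : ℝ) (n : ℤ), ξ ^ 2 ≤ ‖(ξ : ℂ) ^ 2 - Complex.I * n‖ := by
    intro ξ n
    have := Complex.abs_re_le_norm ((ξ : ℂ) ^ 2 - Complex.I * n)
    simp only [Complex.sub_re, ← Complex.ofReal_pow, Complex.ofReal_re, Complex.mul_re,
      Complex.I_re, Complex.I_im, Complex.intCast_im] at this
    rw [Complex.ofReal_pow] at this
    refine (le_abs_self _).trans ?_
    convert! this using 2
    ring
  have hnorm2 : ∀ (ξ : ℝ) (n : ℤ), ‖(n : ℂ)‖ ≤ ‖(ξ : ℂ) ^ 2 - Complex.I * n‖ := by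
    intro ξ n
    have := Complex.abs_im_le_norm ((ξ : ℂ) ^ 2 - Complex.I * n)
    simp only [Complex.sub_im, ← Complex.ofReal_pow, Complex.ofReal_im, Complex.mul_im,
      Complex.I_re, Complex.I_im, Complex.intCast_re] at this
    rw [Complex.ofReal_pow] at this
    rw [Complex.norm_intCast]
    convert! this using 1
    rw [← abs_neg]; congr 1; ring
  -- Solving for p gives ∂_x p and ∂_x⁻¹∂_y p as multipliers of g with symbols ξ²/(ξ² - in) and
  -- -in/(ξ² - in). Both are bounded by 1, because ξ² and -n are the real and imaginary parts of the
  -- denominator, and they add up to 1 off the null set ξ = 0.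
  obtain ⟨a, ha⟩ := exists_isMultiplier
    (m := fun ξ n => (ξ : ℂ) ^ 2 / ((ξ : ℂ) ^ 2 - Complex.I * n)) (C := 1)
    (fun n => by fun_prop)
    (fun ξ n => by
      rw [norm_div]
      refine div_le_one_of_le₀ ?_ (norm_nonneg _)
      rw [norm_pow, Complex.norm_real, Real.norm_eq_abs, sq_abs]; exact hnorm ξ n)
    (fun ξ n => by
      simp [Complex.conj_ofReal]) g
  obtain ⟨b, hb⟩ := exists_isMultiplier
    (m := fun ξ n => -(Complex.I * n) / ((ξ : ℂ) ^ 2 - Complex.I * n)) (C := 1)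
    (fun n => by fun_prop)
    (fun ξ n => by
      rw [norm_div]
      refine div_le_one_of_le₀ ?_ (norm_nonneg _)
      rw [norm_neg, norm_mul, Complex.norm_I, one_mul]; exact hnorm2 ξ n)
    (fun ξ n => by
      simp [Complex.conj_ofReal]) g
  have hae : ∀ᵐ ζ : ℝ, 2 * Real.pi * ζ ≠ 0 := by
    have : ∀ᵐ ζ : ℝ, ζ ≠ 0 := Measure.ae_ne volume 0
    filter_upwards [this] with ζ hζ
    exact mul_ne_zero Real.two_pi_pos.ne' hζ
  have h1 : IsMultiplier symDx p a := fun n => by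
    filter_upwards [ha n, key n, hae] with ζ e1 e2 e3
    rw [e1, symDx, div_mul_eq_mul_div, div_eq_iff (hne _ n e3)]
    set ξ : ℂ := ((2 * Real.pi * ζ : ℝ) : ℂ)
    linear_combination (-Complex.I * ξ) * e2 + (ξ ^ 2 * cylFourier n g ζ) * Complex.I_sq
  have h2 : IsMultiplier symDxInvDy p b := fun n => by
    filter_upwards [hb n, key n, hae] with ζ e1 e2 e3
    have hξ : ((2 * Real.pi * ζ : ℝ) : ℂ) ≠ 0 := by exact_mod_cast e3
    rw [e1, symDxInvDy, div_mul_eq_mul_div, div_eq_iff (hne _ n e3)]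
    set ξ : ℂ := ((2 * Real.pi * ζ : ℝ) : ℂ)
    have h3 : (Complex.I * ξ)⁻¹ * (Complex.I * n) = n / ξ := by
      have := Complex.I_ne_zero
      field_simp
    rw [h3]
    field_simp
    linear_combination (-(n : ℂ)) * e2
  refine ⟨⟨WithLp.toLp 2 ![p, a, b], h1, h2⟩, rfl, ?_⟩
  change a + b = g
  have h3 : IsMultiplier (fun _ _ => (1 : ℂ)) g (a + b) := fun n => by
    rw [cylFourier_add]
    filter_upwards [ha n, hb n, hae, Lp.coeFn_add (cylFourier n a) (cylFourier n b)]
      with ζ e1 e2 e3 e4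
    rw [e4, Pi.add_apply, e1, e2, ← add_mul, ← add_div, ← sub_eq_add_neg, div_self (hne _ n e3)]
  exact h3.unique fun n => by simp

/-! ### The energy space -/

theorem continuous_mode (n : ℤ) : Continuous (mode n) := by
  refine AddMonoidHomClass.continuous_of_bound (mode n) 1 fun u => ?_
  rw [one_mul]
  exact le_of_sq_le_sq ((hasSum_norm_mode_sq u).summable.le_tsum n (fun _ _ => by positivity) |>.trans
    (hasSum_norm_mode_sq u).tsum_eq.le) (norm_nonneg _)

theorem continuous_cylFourier (n : ℤ) : Continuous (cylFourier n) :=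
  (Lp.fourierTransformₗᵢ ℝ ℂ).continuous.comp (continuous_mode n)

theorem _root_.MeasureTheory.Lp.exists_subseq_tendsto_ae {α : Type*} {m : MeasurableSpace α}
    {μ : Measure α} {E : Type*} [NormedAddCommGroup E] {p : ℝ≥0∞} [Fact (1 ≤ p)] {f : ℕ → Lp E p μ}
    {g : Lp E p μ} (h : Tendsto f atTop (𝓝 g)) :
    ∃ ns : ℕ → ℕ, StrictMono ns ∧ ∀ᵐ x ∂μ, Tendsto (fun k => f (ns k) x) atTop (𝓝 (g x)) :=
  (tendstoInMeasure_of_tendsto_Lp h).exists_seq_tendsto_ae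

/-- L² convergence gives a.e. convergence of both transforms along a common subsequence. This
closedness is what makes the energy space complete. -/
theorem IsMultiplier.of_tendsto {m : ℝ → ℤ → ℂ} {u a : ℕ → L2Cyl} {u' a' : L2Cyl}
    (h : ∀ k, IsMultiplier m (u k) (a k)) (hu : Tendsto u atTop (𝓝 u'))
    (ha : Tendsto a atTop (𝓝 a')) : IsMultiplier m u' a' := by
  intro n
  have h1 := ((continuous_cylFourier n).tendsto u').comp hu
  have h2 := ((continuous_cylFourier n).tendsto a').comp ha
  obtain ⟨ns, hns, h3⟩ := Lp.exists_subseq_tendsto_ae h1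
  obtain ⟨ms, hms, h4⟩ := Lp.exists_subseq_tendsto_ae (h2.comp hns.tendsto_atTop)
  have h5 : ∀ᵐ ζ, ∀ k, cylFourier n (a k) ζ = m (2 * Real.pi * ζ) n * cylFourier n (u k) ζ :=
    ae_all_iff.2 fun k => h k n
  filter_upwards [h3, h4, h5] with ζ e3 e4 e5
  refine tendsto_nhds_unique e4 ?_
  simp only [Function.comp_apply, e5]
  exact (e3.comp hms.tendsto_atTop).const_mul _

theorem isClosed_energySubmodule :
    IsClosed (energySubmodule : Set (PiLp 2 (fun _ : Fin 3 => L2Cyl))) := by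
  refine IsSeqClosed.isClosed fun w v hw hv => ?_
  have hc : ∀ i : Fin 3, Tendsto (fun k => w k i) atTop (𝓝 (v i)) := fun i =>
    ((PiLp.continuous_apply 2 (fun _ : Fin 3 => L2Cyl) i).tendsto v).comp hv
  exact ⟨IsMultiplier.of_tendsto (fun k => (hw k).1) (hc 0) (hc 1),
    IsMultiplier.of_tendsto (fun k => (hw k).2) (hc 0) (hc 2)⟩

instance : CompleteSpace EnergySpace := isClosed_energySubmodule.completeSpace_coe

namespace EnergySpace

theorem isMultiplier_dx (v : EnergySpace) : IsMultiplier symDx v.fn v.dx := v.2.1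

theorem isMultiplier_dxInvDy (v : EnergySpace) : IsMultiplier symDxInvDy v.fn v.dxInvDy := v.2.2

/-- The element of the energy space with prescribed derivatives. -/
def mk (u a b : L2Cyl) (h : IsMultiplier symDx u a) (h' : IsMultiplier symDxInvDy u b) :
    EnergySpace := ⟨WithLp.toLp 2 ![u, a, b], h, h'⟩

@[simp] theorem mk_fn {u a b : L2Cyl} (h : IsMultiplier symDx u a)
    (h' : IsMultiplier symDxInvDy u b) : (mk u a b h h').fn = u := rfl
@[simp] theorem mk_dx {u a b : L2Cyl} (h : IsMultiplier symDx u a)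
    (h' : IsMultiplier symDxInvDy u b) : (mk u a b h h').dx = a := rfl
@[simp] theorem mk_dxInvDy {u a b : L2Cyl} (h : IsMultiplier symDx u a)
    (h' : IsMultiplier symDxInvDy u b) : (mk u a b h h').dxInvDy = b := rfl

theorem norm_fn_le (v : EnergySpace) : ‖v.fn‖ ≤ ‖v‖ :=
  le_of_sq_le_sq (by rw [norm_sq]; nlinarith [sq_nonneg ‖v.dx‖, sq_nonneg ‖v.dxInvDy‖])
    (norm_nonneg _)
theorem norm_dx_le (v : EnergySpace) : ‖v.dx‖ ≤ ‖v‖ :=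
  le_of_sq_le_sq (by rw [norm_sq]; nlinarith [sq_nonneg ‖v.fn‖, sq_nonneg ‖v.dxInvDy‖])
    (norm_nonneg _)
theorem norm_dxInvDy_le (v : EnergySpace) : ‖v.dxInvDy‖ ≤ ‖v‖ :=
  le_of_sq_le_sq (by rw [norm_sq]; nlinarith [sq_nonneg ‖v.dx‖, sq_nonneg ‖v.fn‖])
    (norm_nonneg _)

/-- `v ↦ v` as a continuous linear map to `L²`. -/
def fnL : EnergySpace →L[ℝ] L2Cyl :=
  LinearMap.mkContinuous { toFun := fn, map_add' := fun _ _ => rfl, map_smul' := fun _ _ => rfl } 1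
    fun v => by rw [one_mul]; exact v.norm_fn_le
/-- `v ↦ ∂_x v` as a continuous linear map to `L²`. -/
def dxL : EnergySpace →L[ℝ] L2Cyl :=
  LinearMap.mkContinuous { toFun := dx, map_add' := fun _ _ => rfl, map_smul' := fun _ _ => rfl } 1
    fun v => by rw [one_mul]; exact v.norm_dx_le
/-- `v ↦ ∂_x⁻¹ ∂_y v` as a continuous linear map to `L²`. -/
def dxInvDyL : EnergySpace →L[ℝ] L2Cyl :=
  LinearMap.mkContinuous
    { toFun := dxInvDy, map_add' := fun _ _ => rfl, map_smul' := fun _ _ => rfl } 1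
    fun v => by rw [one_mul]; exact v.norm_dxInvDy_le

@[simp] theorem fnL_apply (v : EnergySpace) : fnL v = v.fn := rfl
@[simp] theorem dxL_apply (v : EnergySpace) : dxL v = v.dx := rfl
@[simp] theorem dxInvDyL_apply (v : EnergySpace) : dxInvDyL v = v.dxInvDy := rfl

end EnergySpace

theorem inner_eq_of_ae {u v a b : L2Cyl} (h : ∀ n : ℤ, ∀ᵐ ζ,
    (star (cylFourier n u ζ) * cylFourier n v ζ).re =
      (star (cylFourier n a ζ) * cylFourier n b ζ).re) : inner ℝ u v = inner ℝ a b := by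
  refine (hasSum_re_inner_cylFourier u v).unique ?_
  convert! hasSum_re_inner_cylFourier a b using 2 with n
  have e : ∀ f g : L2Line, (inner ℂ f g).re = ∫ ζ, (star (f ζ) * g ζ).re := by
    intro f g
    rw [L2.inner_def]
    refine (integral_re (L2.integrable_inner (𝕜 := ℂ) f g)).symm.trans ?_
    refine integral_congr_ae (Eventually.of_forall fun ζ => ?_)
    simp [mul_comm]
  rw [e, e]
  exact integral_congr_ae (h n)

theorem inner_eq_zero_of_ae {u v : L2Cyl} (h : ∀ n : ℤ, ∀ᵐ ζ,
    (star (cylFourier n u ζ) * cylFourier n v ζ).re = 0) : inner ℝ u v = 0 := by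
  have h0 : ∀ n, cylFourier n 0 = 0 := fun n => by simpa using cylFourier_smul n 0 0
  rw [← inner_zero_left (𝕜 := ℝ) (0 : L2Cyl)]
  refine inner_eq_of_ae fun n => ?_
  filter_upwards [h n, Lp.coeFn_zero ℂ 2 (volume : Measure ℝ)] with ζ h1 h2
  rw [h1, h0, h2]; simp

theorem symDxInvDy_eq (ξ : ℝ) (n : ℤ) : symDxInvDy ξ n = ((n / ξ : ℝ) : ℂ) := by
  rw [symDxInvDy, mul_inv]
  push_cast
  have := Complex.I_ne_zero
  field_simp

/-- One symbol is imaginary and the other is the real number n/ξ, so the integrand on the Fourier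
side has vanishing real part. Thus a bound on ∂_x⁻¹∂_y v - ∂_x v controls both terms. -/
theorem inner_dx_dxInvDy (v : EnergySpace) : inner ℝ v.dx v.dxInvDy = 0 := by
  refine inner_eq_zero_of_ae fun n => ?_
  filter_upwards [v.isMultiplier_dx n, v.isMultiplier_dxInvDy n] with ζ h1 h2
  rw [h1, h2, symDxInvDy_eq, symDx]
  generalize (n / (2 * Real.pi * ζ) : ℝ) = r
  generalize 2 * Real.pi * ζ = ξ
  simp [Complex.mul_re, Complex.mul_im]
  ring

theorem norm_sq_dxInvDy_sub_dx (v : EnergySpace) :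
    ‖v.dxInvDy - v.dx‖ ^ 2 = ‖v.dx‖ ^ 2 + ‖v.dxInvDy‖ ^ 2 := by
  rw [@norm_sub_sq ℝ, real_inner_comm, inner_dx_dxInvDy]; simp; ring

theorem inner_dxInvDy_comm (v w : EnergySpace) :
    inner ℝ v.dxInvDy w.fn = inner ℝ v.fn w.dxInvDy := by
  refine inner_eq_of_ae fun n => ?_
  filter_upwards [v.isMultiplier_dxInvDy n, w.isMultiplier_dxInvDy n] with ζ h1 h2
  rw [h1, h2, symDxInvDy_eq, star_mul', Complex.star_def, Complex.conj_ofReal]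
  congr 1; ring

theorem inner_dx_eq_neg (v w : EnergySpace) : inner ℝ v.dx w.fn = -inner ℝ v.fn w.dx :=
  inner_eq_neg_of_symDx v.isMultiplier_dx w.isMultiplier_dx

theorem inner_symDy_self {u a : L2Cyl} (h : IsMultiplier symDy u a) : inner ℝ a u = 0 := by
  refine inner_eq_zero_of_ae fun n => ?_
  filter_upwards [h n] with ζ h1
  rw [h1, symDy]
  simp [Complex.mul_re, Complex.mul_im]
  ring

/-! ### Spectral splitting -/

theorem cylFourier_eq_zero_iff {n : ℤ} {u : L2Cyl} : cylFourier n u = 0 ↔ mode n u = 0 := by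
  rw [← norm_eq_zero, norm_cylFourier, norm_eq_zero]

/-- The vanishing of all the nonzero modes. -/
def IsZeroMode (u : L2Cyl) : Prop := ∀ n : ℤ, n ≠ 0 → mode n u = 0

theorem exists_split (u : L2Cyl) : ∃ u₀ u₁ : L2Cyl, u = u₀ + u₁ ∧ IsZeroMode u₀ ∧ mode 0 u₁ = 0 ∧
    IsMultiplier (fun _ n => if n = 0 then 1 else 0) u u₀ ∧
    IsMultiplier (fun _ n => if n = 0 then 0 else 1) u u₁ := by
  obtain ⟨u₀, h0⟩ := exists_isMultiplier (m := fun _ n => if n = 0 then 1 else 0) (C := 1)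
    (fun n => measurable_const) (fun ξ n => by split_ifs <;> simp)
    (fun ξ n => by by_cases h : n = 0 <;> simp [h]) u
  have h1 : IsMultiplier (fun _ n => if n = 0 then 0 else 1) u (u - u₀) := fun n => by
    rw [sub_eq_add_neg, cylFourier_add, ← neg_one_smul ℝ u₀, cylFourier_smul]
    filter_upwards [h0 n, Lp.coeFn_add (cylFourier n u) (((-1 : ℝ) : ℂ) • cylFourier n u₀),
      Lp.coeFn_smul ((-1 : ℝ) : ℂ) (cylFourier n u₀)] with ζ e1 e2 e3
    rw [e2, Pi.add_apply, e3, Pi.smul_apply, e1]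
    split_ifs <;> simp
  refine ⟨u₀, u - u₀, by abel, fun n hn => ?_, ?_, h0, h1⟩
  · rw [← cylFourier_eq_zero_iff]
    refine Lp.ext ?_
    filter_upwards [h0 n, Lp.coeFn_zero ℂ 2 (volume : Measure ℝ)] with ζ e1 e2
    rw [e1, if_neg hn, e2]; simp
  · rw [← cylFourier_eq_zero_iff]
    refine Lp.ext ?_
    filter_upwards [h1 0, Lp.coeFn_zero ℂ 2 (volume : Measure ℝ)] with ζ e1 e2
    rw [e1, if_pos rfl, e2]; simp

theorem IsMultiplier.comm {m m' : ℝ → ℤ → ℂ} {u a b d : L2Cyl} (h : IsMultiplier m u a)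
    (hb : IsMultiplier m' u b) (hd : IsMultiplier m' a d) : IsMultiplier m b d := fun n => by
  filter_upwards [h n, hb n, hd n] with ζ h1 h2 h3
  rw [h2, h3, h1]; ring

theorem IsMultiplier.mode_eq_zero {m : ℝ → ℤ → ℂ} {u a : L2Cyl} (h : IsMultiplier m u a) {n : ℤ}
    (hu : mode n u = 0) : mode n a = 0 := by
  rw [← cylFourier_eq_zero_iff] at hu ⊢
  refine Lp.ext ?_
  filter_upwards [h n, Lp.coeFn_zero ℂ 2 (volume : Measure ℝ)] with ζ e1 e2
  rw [e1, hu, e2]; simp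

theorem exists_energy_isMultiplier {m : ℝ → ℤ → ℂ} (hm : ∀ n, Measurable fun ξ => m ξ n)
    (hC : ∀ ξ n, ‖m ξ n‖ ≤ 1) (hsymm : ∀ ξ n, m (-ξ) (-n) = star (m ξ n)) (v : EnergySpace) :
    ∃ w : EnergySpace, IsMultiplier m v.fn w.fn ∧ IsMultiplier m v.dx w.dx ∧
      IsMultiplier m v.dxInvDy w.dxInvDy ∧ ‖w‖ ≤ ‖v‖ := by
  obtain ⟨a, ha⟩ := exists_isMultiplier hm hC hsymm v.fn
  obtain ⟨b, hb⟩ := exists_isMultiplier hm hC hsymm v.dx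
  obtain ⟨d, hd⟩ := exists_isMultiplier hm hC hsymm v.dxInvDy
  refine ⟨EnergySpace.mk a b d (v.isMultiplier_dx.comm ha hb) (v.isMultiplier_dxInvDy.comm ha hd),
    ha, hb, hd, ?_⟩
  refine le_of_sq_le_sq ?_ (norm_nonneg _)
  rw [EnergySpace.norm_sq, EnergySpace.norm_sq]
  have e : ∀ {u a : L2Cyl}, IsMultiplier m u a → ‖a‖ ^ 2 ≤ ‖u‖ ^ 2 := fun h =>
    pow_le_pow_left₀ (norm_nonneg _) ((h.norm_le zero_le_one hC).trans_eq (one_mul _)) 2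
  exact add_le_add (add_le_add (e ha) (e hb)) (e hd)

theorem exists_split_energy (v : EnergySpace) : ∃ v₀ v₁ : EnergySpace, v = v₀ + v₁ ∧
    IsZeroMode v₀.fn ∧ mode 0 v₁.fn = 0 ∧ ‖v₀‖ ≤ ‖v‖ ∧ ‖v₁‖ ≤ ‖v‖ := by
  obtain ⟨v₀, h1, -, -, h4⟩ := exists_energy_isMultiplier
    (m := fun _ n => if n = 0 then 1 else 0) (fun n => measurable_const)
    (fun ξ n => by split_ifs <;> simp) (fun ξ n => by by_cases h : n = 0 <;> simp [h]) v
  obtain ⟨v₁, g1, -, -, g4⟩ := exists_energy_isMultiplier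
    (m := fun _ n => if n = 0 then 0 else 1) (fun n => measurable_const)
    (fun ξ n => by split_ifs <;> simp) (fun ξ n => by by_cases h : n = 0 <;> simp [h]) v
  obtain ⟨u₀, u₁, e, k1, k2, k3, k4⟩ := exists_split v.fn
  have e0 := h1.unique k3
  have e1 := g1.unique k4
  refine ⟨v₀, v₁, EnergySpace.ext_fn ?_, e0 ▸ k1, e1 ▸ k2, h4, g4⟩
  change v.fn = v₀.fn + v₁.fn
  rw [e0, e1, ← e]

theorem dxInvDy_eq_zero_of_isZeroMode {v : EnergySpace} (h : IsZeroMode v.fn) :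
    v.dxInvDy = 0 := by
  refine eq_of_mode_eq fun n => ?_
  rw [map_zero]
  by_cases hn : n = 0
  · subst hn
    rw [← cylFourier_eq_zero_iff]
    refine Lp.ext ?_
    filter_upwards [v.isMultiplier_dxInvDy 0, Lp.coeFn_zero ℂ 2 (volume : Measure ℝ)] with ζ e1 e2
    rw [e1, e2]; simp [symDxInvDy]
  · exact v.isMultiplier_dxInvDy.mode_eq_zero (h n hn)

theorem mode_zero_dxInvDy (v : EnergySpace) : mode 0 v.dxInvDy = 0 := by
  rw [← cylFourier_eq_zero_iff]
  refine Lp.ext ?_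
  filter_upwards [v.isMultiplier_dxInvDy 0, Lp.coeFn_zero ℂ 2 (volume : Measure ℝ)] with ζ e1 e2
  rw [e1, e2]; simp [symDxInvDy]

theorem ae_two_pi_mul_ne_zero : ∀ᵐ ζ : ℝ, 2 * Real.pi * ζ ≠ 0 := by
  filter_upwards [Measure.ae_ne volume (0 : ℝ)] with ζ hζ
  exact mul_ne_zero Real.two_pi_pos.ne' hζ

/-- A function without zero mode in the energy space is an `x`-derivative. -/
theorem exists_potential {v : EnergySpace} (h : mode 0 v.fn = 0) :
    ∃ D : L2Cyl, IsMultiplier symDx D v.fn ∧ IsMultiplier symDy D v.dxInvDy ∧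
      ‖D‖ ≤ ‖v.dxInvDy‖ := by
  have hC : ∀ (ξ : ℝ) (n : ℤ), ‖(Complex.I * n)⁻¹‖ ≤ 1 := by
    intro ξ n
    rcases eq_or_ne n 0 with rfl | hn
    · simp
    · rw [norm_inv, norm_mul, Complex.norm_I, one_mul, Complex.norm_intCast]
      refine inv_le_one_of_one_le₀ ?_
      exact_mod_cast Int.one_le_abs hn
  -- D is ∂_y⁻¹ applied to ∂_x⁻¹∂_y v. The symbol is bounded since |n| ≥ 1 off the zero mode; at n =
  -- 0 the convention 0⁻¹ = 0 gives D no zero mode.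
  obtain ⟨D, hD⟩ := exists_isMultiplier (m := fun _ n => (Complex.I * n)⁻¹) (C := 1)
    (fun n => measurable_const) hC (fun ξ n => by simp) v.dxInvDy
  refine ⟨D, fun n => ?_, fun n => ?_, (hD.norm_le zero_le_one hC).trans_eq (one_mul _)⟩
  · rcases eq_or_ne n 0 with rfl | hn
    · have h0 := hD.mode_eq_zero (mode_zero_dxInvDy v)
      rw [← cylFourier_eq_zero_iff] at h h0
      rw [h, h0]
      filter_upwards [Lp.coeFn_zero ℂ 2 (volume : Measure ℝ)] with ζ e
      rw [e]; simp
    · filter_upwards [hD n, v.isMultiplier_dxInvDy n, ae_two_pi_mul_ne_zero] with ζ e1 e2 e3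
      have hξ : ((2 * Real.pi * ζ : ℝ) : ℂ) ≠ 0 := by exact_mod_cast e3
      have hn' : (n : ℂ) ≠ 0 := by exact_mod_cast hn
      have hI := Complex.I_ne_zero
      rw [e1, e2, symDxInvDy, symDx]
      field_simp
  · rcases eq_or_ne n 0 with rfl | hn
    · have h0 := mode_zero_dxInvDy v
      rw [← cylFourier_eq_zero_iff] at h0
      rw [h0]
      filter_upwards [Lp.coeFn_zero ℂ 2 (volume : Measure ℝ)] with ζ e
      rw [e]; simp [symDy]
    · filter_upwards [hD n] with ζ e1
      have hn' : (n : ℂ) ≠ 0 := by exact_mod_cast hn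
      have hI := Complex.I_ne_zero
      rw [e1, symDy]
      field_simp

/-! ### Dense classes of smooth functions -/

/-- `∂_x` of a wave, as an element of the energy space. -/
def dxWave (n : ℤ) (θ : 𝓢(ℝ, ℂ)) : EnergySpace :=
  EnergySpace.mk (schwartzWave n (sderiv θ)) (schwartzWave n (sderiv (sderiv θ)))
    (schwartzWave n ((Complex.I * n) • θ)) (isMultiplier_symDx_schwartzWave _ _) (fun m => by
      filter_upwards [isMultiplier_symDx_schwartzWave n θ m, isMultiplier_symDy_schwartzWave n θ m,
        ae_two_pi_mul_ne_zero] with ζ e1 e2 e3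
      have hξ : ((2 * Real.pi * ζ : ℝ) : ℂ) ≠ 0 := by exact_mod_cast e3
      have hI := Complex.I_ne_zero
      rw [e1, e2, symDxInvDy, symDx, symDy]
      field_simp)

theorem isZeroMode_schwartzWave (θ : 𝓢(ℝ, ℂ)) : IsZeroMode (schwartzWave 0 θ) := fun n hn => by
  rw [schwartzWave, mode_synth, if_neg hn, if_neg (by simpa using hn)]; simp

theorem isMultiplier_dxInvDy_of_isZeroMode {u : L2Cyl} (h : IsZeroMode u) :
    IsMultiplier symDxInvDy u 0 := by
  have h0 : ∀ n, cylFourier n 0 = 0 := fun n => by simpa using cylFourier_smul n 0 0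
  intro n
  rw [h0]
  rcases eq_or_ne n 0 with rfl | hn
  · filter_upwards [Lp.coeFn_zero ℂ 2 (volume : Measure ℝ)] with ζ e
    rw [e]; simp [symDxInvDy]
  · rw [cylFourier_eq_zero_iff.2 (h n hn)]
    filter_upwards [Lp.coeFn_zero ℂ 2 (volume : Measure ℝ)] with ζ e
    rw [e]; simp

/-- A `y`-independent Schwartz function, as an element of the energy space. -/
def zeroWave (θ : 𝓢(ℝ, ℂ)) : EnergySpace :=
  EnergySpace.mk (schwartzWave 0 θ) (schwartzWave 0 (sderiv θ)) 0
    (isMultiplier_symDx_schwartzWave _ _)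
    (isMultiplier_dxInvDy_of_isZeroMode (isZeroMode_schwartzWave θ))

/-- The functions in the energy space without zero mode. -/
def energyNonzero : Submodule ℝ EnergySpace where
  carrier := {v | mode 0 v.fn = 0}
  add_mem' {a b} ha hb := by
    change mode 0 (a.fn + b.fn) = 0
    rw [map_add, show mode 0 a.fn = 0 from ha, show mode 0 b.fn = 0 from hb, add_zero]
  zero_mem' := map_zero _
  smul_mem' r a ha := by
    change mode 0 (r • a.fn) = 0
    rw [map_smul, show mode 0 a.fn = 0 from ha, smul_zero]

/-- The `y`-independent functions in the energy space. -/
def energyZero : Submodule ℝ EnergySpace where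
  carrier := {v | IsZeroMode v.fn}
  add_mem' {a b} ha hb n hn := by
    change mode n (a.fn + b.fn) = 0
    rw [map_add, show mode n a.fn = 0 from ha n hn, show mode n b.fn = 0 from hb n hn, add_zero]
  zero_mem' n _ := map_zero _
  smul_mem' r a ha n hn := by
    change mode n (r • a.fn) = 0
    rw [map_smul, show mode n a.fn = 0 from ha n hn, smul_zero]

theorem isClosed_energyNonzero : IsClosed (energyNonzero : Set EnergySpace) :=
  isClosed_eq ((continuous_mode 0).comp EnergySpace.fnL.continuous) continuous_const

theorem isClosed_energyZero : IsClosed (energyZero : Set EnergySpace) := by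
  have : (energyZero : Set EnergySpace) =
      ⋂ n : ℤ, ⋂ _ : n ≠ 0, {v : EnergySpace | mode n v.fn = 0} := by
    ext v; simp [energyZero, IsZeroMode]
  rw [this]
  exact isClosed_iInter fun n => isClosed_iInter fun _ =>
    isClosed_eq ((continuous_mode n).comp EnergySpace.fnL.continuous) continuous_const

theorem inner_energy (v w : EnergySpace) :
    inner ℝ v w = inner ℝ v.fn w.fn + inner ℝ v.dx w.dx + inner ℝ v.dxInvDy w.dxInvDy := by
  have : inner ℝ v w = inner ℝ (v : PiLp 2 (fun _ : Fin 3 => L2Cyl)) w := rfl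
  rw [this, PiLp.inner_apply, Fin.sum_univ_three]
  rfl

theorem dxWave_mem {n : ℤ} (hn : n ≠ 0) (θ : 𝓢(ℝ, ℂ)) : dxWave n θ ∈ energyNonzero := by
  change mode 0 (schwartzWave n (sderiv θ)) = 0
  rw [schwartzWave, mode_synth, if_neg hn.symm, if_neg (by omega)]; simp

/-- Hilbert space projection onto the closure of W: the orthogonal remainder stays in S because S is
closed and contains W. -/
theorem mem_closure_of_orthogonal {W S : Submodule ℝ EnergySpace} (hS : IsClosed (S : Set EnergySpace))
    (hWS : W ≤ S) (h : ∀ v ∈ S, (∀ w ∈ W, inner ℝ v w = 0) → v = 0) {v : EnergySpace} (hv : v ∈ S) :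
    v ∈ closure (W : Set EnergySpace) := by
  have hc : IsClosed (W.topologicalClosure : Set EnergySpace) := W.isClosed_topologicalClosure
  have : CompleteSpace W.topologicalClosure := hc.completeSpace_coe
  obtain ⟨y, hy, z, hz, rfl⟩ := W.topologicalClosure.exists_add_mem_mem_orthogonal v
  have hyS : y ∈ S := (W.topologicalClosure_minimal hWS hS) hy
  have hzS : z ∈ S := by simpa using S.sub_mem hv hyS
  have : z = 0 := h z hzS fun w hw =>
    (Submodule.mem_orthogonal' _ _).1 hz w (W.le_topologicalClosure hw)
  rw [this, add_zero]
  exact hy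

/-- With v = ∂_x D, energy orthogonality to every ∂_x-wave of frequency n says that (ξ² + ξ⁴ + n²)
times the transform of D vanishes, and this factor is positive for n > 0. The negative frequencies
follow by conjugation, since v is real. -/
theorem mem_closure_span_dxWave {v : EnergySpace} (hv : mode 0 v.fn = 0) :
    v ∈ closure (Submodule.span ℝ {w | ∃ (n : ℤ) (θ : 𝓢(ℝ, ℂ)), 0 < n ∧ w = dxWave n θ} :
      Set EnergySpace) := by
  refine mem_closure_of_orthogonal isClosed_energyNonzero ?_ ?_ hv
  · rw [Submodule.span_le]
    rintro _ ⟨n, θ, hn, rfl⟩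
    exact dxWave_mem hn.ne' θ
  intro v hv h
  obtain ⟨D, hD1, hD2, -⟩ := exists_potential hv
  have hξ := hasTemperateGrowth_xi
  have key : ∀ n : ℤ, 0 < n → mode n D = 0 := by
    intro n hn
    have k := ae_eq_of_forall_re_schwartz (f := fun ζ => star (cylFourier n D ζ))
      (g := fun ζ => star (cylFourier n D ζ))
      (p := fun ζ : ℝ => ((2 * Real.pi * ζ : ℝ) : ℂ) * ((2 * Real.pi * ζ : ℝ) : ℂ) +
        ((2 * Real.pi * ζ : ℝ) : ℂ) * ((2 * Real.pi * ζ : ℝ) : ℂ) *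
          (((2 * Real.pi * ζ : ℝ) : ℂ) * ((2 * Real.pi * ζ : ℝ) : ℂ)) + (n : ℂ) ^ 2)
      (((hξ.mul hξ).add ((hξ.mul hξ).mul (hξ.mul hξ))).add (Function.HasTemperateGrowth.const _))
      (Function.HasTemperateGrowth.const 0)
      (memLp_star_cylFourier n D) (memLp_star_cylFourier n D) (fun θ => by
        have h1 := h (dxWave n θ) (Submodule.subset_span ⟨n, θ, hn, rfl⟩)
        rw [inner_energy] at h1
        change inner ℝ v.fn (schwartzWave n (sderiv θ)) +
          inner ℝ v.dx (schwartzWave n (sderiv (sderiv θ))) +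
          inner ℝ v.dxInvDy (schwartzWave n ((Complex.I * n) • θ)) = 0 at h1
        rw [inner_schwartzWave, inner_schwartzWave, inner_schwartzWave, ← mul_add, ← mul_add] at h1
        have h2 := (mul_eq_zero.1 h1).resolve_left (Real.sqrt_pos.2 Real.two_pi_pos).ne'
        rw [← Complex.add_re, ← Complex.add_re, ← integral_add, ← integral_add] at h2
        · simp only [zero_mul, mul_zero, integral_zero, Complex.zero_re]
          rw [← h2]
          congr 1
          refine integral_congr_ae ?_
          filter_upwards [hD1 n, hD2 n, v.isMultiplier_dx n] with ζ e1 e2 e3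
          rw [e3, e2, e1, symDx, symDy]
          simp only [fourier_smul_schwartz, fourier_sderiv, star_mul', Complex.star_def,
            Complex.conj_I, Complex.conj_ofReal, map_intCast]
          ring_nf
          simp only [Complex.I_sq, Complex.I_pow_four]
          ring
        · exact ((memLp_star_cylFourier n v.fn).integrable_mul_schwartz _).add
            ((memLp_star_cylFourier n v.dx).integrable_mul_schwartz _)
        · exact (memLp_star_cylFourier n v.dxInvDy).integrable_mul_schwartz _
        · exact (memLp_star_cylFourier n v.fn).integrable_mul_schwartz _
        · exact (memLp_star_cylFourier n v.dx).integrable_mul_schwartz _)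
    rw [← cylFourier_eq_zero_iff]
    refine Lp.ext ?_
    filter_upwards [k, Lp.coeFn_zero ℂ 2 (volume : Measure ℝ)] with ζ hζ e0
    rw [zero_mul] at hζ
    rw [e0]
    have hne : ((2 * Real.pi * ζ : ℝ) : ℂ) * ((2 * Real.pi * ζ : ℝ) : ℂ) +
        ((2 * Real.pi * ζ : ℝ) : ℂ) * ((2 * Real.pi * ζ : ℝ) : ℂ) *
          (((2 * Real.pi * ζ : ℝ) : ℂ) * ((2 * Real.pi * ζ : ℝ) : ℂ)) + (n : ℂ) ^ 2 ≠ 0 := by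
      set ξ := 2 * Real.pi * ζ
      have : (0 : ℝ) < ξ * ξ + ξ * ξ * (ξ * ξ) + (n : ℝ) ^ 2 := by
        have : (0 : ℝ) < (n : ℝ) ^ 2 := by positivity
        nlinarith [mul_self_nonneg ξ, mul_self_nonneg (ξ * ξ)]
      have h2 := this.ne'
      intro h0
      apply h2
      exact_mod_cast h0
    simpa using (mul_eq_zero.1 hζ).resolve_left hne
  refine EnergySpace.ext_fn (eq_of_mode_eq fun n => ?_)
  change mode n v.fn = mode n 0
  rw [map_zero]
  rcases lt_trichotomy n 0 with hn | rfl | hn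
  · refine hD1.mode_eq_zero ?_
    rw [← neg_neg n, mode_neg, key (-n) (by omega)]
    refine Lp.ext ?_
    filter_upwards [Lp.coeFn_star (0 : L2Line), Lp.coeFn_zero ℂ 2 (volume : Measure ℝ)]
      with x h1 h2
    rw [h1, Pi.star_apply, h2]; simp
  · exact hv
  · exact hD1.mode_eq_zero (key n hn)

/-- Here the energy inner product is that of H¹(ℝ), and orthogonality produces the positive factor 1
+ ξ². -/
theorem mem_closure_span_zeroWave {v : EnergySpace} (hv : IsZeroMode v.fn) :
    v ∈ closure (Submodule.span ℝ (Set.range zeroWave) : Set EnergySpace) := by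
  refine mem_closure_of_orthogonal isClosed_energyZero ?_ ?_ hv
  · rw [Submodule.span_le]
    rintro _ ⟨θ, rfl⟩
    exact isZeroMode_schwartzWave θ
  intro v hv h
  have hξ := hasTemperateGrowth_xi
  have k := ae_eq_of_forall_re_schwartz (f := fun ζ => star (cylFourier 0 v.fn ζ))
    (g := fun ζ => star (cylFourier 0 v.fn ζ))
    (p := fun ζ : ℝ => 1 + ((2 * Real.pi * ζ : ℝ) : ℂ) * ((2 * Real.pi * ζ : ℝ) : ℂ))
    ((Function.HasTemperateGrowth.const _).add (hξ.mul hξ))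
    (Function.HasTemperateGrowth.const 0)
    (memLp_star_cylFourier 0 v.fn) (memLp_star_cylFourier 0 v.fn) (fun θ => by
      have h1 := h (zeroWave θ) (Submodule.subset_span ⟨θ, rfl⟩)
      rw [inner_energy] at h1
      change inner ℝ v.fn (schwartzWave 0 θ) +
        inner ℝ v.dx (schwartzWave 0 (sderiv θ)) + inner ℝ v.dxInvDy 0 = 0 at h1
      rw [inner_zero_right, add_zero, inner_schwartzWave, inner_schwartzWave, ← mul_add] at h1
      have h2 := (mul_eq_zero.1 h1).resolve_left (Real.sqrt_pos.2 Real.two_pi_pos).ne'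
      rw [← Complex.add_re, ← integral_add] at h2
      · simp only [zero_mul, mul_zero, integral_zero, Complex.zero_re]
        rw [← h2]
        congr 1
        refine integral_congr_ae ?_
        filter_upwards [v.isMultiplier_dx 0] with ζ e3
        rw [e3, symDx]
        simp only [fourier_sderiv, star_mul', Complex.star_def,
          Complex.conj_I, Complex.conj_ofReal]
        ring_nf
        simp only [Complex.I_sq]
        ring
      · exact (memLp_star_cylFourier 0 v.fn).integrable_mul_schwartz _
      · exact (memLp_star_cylFourier 0 v.dx).integrable_mul_schwartz _)
  refine EnergySpace.ext_fn (eq_of_mode_eq fun n => ?_)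
  change mode n v.fn = mode n 0
  rw [map_zero]
  rcases eq_or_ne n 0 with rfl | hn
  · rw [← cylFourier_eq_zero_iff]
    refine Lp.ext ?_
    filter_upwards [k, Lp.coeFn_zero ℂ 2 (volume : Measure ℝ)] with ζ hζ e3
    rw [zero_mul] at hζ
    have hne : 1 + ((2 * Real.pi * ζ : ℝ) : ℂ) * ((2 * Real.pi * ζ : ℝ) : ℂ) ≠ 0 := by
      set ξ := 2 * Real.pi * ζ
      have : (0 : ℝ) < 1 + ξ * ξ := by nlinarith [mul_self_nonneg ξ]
      have h2 := this.ne'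
      intro h0
      apply h2
      exact_mod_cast h0
    rw [e3]
    simpa using (mul_eq_zero.1 hζ).resolve_left hne
  · exact hv n hn

/-! ### Interpolation inequalities -/

/-- The one-dimensional interpolation inequality `|f|_∞² ≤ 2 |f|₂ |f'|₂`. -/
theorem norm_sq_le_of_hasDerivAt {E : Type*} [NormedAddCommGroup E] [InnerProductSpace ℝ E]
    {f f' : ℝ → E} (hf : MemLp f 2) (hf' : MemLp f' 2) (h : ∀ x, HasDerivAt f (f' x) x) (x : ℝ) :
    ‖f x‖ ^ 2 ≤ 2 * (‖hf.toLp f‖ * ‖hf'.toLp f'‖) := by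
  have hd : ∀ x, HasDerivAt (fun x => ‖f x‖ ^ 2) (2 * inner ℝ (f x) (f' x)) x := fun x =>
    (h x).norm_sq
  have i1 : Integrable fun x => ‖f x‖ ^ 2 := (memLp_two_iff_integrable_sq_norm hf.1).1 hf
  have i3 : Integrable fun x => ‖f x‖ * ‖f' x‖ := hf.norm.integrable_mul hf'.norm
  have i2 : Integrable fun x => 2 * inner ℝ (f x) (f' x) := by
    refine Integrable.const_mul (i3.mono (hf.1.inner hf'.1) (Eventually.of_forall fun x => ?_)) 2
    rw [Real.norm_eq_abs, Real.norm_eq_abs, abs_mul, abs_norm, abs_norm]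
    exact abs_real_inner_le_norm _ _
  have ht := tendsto_zero_of_hasDerivAt_of_integrableOn_Iic (a := x) (fun y _ => hd y)
    i2.integrableOn i1.integrableOn
  have h1 := integral_Iic_of_hasDerivAt_of_tendsto (a := x) (hd x).continuousAt.continuousWithinAt
    (fun y _ => hd y) i2.integrableOn ht
  rw [sub_zero] at h1
  rw [← h1]
  have h2 : ∫ y in Set.Iic x, 2 * inner ℝ (f y) (f' y) ≤ ∫ y in Set.Iic x, 2 * (‖f y‖ * ‖f' y‖) :=
    integral_mono i2.integrableOn (i3.const_mul 2).integrableOn fun y =>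
      mul_le_mul_of_nonneg_left (real_inner_le_norm _ _) zero_le_two
  have h3 : ∫ y in Set.Iic x, 2 * (‖f y‖ * ‖f' y‖) ≤ ∫ y, 2 * (‖f y‖ * ‖f' y‖) :=
    setIntegral_le_integral (i3.const_mul 2) (Eventually.of_forall fun y => by positivity)
  have h4 : ∫ y, ‖f y‖ * ‖f' y‖ ≤ ‖hf.toLp f‖ * ‖hf'.toLp f'‖ := by
    have h5 := real_inner_le_norm (hf.norm.toLp _) (hf'.norm.toLp _)
    rw [L2.inner_def] at h5
    have e : ∀ {g : ℝ → E} (hg : MemLp g 2), ‖hg.norm.toLp _‖ = ‖hg.toLp g‖ := fun hg => by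
      rw [Lp.norm_toLp, Lp.norm_toLp, eLpNorm_norm]
    rw [e hf, e hf'] at h5
    refine le_trans (le_of_eq ?_) h5
    refine integral_congr_ae ?_
    filter_upwards [hf.norm.coeFn_toLp, hf'.norm.coeFn_toLp] with y e1 e2
    rw [e1, e2]; simp [mul_comm]
  have h6 : ∫ y, 2 * (‖f y‖ * ‖f' y‖) = 2 * ∫ y, ‖f y‖ * ‖f' y‖ := integral_const_mul _ _
  linarith

/-- `|θ'|₂² ≤ |θ|₂ |θ''|₂`. -/
theorem norm_sq_sderiv_le (θ : 𝓢(ℝ, ℂ)) :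
    ‖(sderiv θ).toLp 2 volume‖ ^ 2 ≤ ‖θ.toLp 2 volume‖ * ‖(sderiv (sderiv θ)).toLp 2 volume‖ := by
  have e1 : ∀ φ ψ : 𝓢(ℝ, ℂ), (inner ℂ (φ.toLp 2 volume) (ψ.toLp 2 volume) : ℂ) =
      ∫ x, ψ x * star (φ x) := by
    intro φ ψ
    rw [L2.inner_def]
    refine integral_congr_ae ?_
    filter_upwards [φ.coeFn_toLp 2 volume, ψ.coeFn_toLp 2 volume] with x h1 h2
    rw [h1, h2]; rfl
  have hi : ∀ φ ψ : 𝓢(ℝ, ℂ), Integrable fun x => ψ x * star (φ x) := fun φ ψ =>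
    (ψ.memLp 2).integrable_mul (φ.memLp 2).star
  have h0 := integral_eq_zero_of_hasDerivAt_of_integrable
    (f := fun x => sderiv θ x * star (θ x))
    (f' := fun x => sderiv (sderiv θ) x * star (θ x) + sderiv θ x * star (sderiv θ x))
    (fun x => (hasDerivAt_schwartz _ x).mul (hasDerivAt_schwartz θ x).star)
    ((hi _ _).add (hi _ _)) (hi _ _)
  rw [integral_add (hi _ _) (hi _ _), ← e1, ← e1] at h0
  have h1 : (inner ℂ ((sderiv θ).toLp 2 volume) ((sderiv θ).toLp 2 volume) : ℂ) =
      -inner ℂ (θ.toLp 2 volume) ((sderiv (sderiv θ)).toLp 2 volume) :=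
    eq_neg_of_add_eq_zero_right h0
  rw [inner_self_eq_norm_sq_to_K] at h1
  have h2 := congrArg norm h1
  rw [norm_neg, norm_pow] at h2
  simp only [Complex.coe_algebraMap, Complex.norm_real, norm_norm] at h2
  rw [h2]
  exact norm_inner_le_norm _ _

theorem norm_schwartz_pow_four_le (θ : 𝓢(ℝ, ℂ)) (x : ℝ) :
    ‖θ x‖ ^ 4 ≤ 4 * (‖θ.toLp 2 volume‖ ^ 3 * ‖(sderiv (sderiv θ)).toLp 2 volume‖) := by
  have h1 := norm_sq_le_of_hasDerivAt (θ.memLp 2) ((sderiv θ).memLp 2) (hasDerivAt_schwartz θ) x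
  change ‖θ x‖ ^ 2 ≤ 2 * (‖θ.toLp 2 volume‖ * ‖(sderiv θ).toLp 2 volume‖) at h1
  have h2 := norm_sq_sderiv_le θ
  have h3 := pow_le_pow_left₀ (sq_nonneg _) h1 2
  have h4 := mul_le_mul_of_nonneg_left h2 (sq_nonneg ‖θ.toLp 2 volume‖)
  calc ‖θ x‖ ^ 4 = (‖θ x‖ ^ 2) ^ 2 := by ring
    _ ≤ _ := h3
    _ = 4 * (‖θ.toLp 2 volume‖ ^ 2 * ‖(sderiv θ).toLp 2 volume‖ ^ 2) := by ring
    _ ≤ 4 * (‖θ.toLp 2 volume‖ ^ 2 * (‖θ.toLp 2 volume‖ *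
          ‖(sderiv (sderiv θ)).toLp 2 volume‖)) := by gcongr
    _ = _ := by ring

/-! ### Trigonometric potentials -/

/-- Finite sums of waves with positive frequencies. -/
def trigPotential (Θ : ℕ →₀ 𝓢(ℝ, ℂ)) (p : Cyl) : ℝ := Θ.sum fun n θ => wave (n + 1) θ p

/-- The `x`-derivative of a finite sum of waves, in the energy space. -/
def trigEnergy (Θ : ℕ →₀ 𝓢(ℝ, ℂ)) : EnergySpace := Θ.sum fun n θ => dxWave (n + 1) θ

theorem synth_ae (n : ℤ) (f : L2Line) : (synth n f : Cyl → ℝ) =ᵐ[volume] wave n f :=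
  MemLp.coeFn_toLp _

theorem synth_add (n : ℤ) (f g : L2Line) : synth n (f + g) = synth n f + synth n g := by
  refine Lp.ext ?_
  have h0 := Measure.quasiMeasurePreserving_fst (μ := (volume : Measure ℝ))
    (ν := (volume : Measure Torus)) |>.ae (Lp.coeFn_add f g)
  filter_upwards [synth_ae n (f + g), synth_ae n f, synth_ae n g,
    Lp.coeFn_add (synth n f) (synth n g), h0] with p h1 h2 h3 h4 h5
  rw [h1, h4, Pi.add_apply, h2, h3, wave, wave, wave, h5, Pi.add_apply, add_mul, Complex.add_re]

theorem synth_smul (n : ℤ) (r : ℝ) (f : L2Line) : synth n (r • f) = r • synth n f := by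
  refine Lp.ext ?_
  have h0 := Measure.quasiMeasurePreserving_fst (μ := (volume : Measure ℝ))
    (ν := (volume : Measure Torus)) |>.ae (Lp.coeFn_smul r f)
  filter_upwards [synth_ae n (r • f), synth_ae n f,
    Lp.coeFn_smul r (synth n f), h0] with p h1 h2 h4 h5
  rw [h1, h4, Pi.smul_apply, h2, wave, wave, h5, Pi.smul_apply, Complex.real_smul, mul_assoc,
    Complex.re_ofReal_mul, smul_eq_mul]

theorem toLp_add_schwartz (θ φ : 𝓢(ℝ, ℂ)) :
    (θ + φ).toLp 2 (volume : Measure ℝ) = θ.toLp 2 volume + φ.toLp 2 volume := rfl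

theorem toLp_zero_schwartz : (0 : 𝓢(ℝ, ℂ)).toLp 2 (volume : Measure ℝ) = 0 := rfl

theorem toLp_smul_schwartz (r : ℝ) (θ : 𝓢(ℝ, ℂ)) :
    (r • θ).toLp 2 (volume : Measure ℝ) = r • θ.toLp 2 volume := rfl

/-- `θ ↦ Re (θ(x) e^{iny})` as a linear map. -/
def schwartzWaveₗ (n : ℤ) : 𝓢(ℝ, ℂ) →ₗ[ℝ] L2Cyl where
  toFun := schwartzWave n
  map_add' θ φ := by
    rw [schwartzWave, schwartzWave, schwartzWave, toLp_add_schwartz, synth_add]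
  map_smul' r θ := by
    rw [schwartzWave, schwartzWave, toLp_smul_schwartz, synth_smul]; rfl

theorem schwartzWave_add (n : ℤ) (θ φ : 𝓢(ℝ, ℂ)) :
    schwartzWave n (θ + φ) = schwartzWave n θ + schwartzWave n φ := map_add (schwartzWaveₗ n) θ φ

theorem schwartzWave_smul (n : ℤ) (r : ℝ) (θ : 𝓢(ℝ, ℂ)) :
    schwartzWave n (r • θ) = r • schwartzWave n θ := map_smul (schwartzWaveₗ n) r θ

theorem sderiv_add (θ φ : 𝓢(ℝ, ℂ)) : sderiv (θ + φ) = sderiv θ + sderiv φ := map_add _ _ _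

theorem sderiv_smul (r : ℝ) (θ : 𝓢(ℝ, ℂ)) : sderiv (r • θ) = r • sderiv θ := by
  have : ∀ φ : 𝓢(ℝ, ℂ), r • φ = (r : ℂ) • φ := fun φ => by ext x; simp
  rw [this, this]; exact map_smul _ _ _

/-- `dxWave` as a linear map. -/
def dxWaveₗ (n : ℤ) : 𝓢(ℝ, ℂ) →ₗ[ℝ] EnergySpace where
  toFun := dxWave n
  map_add' θ φ := EnergySpace.ext_fn (by
    change schwartzWave n (sderiv (θ + φ)) = schwartzWave n (sderiv θ) + schwartzWave n (sderiv φ)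
    rw [sderiv_add, schwartzWave_add])
  map_smul' r θ := EnergySpace.ext_fn (by
    change schwartzWave n (sderiv (r • θ)) = r • schwartzWave n (sderiv θ)
    rw [sderiv_smul, schwartzWave_smul])

/-- `zeroWave` as a linear map. -/
def zeroWaveₗ : 𝓢(ℝ, ℂ) →ₗ[ℝ] EnergySpace where
  toFun := zeroWave
  map_add' θ φ := EnergySpace.ext_fn (schwartzWave_add 0 θ φ)
  map_smul' r θ := EnergySpace.ext_fn (schwartzWave_smul 0 r θ)

theorem trigEnergy_eq (Θ : ℕ →₀ 𝓢(ℝ, ℂ)) :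
    trigEnergy Θ = Finsupp.lsum ℝ (fun n : ℕ => dxWaveₗ (n + 1)) Θ := rfl

theorem trigEnergy_sub (Θ Θ' : ℕ →₀ 𝓢(ℝ, ℂ)) :
    trigEnergy (Θ - Θ') = trigEnergy Θ - trigEnergy Θ' := by
  simp only [trigEnergy_eq, map_sub]

theorem trigPotential_sub (Θ Θ' : ℕ →₀ 𝓢(ℝ, ℂ)) (p : Cyl) :
    trigPotential (Θ - Θ') p = trigPotential Θ p - trigPotential Θ' p := by
  refine Finsupp.sum_sub_index fun n θ φ => ?_
  simp only [wave, sub_apply, sub_mul, Complex.sub_re]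

theorem span_dxWave_eq : (Submodule.span ℝ
    {w | ∃ (n : ℤ) (θ : 𝓢(ℝ, ℂ)), 0 < n ∧ w = dxWave n θ} : Set EnergySpace) ⊆
    Set.range trigEnergy := by
  have : Submodule.span ℝ {w | ∃ (n : ℤ) (θ : 𝓢(ℝ, ℂ)), 0 < n ∧ w = dxWave n θ} ≤
      LinearMap.range (Finsupp.lsum ℝ (fun n : ℕ => dxWaveₗ (n + 1))) := by
    rw [Submodule.span_le]
    rintro _ ⟨n, θ, hn, rfl⟩
    refine ⟨Finsupp.single (n - 1).toNat θ, ?_⟩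
    rw [Finsupp.lsum_single]
    change dxWave (((n - 1).toNat : ℤ) + 1) θ = dxWave n θ
    congr 1; omega
  intro w hw
  obtain ⟨Θ, h⟩ := this hw
  exact ⟨Θ, h⟩

theorem exists_trigEnergy_tendsto {v : EnergySpace} (hv : mode 0 v.fn = 0) :
    ∃ Θ : ℕ → ℕ →₀ 𝓢(ℝ, ℂ), Tendsto (fun k => trigEnergy (Θ k)) atTop (𝓝 v) := by
  obtain ⟨w, hw, hwv⟩ := mem_closure_iff_seq_limit.1
    (closure_mono span_dxWave_eq (mem_closure_span_dxWave hv))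
  choose Θ hΘ using hw
  exact ⟨Θ, by simpa only [hΘ] using hwv⟩

theorem exists_zeroWave_tendsto {v : EnergySpace} (hv : IsZeroMode v.fn) :
    ∃ θ : ℕ → 𝓢(ℝ, ℂ), Tendsto (fun k => zeroWave (θ k)) atTop (𝓝 v) := by
  have h : (Submodule.span ℝ (Set.range zeroWave) : Set EnergySpace) ⊆ Set.range zeroWave := by
    have : Submodule.span ℝ (Set.range zeroWave) ≤ LinearMap.range zeroWaveₗ := by
      rw [Submodule.span_le]
      rintro _ ⟨θ, rfl⟩
      exact ⟨θ, rfl⟩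
    intro w hw
    obtain ⟨θ, h⟩ := this hw
    exact ⟨θ, h⟩
  obtain ⟨w, hw, hwv⟩ := mem_closure_iff_seq_limit.1
    (closure_mono h (mem_closure_span_zeroWave hv))
  choose θ hθ using hw
  exact ⟨θ, by simpa only [hθ] using hwv⟩

theorem mode_schwartzWave_succ (n k : ℕ) (θ : 𝓢(ℝ, ℂ)) :
    mode (n + 1 : ℤ) (schwartzWave (k + 1 : ℤ) θ) =
      if n = k then (Real.sqrt (2 * Real.pi) / 2 : ℝ) • θ.toLp 2 volume else 0 := by
  rw [schwartzWave, mode_synth, if_neg (c := (n + 1 : ℤ) = -(k + 1)) (by omega), add_zero]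
  by_cases h : n = k
  · rw [if_pos (by omega), if_pos h]
  · rw [if_neg (by omega), if_neg h, smul_zero]

theorem mode_dx_trigEnergy (Θ : ℕ →₀ 𝓢(ℝ, ℂ)) (n : ℕ) :
    mode (n + 1 : ℤ) (trigEnergy Θ).dx =
      (Real.sqrt (2 * Real.pi) / 2 : ℝ) • (sderiv (sderiv (Θ n))).toLp 2 volume := by
  induction Θ using Finsupp.induction_linear with
  | zero => 
    rw [trigEnergy_eq, map_zero]
    change mode _ 0 = _
    simp [sderiv, toLp_zero_schwartz]
  | add Θ Θ' h1 h2 =>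
    have : (trigEnergy (Θ + Θ')).dx = (trigEnergy Θ).dx + (trigEnergy Θ').dx := by
      rw [trigEnergy_eq, map_add]; rfl
    rw [this, map_add, h1, h2, ← smul_add, Finsupp.add_apply, sderiv_add, sderiv_add,
      toLp_add_schwartz]
  | single k θ =>
    have : (trigEnergy (Finsupp.single k θ)) = dxWave (k + 1) θ := by
      rw [trigEnergy_eq, Finsupp.lsum_single]; rfl
    rw [this]
    change mode (n + 1 : ℤ) (schwartzWave (k + 1) (sderiv (sderiv θ))) = _
    rw [mode_schwartzWave_succ]
    split_ifs with h
    · rw [h, Finsupp.single_eq_same]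
    · rw [Finsupp.single_eq_of_ne h]; simp [sderiv, toLp_zero_schwartz]

theorem mode_dxInvDy_trigEnergy (Θ : ℕ →₀ 𝓢(ℝ, ℂ)) (n : ℕ) :
    mode (n + 1 : ℤ) (trigEnergy Θ).dxInvDy =
      (Real.sqrt (2 * Real.pi) / 2 : ℝ) •
        ((Complex.I * ((n + 1 : ℤ) : ℂ)) • Θ n).toLp 2 volume := by
  induction Θ using Finsupp.induction_linear with
  | zero => 
    rw [trigEnergy_eq, map_zero]
    change mode _ 0 = _
    simp [toLp_zero_schwartz]
  | add Θ Θ' h1 h2 =>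
    have : (trigEnergy (Θ + Θ')).dxInvDy = (trigEnergy Θ).dxInvDy + (trigEnergy Θ').dxInvDy := by
      rw [trigEnergy_eq, map_add]; rfl
    rw [this, map_add, h1, h2, ← smul_add, Finsupp.add_apply, smul_add (Complex.I * _),
      toLp_add_schwartz]
  | single k θ =>
    have : (trigEnergy (Finsupp.single k θ)) = dxWave (k + 1) θ := by
      rw [trigEnergy_eq, Finsupp.lsum_single]; rfl
    rw [this]
    change mode (n + 1 : ℤ) (schwartzWave (k + 1) ((Complex.I * ((k + 1 : ℤ) : ℂ)) • θ)) = _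
    rw [mode_schwartzWave_succ]
    split_ifs with h
    · rw [h, Finsupp.single_eq_same]
    · rw [Finsupp.single_eq_of_ne h]; simp [toLp_zero_schwartz]

/-- For a single coefficient, |θ|_∞⁴ ≤ 4|θ|₂³|θ''|₂. The energy controls (n+1)|θ|₂ and |θ''|₂ by a
square-summable sequence e, so |θ|_∞ is at most a constant times (n+1)^{-3/4} e n. Cauchy–Schwarz
applies because ∑ (n+1)^{-3/2} converges. -/
theorem exists_sup_bound : ∃ K : ℝ, 0 < K ∧ ∀ (Θ : ℕ →₀ 𝓢(ℝ, ℂ)) (p : Cyl),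
    |trigPotential Θ p| ≤ K * ‖trigEnergy Θ‖ := by
  have hs : Summable fun n : ℕ => ((n : ℝ) + 1) ^ (-(3 / 2) : ℝ) := by
    have := (summable_nat_add_iff 1).2 (Real.summable_nat_rpow.2 (by norm_num : (-(3 / 2) : ℝ) < -1))
    simpa using this
  set S := ∑' n : ℕ, ((n : ℝ) + 1) ^ (-(3 / 2) : ℝ) with hS
  set c0 : ℝ := Real.sqrt (2 * Real.pi) / 2 with hc0
  have hc0pos : 0 < c0 := by have := Real.sqrt_pos.2 Real.two_pi_pos; positivity
  -- The added 1 only makes the constant visibly positive.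
  refine ⟨Real.sqrt 2 / c0 * Real.sqrt S + 1, by positivity, fun Θ p => ?_⟩
  set w := trigEnergy Θ with hw
  set e : ℕ → ℝ := fun n => Real.sqrt (‖mode (n + 1 : ℤ) w.dxInvDy‖ ^ 2 + ‖mode (n + 1 : ℤ) w.dx‖ ^ 2)
  have he : ∀ n, e n ^ 2 = ‖mode (n + 1 : ℤ) w.dxInvDy‖ ^ 2 + ‖mode (n + 1 : ℤ) w.dx‖ ^ 2 :=
    fun n => Real.sq_sqrt (by positivity)
  have he0 : ∀ n, 0 ≤ e n := fun n => Real.sqrt_nonneg _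
  have hsum : ∑ n ∈ Θ.support, e n ^ 2 ≤ ‖w‖ ^ 2 := by
    simp only [he, Finset.sum_add_distrib]
    have hle : ∀ u : L2Cyl, ∑ n ∈ Θ.support, ‖mode ((n : ℤ) + 1) u‖ ^ 2 ≤ ‖u‖ ^ 2 := by
      intro u
      have h1 := sum_le_hasSum (Θ.support.map ⟨fun n : ℕ => (n : ℤ) + 1, fun a b h => by
        simpa using h⟩) (fun _ _ => by positivity) (hasSum_norm_mode_sq u)
      rwa [Finset.sum_map] at h1
    rw [EnergySpace.norm_sq]
    nlinarith [hle w.dxInvDy, hle w.dx, sq_nonneg ‖w.fn‖]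
  have hterm : ∀ n : ℕ, |wave (n + 1) (Θ n) p| ≤
      Real.sqrt 2 / c0 * (((n : ℝ) + 1) ^ (-(3 / 4) : ℝ) * e n) := by
    intro n
    refine (abs_wave_le _ _ _).trans ?_
    have h1 := norm_schwartz_pow_four_le (Θ n) p.1
    have h2 : ‖mode (n + 1 : ℤ) w.dxInvDy‖ = c0 * ((n + 1) * ‖(Θ n).toLp 2 volume‖) := by
      rw [hw, mode_dxInvDy_trigEnergy, norm_smul, Real.norm_of_nonneg hc0pos.le]
      have : ((Complex.I * ((n + 1 : ℤ) : ℂ)) • Θ n).toLp 2 volume =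
        (Complex.I * ((n + 1 : ℤ) : ℂ)) • (Θ n).toLp 2 volume := rfl
      rw [this, norm_smul, norm_mul, Complex.norm_I, one_mul, Complex.norm_intCast]
      push_cast
      rw [abs_of_nonneg (by positivity : (0 : ℝ) ≤ n + 1)]
    have h3 : ‖mode (n + 1 : ℤ) w.dx‖ = c0 * ‖(sderiv (sderiv (Θ n))).toLp 2 volume‖ := by
      rw [hw, mode_dx_trigEnergy, norm_smul, Real.norm_of_nonneg hc0pos.le]
    set A := ‖(Θ n).toLp 2 volume‖
    set B := ‖(sderiv (sderiv (Θ n))).toLp 2 volume‖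
    have hA : c0 * ((n + 1) * A) ≤ e n := by
      rw [← h2]; exact Real.le_sqrt_of_sq_le (by nlinarith [sq_nonneg ‖mode (n + 1 : ℤ) w.dx‖])
    have hB : c0 * B ≤ e n := by
      rw [← h3]; exact Real.le_sqrt_of_sq_le (by nlinarith [sq_nonneg ‖mode (n + 1 : ℤ) w.dxInvDy‖])
    have hA0 : 0 ≤ A := norm_nonneg _
    have hB0 : 0 ≤ B := norm_nonneg _
    have hN : (0 : ℝ) < n + 1 := by positivity
    refine le_of_pow_le_pow_left₀ (n := 4) (by norm_num) (by have := he0 n; positivity) ?_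
    refine h1.trans ?_
    have hr : (((n : ℝ) + 1) ^ (-(3 / 4) : ℝ)) ^ 4 = ((n + 1 : ℝ) ^ 3)⁻¹ := by
      rw [← Real.rpow_natCast, ← Real.rpow_mul hN.le, ← Real.rpow_natCast, ← Real.rpow_neg hN.le]
      norm_num
    have h2' : Real.sqrt 2 ^ 4 = 4 := by
      rw [show (4 : ℕ) = 2 * 2 from rfl, pow_mul, Real.sq_sqrt zero_le_two]; norm_num
    rw [mul_pow, mul_pow, div_pow, h2', hr]
    have h5 : (c0 * ((n + 1) * A)) ^ 3 * (c0 * B) ≤ e n ^ 3 * e n := by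
      gcongr
    calc 4 * (A ^ 3 * B) = 4 / c0 ^ 4 * (((n + 1 : ℝ) ^ 3)⁻¹ * ((c0 * ((n + 1) * A)) ^ 3 * (c0 * B))) := by
          field_simp
      _ ≤ 4 / c0 ^ 4 * (((n + 1 : ℝ) ^ 3)⁻¹ * (e n ^ 3 * e n)) := by gcongr
      _ = _ := by ring
  calc |trigPotential Θ p| ≤ ∑ n ∈ Θ.support, |wave (n + 1) (Θ n) p| :=
        Finset.abs_sum_le_sum_abs _ _
    _ ≤ ∑ n ∈ Θ.support, Real.sqrt 2 / c0 * (((n : ℝ) + 1) ^ (-(3 / 4) : ℝ) * e n) :=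
        Finset.sum_le_sum fun n _ => hterm n
    _ = Real.sqrt 2 / c0 * ∑ n ∈ Θ.support, ((n : ℝ) + 1) ^ (-(3 / 4) : ℝ) * e n := by
        rw [Finset.mul_sum]
    _ ≤ Real.sqrt 2 / c0 * (Real.sqrt S * ‖w‖) := by
        gcongr
        refine le_of_sq_le_sq ?_ (by positivity)
        refine (Finset.sum_mul_sq_le_sq_mul_sq _ _ _).trans ?_
        rw [mul_pow, Real.sq_sqrt (tsum_nonneg fun n => by positivity)]
        refine mul_le_mul ?_ hsum (Finset.sum_nonneg fun n _ => by positivity)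
          (tsum_nonneg fun n => by positivity)
        have : ∀ n : ℕ, (((n : ℝ) + 1) ^ (-(3 / 4) : ℝ)) ^ 2 = ((n : ℝ) + 1) ^ (-(3 / 2) : ℝ) := by
          intro n
          rw [← Real.rpow_natCast, ← Real.rpow_mul (by positivity)]
          norm_num
        simp only [this]
        exact hs.sum_le_tsum _ fun n _ => by positivity
    _ ≤ _ := by
        rw [add_mul, one_mul, ← mul_assoc]
        linarith [norm_nonneg w]

/-! ### Integration by parts on the cylinder -/

/-- The integral over the cylinder of an `x`-derivative vanishes. -/
theorem integral_eq_zero_of_hasDerivAt_fst {G G' : Cyl → ℝ}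
    (h : ∀ x y, HasDerivAt (fun x => G (x, y)) (G' (x, y)) x) (hG : Integrable G)
    (hG' : Integrable G') : ∫ p, G' p = 0 := by
  change Integrable G ((volume : Measure ℝ).prod (volume : Measure Torus)) at hG
  change Integrable G' ((volume : Measure ℝ).prod (volume : Measure Torus)) at hG'
  change ∫ p, G' p ∂((volume : Measure ℝ).prod (volume : Measure Torus)) = 0
  rw [integral_prod_symm _ hG']
  refine integral_eq_zero_of_ae ?_
  filter_upwards [hG.prod_left_ae, hG'.prod_left_ae] with y h1 h2
  exact integral_eq_zero_of_hasDerivAt_of_integrable (fun x => h x y) h2 h1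

/-- The integral over the torus of a derivative vanishes. -/
theorem integral_torus_eq_zero_of_hasDerivAt {F F' : Torus → ℝ} (hc : Continuous F')
    (h : ∀ t : ℝ, HasDerivAt (fun t : ℝ => F (t : Torus)) (F' (t : Torus)) t) :
    ∫ y, F' y = 0 := by
  rw [← AddCircle.intervalIntegral_preimage (2 * Real.pi) 0,
    intervalIntegral.integral_eq_sub_of_hasDerivAt (fun t _ => h t)
      ((hc.comp (AddCircle.continuous_mk' _)).intervalIntegrable _ _), AddCircle.coe_add_period,
    sub_self]

/-- The integral over the cylinder of a `y`-derivative vanishes. -/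
theorem integral_eq_zero_of_hasDerivAt_snd {G G' : Cyl → ℝ}
    (h : ∀ (x t : ℝ), HasDerivAt (fun t : ℝ => G (x, (t : Torus))) (G' (x, (t : Torus))) t)
    (hc : Continuous G') (hG' : Integrable G') : ∫ p, G' p = 0 := by
  change Integrable G' ((volume : Measure ℝ).prod (volume : Measure Torus)) at hG'
  change ∫ p, G' p ∂((volume : Measure ℝ).prod (volume : Measure Torus)) = 0
  rw [integral_prod _ hG']
  refine integral_eq_zero_of_ae (Eventually.of_forall fun x => ?_)
  exact integral_torus_eq_zero_of_hasDerivAt (F := fun y => G (x, y)) (F' := fun y => G' (x, y))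
    (by fun_prop) (h x)

theorem hasDerivAt_wave_fst (n : ℤ) {f : ℝ → ℂ} {f' : ℂ} {x : ℝ} (h : HasDerivAt f f' x)
    (y : Torus) :
    HasDerivAt (fun x => wave n f (x, y)) (f' * _root_.fourier n y).re x := by
  have h1 := h.mul_const (_root_.fourier n y)
  exact Complex.reCLM.hasFDerivAt.comp_hasDerivAt x h1

theorem hasDerivAt_wave_snd (n : ℤ) (f : ℝ → ℂ) (x t : ℝ) :
    HasDerivAt (fun t : ℝ => wave n f (x, (t : Torus)))
      (wave n (fun x => Complex.I * n * f x) (x, (t : Torus))) t := by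
  have h := (hasDerivAt_fourier (2 * Real.pi) n t).const_mul (f x)
  have h2 := Complex.reCLM.hasFDerivAt.comp_hasDerivAt t h
  refine h2.congr_deriv ?_
  have : (Real.pi : ℂ) ≠ 0 := by exact_mod_cast Real.pi_ne_zero
  rw [wave, Complex.reCLM_apply]
  congr 1
  push_cast
  field_simp

theorem continuous_wave (n : ℤ) {f : ℝ → ℂ} (hf : Continuous f) : Continuous (wave n f) := by
  unfold wave; fun_prop

/-! ### Trigonometric sums of Schwartz functions -/

/-- `∑ Re (g n (Θ n) (x) e^{i(n+1)y})`. -/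
def trigSum (g : ℕ → 𝓢(ℝ, ℂ) → 𝓢(ℝ, ℂ)) (Θ : ℕ →₀ 𝓢(ℝ, ℂ)) (p : Cyl) : ℝ :=
  ∑ n ∈ Θ.support, wave (n + 1) (g n (Θ n)) p

theorem continuous_trigSum (g : ℕ → 𝓢(ℝ, ℂ) → 𝓢(ℝ, ℂ)) (Θ : ℕ →₀ 𝓢(ℝ, ℂ)) :
    Continuous (trigSum g Θ) :=
  continuous_finsetSum _ fun n _ => continuous_wave _ (g n (Θ n)).continuous

theorem bound_trigSum (g : ℕ → 𝓢(ℝ, ℂ) → 𝓢(ℝ, ℂ)) (Θ : ℕ →₀ 𝓢(ℝ, ℂ)) :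
    ∃ C : ℝ, ∀ p, |trigSum g Θ p| ≤ C := by
  have h : ∀ θ : 𝓢(ℝ, ℂ), ∃ C : ℝ, ∀ x, ‖θ x‖ ≤ C := fun θ => by
    obtain ⟨C, hC⟩ := θ.decay 0 0
    exact ⟨C, fun x => by simpa using hC.2 x⟩
  choose C hC using h
  refine ⟨∑ n ∈ Θ.support, C (g n (Θ n)), fun p => (Finset.abs_sum_le_sum_abs _ _).trans ?_⟩
  exact Finset.sum_le_sum fun n _ => (abs_wave_le _ _ _).trans (hC _ _)

theorem memLp_trigSum (g : ℕ → 𝓢(ℝ, ℂ) → 𝓢(ℝ, ℂ)) (Θ : ℕ →₀ 𝓢(ℝ, ℂ)) :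
    MemLp (trigSum g Θ) 2 :=
  memLp_finsetSum _ fun n _ => memLp_wave _ ((g n (Θ n)).memLp 2)

/-- The first `x`-derivative of a trigonometric potential. -/
def trigX : (ℕ →₀ 𝓢(ℝ, ℂ)) → Cyl → ℝ := trigSum fun _ θ => sderiv θ
/-- The second `x`-derivative of a trigonometric potential. -/
def trigXX : (ℕ →₀ 𝓢(ℝ, ℂ)) → Cyl → ℝ := trigSum fun _ θ => sderiv (sderiv θ)
/-- The `y`-derivative of a trigonometric potential. -/
def trigY : (ℕ →₀ 𝓢(ℝ, ℂ)) → Cyl → ℝ := trigSum fun n θ => (Complex.I * ((n + 1 : ℤ) : ℂ)) • θ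

theorem hasDerivAt_trigPotential (Θ : ℕ →₀ 𝓢(ℝ, ℂ)) (x : ℝ) (y : Torus) :
    HasDerivAt (fun x => trigPotential Θ (x, y)) (trigX Θ (x, y)) x :=
  HasDerivAt.fun_sum fun _ _ => hasDerivAt_wave_fst _ (hasDerivAt_schwartz _ x) y

theorem hasDerivAt_trigX (Θ : ℕ →₀ 𝓢(ℝ, ℂ)) (x : ℝ) (y : Torus) :
    HasDerivAt (fun x => trigX Θ (x, y)) (trigXX Θ (x, y)) x :=
  HasDerivAt.fun_sum fun _ _ => hasDerivAt_wave_fst _ (hasDerivAt_schwartz _ x) y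

theorem hasDerivAt_trigPotential_snd (Θ : ℕ →₀ 𝓢(ℝ, ℂ)) (x t : ℝ) :
    HasDerivAt (fun t : ℝ => trigPotential Θ (x, (t : Torus))) (trigY Θ (x, (t : Torus))) t :=
  HasDerivAt.fun_sum fun _ _ => hasDerivAt_wave_snd _ _ x t

theorem coeFn_sum_ae {f : ℕ → L2Cyl} {g : ℕ → Cyl → ℝ} (h : ∀ n, f n =ᵐ[volume] g n)
    (s : Finset ℕ) : (∑ n ∈ s, f n : L2Cyl) =ᵐ[volume] fun p => ∑ n ∈ s, g n p := by
  induction s using Finset.cons_induction with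
  | empty => exact Lp.coeFn_zero ℝ 2 (volume : Measure Cyl)
  | cons a s ha ih =>
    rw [Finset.sum_cons]
    filter_upwards [Lp.coeFn_add (f a) (∑ n ∈ s, f n), h a, ih] with p h1 h2 h3
    rw [h1, Pi.add_apply, h2, h3, Finset.sum_cons]

theorem trigEnergy_fn_ae (Θ : ℕ →₀ 𝓢(ℝ, ℂ)) : (trigEnergy Θ).fn =ᵐ[volume] trigX Θ := by
  rw [← EnergySpace.fnL_apply, trigEnergy, Finsupp.sum, map_sum]
  exact coeFn_sum_ae (fun n => schwartzWave_coeFn _ _) _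

theorem trigEnergy_dx_ae (Θ : ℕ →₀ 𝓢(ℝ, ℂ)) : (trigEnergy Θ).dx =ᵐ[volume] trigXX Θ := by
  rw [← EnergySpace.dxL_apply, trigEnergy, Finsupp.sum, map_sum]
  exact coeFn_sum_ae (fun n => schwartzWave_coeFn _ _) _

theorem trigEnergy_dxInvDy_ae (Θ : ℕ →₀ 𝓢(ℝ, ℂ)) :
    (trigEnergy Θ).dxInvDy =ᵐ[volume] trigY Θ := by
  rw [← EnergySpace.dxInvDyL_apply, trigEnergy, Finsupp.sum, map_sum]
  exact coeFn_sum_ae (fun n => schwartzWave_coeFn _ _) _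

/-! ### The embedding of the energy space in `L⁴` -/

theorem _root_.MeasureTheory.MemLp.mul_of_bound {α : Type*} [MeasurableSpace α] {μ : Measure α} {f g : α → ℝ} {C : ℝ}
    {p : ℝ≥0∞} (hf : MemLp f p μ) (hg : AEStronglyMeasurable g μ) (h : ∀ x, |g x| ≤ C) :
    MemLp (fun x => g x * f x) p μ :=
  MemLp.of_le_mul (c := C) hf (hg.mul hf.1) (Eventually.of_forall fun x => by
    rw [norm_mul]; exact mul_le_mul_of_nonneg_right (h x) (norm_nonneg _))

theorem inner_toLp {f g : Cyl → ℝ} (hf : MemLp f 2) (hg : MemLp g 2) :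
    inner ℝ (hf.toLp f) (hg.toLp g) = ∫ p, f p * g p := by
  rw [L2.inner_def]
  refine integral_congr_ae ?_
  filter_upwards [hf.coeFn_toLp, hg.coeFn_toLp] with p h1 h2
  rw [h1, h2]; simp [mul_comm]

theorem eLpNorm_four_le_of_sq {f : Cyl → ℝ} {C : ℝ} (hC : 0 ≤ C)
    (h : MemLp (fun p => f p ^ 2) 2) (hn : ‖h.toLp _‖ ≤ C ^ 2) :
    eLpNorm f 4 volume ≤ ENNReal.ofReal C := by
  have h1 : eLpNorm (fun p => f p ^ 2) 2 volume = eLpNorm f 4 volume ^ (2 : ℝ) := by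
    have := eLpNorm_norm_rpow (p := 2) (μ := volume) f (q := 2) (by norm_num)
    rw [show (2 : ℝ≥0∞) * ENNReal.ofReal 2 = 4 by
      rw [show (2 : ℝ) = ((2 : ℕ) : ℝ) by norm_num, ENNReal.ofReal_natCast]; norm_num] at this
    rw [← this]
    refine eLpNorm_congr_norm_ae (Eventually.of_forall fun p => ?_)
    simp
  rw [Lp.norm_toLp, h1] at hn
  have h2 : eLpNorm f 4 volume ^ (2 : ℝ) ≤ ENNReal.ofReal (C ^ 2) := by
    rw [← h1] at hn ⊢
    exact (ENNReal.le_ofReal_iff_toReal_le h.eLpNorm_ne_top (by positivity)).2 hn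
  rw [show C ^ 2 = C ^ (2 : ℝ) by norm_cast, ← ENNReal.ofReal_rpow_of_nonneg hC (by norm_num)] at h2
  exact (ENNReal.rpow_le_rpow_iff (by norm_num)).1 h2

/-- For X = ∂_x W, integrating ∂_x(W X³) gives ∫ X⁴ = -3 ∫ W ∂_x²W X². The sup bound on W and
Cauchy–Schwarz give |X²|₂² ≤ 3K‖·‖²|X²|₂, and one factor cancels. -/
theorem exists_trigEnergy_four_bound : ∃ C : ℝ, 0 ≤ C ∧ ∀ Θ : ℕ →₀ 𝓢(ℝ, ℂ),
    eLpNorm (trigEnergy Θ).fn 4 volume ≤ ENNReal.ofReal (C * ‖trigEnergy Θ‖) := by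
  obtain ⟨K, hK, hsup⟩ := exists_sup_bound
  refine ⟨Real.sqrt (3 * K), by positivity, fun Θ => ?_⟩
  obtain ⟨C1, h1⟩ : ∃ C, ∀ p, |trigX Θ p| ≤ C := bound_trigSum _ Θ
  have mW : MemLp (trigPotential Θ) 2 := memLp_trigSum (fun _ θ => θ) Θ
  have mX : MemLp (trigX Θ) 2 := memLp_trigSum _ Θ
  have mY : MemLp (trigXX Θ) 2 := memLp_trigSum _ Θ
  have hW := hasDerivAt_trigPotential Θ
  have hX := hasDerivAt_trigX Θ
  have hae := trigEnergy_fn_ae Θ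
  have hae' := trigEnergy_dx_ae Θ
  have hK' := hsup Θ
  generalize trigPotential Θ = W at *
  generalize trigX Θ = X at *
  generalize trigXX Θ = Y at *
  have mX2 : MemLp (fun p => X p * X p) 2 := mX.mul_of_bound mX.1 h1
  have mX3 : MemLp (fun p => X p * (X p * X p)) 2 := mX2.mul_of_bound mX.1 h1
  have mWY : MemLp (fun p => W p * Y p) 2 := mY.mul_of_bound mW.1 hK'
  have i1 : Integrable fun p => W p * (X p * (X p * X p)) := mW.integrable_mul mX3
  have i2 : Integrable fun p => X p * X p * (X p * X p) := mX2.integrable_mul mX2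
  have i3 : Integrable fun p => W p * Y p * (X p * X p) := mWY.integrable_mul mX2
  have key := integral_eq_zero_of_hasDerivAt_fst
    (G := fun p => W p * (X p * (X p * X p)))
    (G' := fun p => X p * X p * (X p * X p) + 3 * (W p * Y p * (X p * X p)))
    (fun x y => ((hW x y).mul ((hX x y).mul ((hX x y).mul (hX x y)))).congr_deriv (by
      simp only [Pi.mul_apply]; ring))
    i1 (i2.add (i3.const_mul 3))
  rw [integral_add i2 (i3.const_mul 3), integral_const_mul, ← inner_toLp mX2 mX2,
    ← inner_toLp mWY mX2, real_inner_self_eq_norm_sq] at key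
  set N := ‖mX2.toLp _‖
  have h5 : ‖mWY.toLp _‖ ≤ K * ‖trigEnergy Θ‖ * ‖trigEnergy Θ‖ := by
    have : ‖mWY.toLp _‖ ≤ K * ‖trigEnergy Θ‖ * ‖(trigEnergy Θ).dx‖ := by
      refine Lp.norm_le_mul_norm_of_ae_le_mul ?_
      filter_upwards [mWY.coeFn_toLp, hae'] with p e1 e2
      rw [e1, e2, norm_mul]
      exact mul_le_mul_of_nonneg_right (hK' p) (norm_nonneg _)
    exact this.trans (mul_le_mul_of_nonneg_left (EnergySpace.norm_dx_le _) (by positivity))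
  have h6 := (abs_le.1 (abs_real_inner_le_norm (mWY.toLp _) (mX2.toLp _))).1
  have hN : N ≤ 3 * K * ‖trigEnergy Θ‖ ^ 2 := by
    by_contra! hlt
    have hN0 : 0 < N := lt_of_le_of_lt (by positivity) hlt
    nlinarith
  rw [eLpNorm_congr_ae hae]
  have mX2' : MemLp (fun p => X p ^ 2) 2 := by simpa only [pow_two] using mX2
  refine eLpNorm_four_le_of_sq (by positivity) mX2' ?_
  rw [mul_pow, Real.sq_sqrt (by positivity)]
  refine le_trans (le_of_eq ?_) hN
  simp only [N, pow_two]

theorem memLp_fst {g : ℝ → ℝ} (hg : MemLp g 2) : MemLp (fun p : Cyl => g p.1) 2 := by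
  have h := memLp_wave 0 hg.ofReal
  refine h.ae_eq (Eventually.of_forall fun p => ?_)
  simp [wave]

theorem integral_fst (g : ℝ → ℝ) : ∫ p : Cyl, g p.1 = 2 * Real.pi * ∫ x, g x := by
  have h := integral_fun_fst (μ := (volume : Measure ℝ)) (ν := (volume : Measure Torus)) g
  change ∫ p : Cyl, g p.1 = _ at h
  rw [h, Measure.real, AddCircle.measure_univ, ENNReal.toReal_ofReal Real.two_pi_pos.le,
    smul_eq_mul]

theorem norm_sq_fst {g : ℝ → ℝ} (hg : MemLp g 2) :
    ‖(memLp_fst hg).toLp _‖ ^ 2 = 2 * Real.pi * ‖hg.toLp g‖ ^ 2 := by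
  rw [← real_inner_self_eq_norm_sq, inner_toLp, integral_fst fun x => g x * g x,
    ← real_inner_self_eq_norm_sq, L2.inner_def]
  congr 1
  refine integral_congr_ae ?_
  filter_upwards [hg.coeFn_toLp] with x h1
  rw [h1]; simp [pow_two]

/-- The sup norm of a function of `x` is controlled by its energy norm on the cylinder. -/
theorem sq_le_of_hasDerivAt_fst {g g' : ℝ → ℝ} (hg : MemLp g 2) (hg' : MemLp g' 2)
    (h : ∀ x, HasDerivAt g (g' x) x) (x : ℝ) :
    g x ^ 2 ≤ ‖(memLp_fst hg).toLp _‖ * ‖(memLp_fst hg').toLp _‖ := by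
  have h1 := norm_sq_le_of_hasDerivAt hg hg' h x
  have h2 := norm_sq_fst hg
  have h3 := norm_sq_fst hg'
  rw [Real.norm_eq_abs, sq_abs] at h1
  have e : ∀ {A B : ℝ}, 0 ≤ A → 0 ≤ B → A ^ 2 = 2 * Real.pi * B ^ 2 →
      A = Real.sqrt (2 * Real.pi) * B := fun {A B} hA hB h => by
    rw [← Real.sqrt_sq hA, h, Real.sqrt_mul Real.two_pi_pos.le, Real.sqrt_sq hB]
  rw [e (norm_nonneg _) (norm_nonneg _) h2, e (norm_nonneg _) (norm_nonneg _) h3]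
  refine h1.trans ?_
  have h4 : Real.sqrt (2 * Real.pi) * Real.sqrt (2 * Real.pi) = 2 * Real.pi :=
    Real.mul_self_sqrt Real.two_pi_pos.le
  have h5 : 0 ≤ ‖hg.toLp g‖ * ‖hg'.toLp g'‖ := by positivity
  calc 2 * (‖hg.toLp g‖ * ‖hg'.toLp g'‖) ≤ (2 * Real.pi) * (‖hg.toLp g‖ * ‖hg'.toLp g'‖) := by
        nlinarith [Real.pi_gt_three]
    _ = (Real.sqrt (2 * Real.pi) * Real.sqrt (2 * Real.pi)) * _ := by rw [h4]
    _ = _ := by ring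

theorem memLp_re_schwartz (θ : 𝓢(ℝ, ℂ)) : MemLp (fun x => (θ x).re) 2 := (θ.memLp 2).re

theorem schwartzWave_zero (θ : 𝓢(ℝ, ℂ)) :
    schwartzWave 0 θ = (memLp_fst (memLp_re_schwartz θ)).toLp _ := by
  refine Lp.ext ?_
  filter_upwards [schwartzWave_coeFn 0 θ, (memLp_fst (memLp_re_schwartz θ)).coeFn_toLp]
    with p h1 h2
  rw [h1, h2]; simp [wave]

theorem hasDerivAt_re_schwartz (θ : 𝓢(ℝ, ℂ)) (x : ℝ) :
    HasDerivAt (fun x => (θ x).re) (sderiv θ x).re x :=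
  (Complex.reCLM.hasFDerivAt (x := θ x)).comp_hasDerivAt x (hasDerivAt_schwartz θ x)

theorem abs_re_le_zeroWave (θ : 𝓢(ℝ, ℂ)) (x : ℝ) : |(θ x).re| ≤ ‖zeroWave θ‖ := by
  have h := sq_le_of_hasDerivAt_fst (memLp_re_schwartz θ) (memLp_re_schwartz (sderiv θ))
    (hasDerivAt_re_schwartz θ) x
  rw [← schwartzWave_zero, ← schwartzWave_zero] at h
  have h1 : ‖schwartzWave 0 θ‖ ≤ ‖zeroWave θ‖ := (zeroWave θ).norm_fn_le
  have h2 : ‖schwartzWave 0 (sderiv θ)‖ ≤ ‖zeroWave θ‖ := (zeroWave θ).norm_dx_le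
  refine abs_le_of_sq_le_sq (h.trans ?_) (norm_nonneg _)
  rw [pow_two]
  exact mul_le_mul h1 h2 (norm_nonneg _) (norm_nonneg _)

theorem zeroWave_four_bound (θ : 𝓢(ℝ, ℂ)) :
    eLpNorm (zeroWave θ).fn 4 volume ≤ ENNReal.ofReal (1 * ‖zeroWave θ‖) := by
  have hm := memLp_fst (memLp_re_schwartz θ)
  have hfn : (zeroWave θ).fn = hm.toLp _ := schwartzWave_zero θ
  have h2 : MemLp (fun p : Cyl => (θ p.1).re ^ 2) 2 := by
    simpa only [pow_two] using hm.mul_of_bound hm.1 fun p => abs_re_le_zeroWave θ p.1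
  rw [hfn, eLpNorm_congr_ae hm.coeFn_toLp, one_mul]
  refine eLpNorm_four_le_of_sq (norm_nonneg _) h2 ?_
  rw [pow_two ‖zeroWave θ‖]
  refine (Lp.norm_le_mul_norm_of_ae_le_mul (g := (zeroWave θ).fn) ?_).trans
    (mul_le_mul_of_nonneg_left (EnergySpace.norm_fn_le _) (norm_nonneg _))
  rw [hfn]
  filter_upwards [h2.coeFn_toLp, hm.coeFn_toLp] with p e1 e2
  rw [e1, e2, norm_pow, pow_two, Real.norm_eq_abs]
  exact mul_le_mul_of_nonneg_right (abs_re_le_zeroWave θ p.1) (abs_nonneg _)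

/-- Fatou's lemma along an a.e. convergent subsequence: no L⁴ convergence is needed to pass the
bound to the limit. -/
theorem eLpNorm_four_le_of_tendsto {w : ℕ → EnergySpace} {v : EnergySpace}
    (h : Tendsto w atTop (𝓝 v)) {C : ℝ}
    (hw : ∀ k, eLpNorm (w k).fn 4 volume ≤ ENNReal.ofReal (C * ‖w k‖)) :
    eLpNorm v.fn 4 volume ≤ ENNReal.ofReal (C * ‖v‖) := by
  have h1 : Tendsto (fun k => (w k).fn) atTop (𝓝 v.fn) :=
    (EnergySpace.fnL.continuous.tendsto v).comp h
  obtain ⟨φ, hφ, hae⟩ := Lp.exists_subseq_tendsto_ae h1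
  refine (Lp.eLpNorm_lim_le_liminf_eLpNorm (fun k => Lp.aestronglyMeasurable (w (φ k)).fn) _
    hae).trans ?_
  have h2 : Tendsto (fun k => ENNReal.ofReal (C * ‖w (φ k)‖)) atTop
      (𝓝 (ENNReal.ofReal (C * ‖v‖))) :=
    ENNReal.tendsto_ofReal ((h.norm.comp hφ.tendsto_atTop).const_mul C)
  rw [← h2.liminf_eq]
  exact liminf_le_liminf (Eventually.of_forall fun k => hw (φ k))

/-- The embedding of the energy space in `L⁴`. -/
theorem exists_four_bound : ∃ C : ℝ, 0 ≤ C ∧ ∀ v : EnergySpace,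
    eLpNorm v.fn 4 volume ≤ ENNReal.ofReal (C * ‖v‖) := by
  obtain ⟨C, hC, h⟩ := exists_trigEnergy_four_bound
  refine ⟨1 + C, by positivity, fun v => ?_⟩
  obtain ⟨v₀, v₁, rfl, h0, h1, h2, h3⟩ := exists_split_energy v
  obtain ⟨θ, hθ⟩ := exists_zeroWave_tendsto h0
  obtain ⟨Θ, hΘ⟩ := exists_trigEnergy_tendsto h1
  have e0 := eLpNorm_four_le_of_tendsto hθ fun k => zeroWave_four_bound (θ k)
  have e1 := eLpNorm_four_le_of_tendsto hΘ fun k => h (Θ k)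
  rw [eLpNorm_congr_ae (show (v₀ + v₁).fn =ᵐ[volume] _ from Lp.coeFn_add v₀.fn v₁.fn)]
  refine (eLpNorm_add_le (Lp.aestronglyMeasurable _) (Lp.aestronglyMeasurable _)
    (by norm_num)).trans ((add_le_add e0 e1).trans ?_)
  rw [← ENNReal.ofReal_add (by positivity) (by positivity)]
  refine ENNReal.ofReal_le_ofReal ?_
  rw [add_mul]
  gcongr

instance fact_one_le_four : Fact ((1 : ℝ≥0∞) ≤ 4) := ⟨by norm_num⟩

theorem memLp_four (v : EnergySpace) : MemLp v.fn 4 volume := by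
  obtain ⟨C, -, h⟩ := exists_four_bound
  exact ⟨Lp.aestronglyMeasurable _, (h v).trans_lt ENNReal.ofReal_lt_top⟩

/-- The embedding of the energy space in `L⁴`. -/
def toLpFour : EnergySpace →L[ℝ] Lp ℝ 4 (volume : Measure Cyl) :=
  LinearMap.mkContinuousOfExistsBound
    { toFun := fun v => (memLp_four v).toLp v.fn
      map_add' := fun v w => by
        rw [← MemLp.toLp_add]
        exact MemLp.toLp_congr _ _ (Lp.coeFn_add v.fn w.fn)
      map_smul' := fun r v => by
        rw [RingHom.id_apply, ← MemLp.toLp_const_smul]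
        exact MemLp.toLp_congr _ _ (Lp.coeFn_smul r v.fn) }
    (by
      obtain ⟨C, hC, h⟩ := exists_four_bound
      refine ⟨C, fun v => ?_⟩
      change ‖(memLp_four v).toLp v.fn‖ ≤ _
      rw [Lp.norm_toLp]
      exact ENNReal.toReal_le_of_le_ofReal (by positivity) (h v))

theorem toLpFour_ae (v : EnergySpace) : toLpFour v =ᵐ[volume] v.fn := (memLp_four v).coeFn_toLp

instance holderTriple_four : ENNReal.HolderTriple 4 4 2 where
  inv_add_inv_eq_inv := by
    have := ENNReal.inv_two_add_inv_two
    rw [show (4 : ℝ≥0∞) = 2 * 2 by norm_num,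
      ENNReal.mul_inv (by simp) (by simp), ← mul_add, this, mul_one]

/-- The product of two functions in the energy space, as an element of `L²`. -/
def mulE : EnergySpace →L[ℝ] EnergySpace →L[ℝ] L2Cyl :=
  ((((ContinuousLinearMap.mul ℝ ℝ).holderL (volume : Measure Cyl) 4 4 2).comp toLpFour).flip.comp
    toLpFour).flip

theorem mulE_ae (v w : EnergySpace) : mulE v w =ᵐ[volume] fun p => v.fn p * w.fn p := by
  have h := (ContinuousLinearMap.mul ℝ ℝ).coeFn_holder (r := 2) (toLpFour v) (toLpFour w)
  filter_upwards [h, toLpFour_ae v, toLpFour_ae w] with p h1 h2 h3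
  rw [← h2, ← h3]
  exact h1

theorem exists_mulE_bound : ∃ C : ℝ, 0 ≤ C ∧ ∀ v w : EnergySpace, ‖mulE v w‖ ≤ C * ‖v‖ * ‖w‖ := by
  obtain ⟨C, hC, h⟩ := mulE.isBoundedBilinearMap.bound
  exact ⟨C, hC.le, h⟩

/-! ### Bounded continuous functions acting on `L²` -/

theorem memLp_mul_bcf (f : Cyl →ᵇ ℝ) (u : L2Cyl) : MemLp (fun p => f p * u p) 2 :=
  (Lp.memLp u).mul_of_bound f.continuous.aestronglyMeasurable fun p => f.norm_coe_le_norm p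

theorem norm_mul_bcf_le (f : Cyl →ᵇ ℝ) (u : L2Cyl) :
    ‖(memLp_mul_bcf f u).toLp _‖ ≤ ‖f‖ * ‖u‖ := by
  refine Lp.norm_le_mul_norm_of_ae_le_mul ?_
  filter_upwards [(memLp_mul_bcf f u).coeFn_toLp] with p h
  rw [h, norm_mul]
  exact mul_le_mul_of_nonneg_right (f.norm_coe_le_norm p) (norm_nonneg _)

/-- Multiplication of `L²` functions by bounded continuous functions. -/
def mulB : (Cyl →ᵇ ℝ) →L[ℝ] L2Cyl →L[ℝ] L2Cyl :=
  LinearMap.mkContinuous₂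
    (LinearMap.mk₂ ℝ (fun f u => (memLp_mul_bcf f u).toLp _)
      (fun f g u => by
        rw [← MemLp.toLp_add]
        exact MemLp.toLp_congr _ _ (Eventually.of_forall fun p => add_mul _ _ _))
      (fun r f u => by
        rw [← MemLp.toLp_const_smul]
        exact MemLp.toLp_congr _ _ (Eventually.of_forall fun p => mul_assoc _ _ _))
      (fun f u v => by
        rw [← MemLp.toLp_add]
        refine MemLp.toLp_congr _ _ ?_
        filter_upwards [Lp.coeFn_add u v] with p h
        rw [h, Pi.add_apply, mul_add]; rfl)
      (fun r f u => by
        rw [← MemLp.toLp_const_smul]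
        refine MemLp.toLp_congr _ _ ?_
        filter_upwards [Lp.coeFn_smul r u] with p h
        rw [h]; simp only [Pi.smul_apply, smul_eq_mul]; ring)) 1
    fun f u => by rw [one_mul]; exact norm_mul_bcf_le f u

theorem mulB_ae (f : Cyl →ᵇ ℝ) (u : L2Cyl) : mulB f u =ᵐ[volume] fun p => f p * u p :=
  (memLp_mul_bcf f u).coeFn_toLp

theorem norm_mulB_le (f : Cyl →ᵇ ℝ) (u : L2Cyl) : ‖mulB f u‖ ≤ ‖f‖ * ‖u‖ := norm_mul_bcf_le f u

theorem mulB_mulB (f g : Cyl →ᵇ ℝ) (u : L2Cyl) : mulB f (mulB g u) = mulB (f * g) u := by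
  refine Lp.ext ?_
  filter_upwards [mulB_ae f (mulB g u), mulB_ae g u, mulB_ae (f * g) u] with p h1 h2 h3
  rw [h1, h2, h3, BoundedContinuousFunction.mul_apply, mul_assoc]

theorem inner_mulB_comm (f : Cyl →ᵇ ℝ) (u v : L2Cyl) :
    inner ℝ (mulB f u) v = inner ℝ u (mulB f v) := by
  rw [L2.inner_def, L2.inner_def]
  refine integral_congr_ae ?_
  filter_upwards [mulB_ae f u, mulB_ae f v] with p h1 h2
  rw [h1, h2]; simp only [RCLike.inner_apply, conj_trivial]; ring

/-- `u ↦ (f ↦ ∫ f u)` is continuous along uniform convergence. -/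
theorem tendsto_integral_mul {α : Type*} {l : Filter α} {f : α → Cyl →ᵇ ℝ} {g : Cyl →ᵇ ℝ}
    (h : Tendsto f l (𝓝 g)) {A : Cyl → ℝ} (hA : Integrable A) :
    Tendsto (fun k => ∫ p, f k p * A p) l (𝓝 (∫ p, g p * A p)) := by
  have hi : ∀ f : Cyl →ᵇ ℝ, Integrable fun p => f p * A p := fun f =>
    hA.bdd_mul f.continuous.aestronglyMeasurable (Eventually.of_forall f.norm_coe_le_norm)
  rw [tendsto_iff_norm_sub_tendsto_zero] at h ⊢
  have h2 : Tendsto (fun k => ‖f k - g‖ * ∫ p, ‖A p‖) l (𝓝 0) := by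
    simpa using h.mul_const (∫ p, ‖A p‖)
  refine squeeze_zero (fun _ => norm_nonneg _) (fun k => ?_) h2
  rw [← integral_sub (hi _) (hi _), ← integral_const_mul]
  refine norm_integral_le_of_norm_le (hA.norm.const_mul _) (Eventually.of_forall fun p => ?_)
  rw [← sub_mul, norm_mul]
  exact mul_le_mul_of_nonneg_right ((f k - g).norm_coe_le_norm p) (norm_nonneg _)

/-- `e^{-f}` as a bounded continuous function. -/
def expNeg (f : Cyl →ᵇ ℝ) : Cyl →ᵇ ℝ :=
  BoundedContinuousFunction.ofNormedAddCommGroup (fun p => Real.exp (-f p)) (by fun_prop)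
    (Real.exp ‖f‖) fun p => by
      rw [Real.norm_eq_abs, Real.abs_exp]
      exact Real.exp_le_exp.2 ((neg_le_abs _).trans (f.norm_coe_le_norm p))

@[simp] theorem expNeg_apply (f : Cyl →ᵇ ℝ) (p : Cyl) : expNeg f p = Real.exp (-f p) := rfl

theorem norm_expNeg_le (f : Cyl →ᵇ ℝ) : ‖expNeg f‖ ≤ Real.exp ‖f‖ :=
  BoundedContinuousFunction.norm_ofNormedAddCommGroup_le _ (Real.exp_pos _).le _

theorem tendsto_expNeg {α : Type*} {l : Filter α} {f : α → Cyl →ᵇ ℝ} {g : Cyl →ᵇ ℝ}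
    (h : Tendsto f l (𝓝 g)) : Tendsto (fun k => expNeg (f k)) l (𝓝 (expNeg g)) := by
  rw [tendsto_iff_norm_sub_tendsto_zero] at h ⊢
  have h2 : Tendsto (fun k => Real.exp ‖g‖ * (2 * ‖f k - g‖)) l (𝓝 0) := by
    simpa using (h.const_mul 2).const_mul (Real.exp ‖g‖)
  refine squeeze_zero' (Eventually.of_forall fun _ => norm_nonneg _) ?_ h2
  filter_upwards [h.eventually (ge_mem_nhds (zero_lt_one' ℝ))] with k hk
  refine (BoundedContinuousFunction.norm_le (by positivity)).2 fun p => ?_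
  have hp : |f k p - g p| ≤ ‖f k - g‖ := (f k - g).norm_coe_le_norm p
  have e : Real.exp (-f k p) - Real.exp (-g p) =
      Real.exp (-g p) * (Real.exp (-(f k p - g p)) - 1) := by
    rw [mul_sub, ← Real.exp_add]; ring_nf
  change ‖Real.exp (-f k p) - Real.exp (-g p)‖ ≤ _
  rw [e, norm_mul, Real.norm_eq_abs, Real.norm_eq_abs, Real.abs_exp]
  refine mul_le_mul (Real.exp_le_exp.2 ((neg_le_abs _).trans (g.norm_coe_le_norm p))) ?_
    (abs_nonneg _) (Real.exp_pos _).le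
  have h3 := Real.abs_exp_sub_one_le (x := -(f k p - g p)) (by rw [abs_neg]; linarith)
  rw [abs_neg] at h3
  linarith

/-- A bounded continuous function of `x`, on the cylinder. -/
def fstB (f : ℝ →ᵇ ℝ) : Cyl →ᵇ ℝ := f.compContinuous ⟨Prod.fst, continuous_fst⟩

@[simp] theorem fstB_apply (f : ℝ →ᵇ ℝ) (p : Cyl) : fstB f p = f p.1 := rfl

theorem norm_fstB_le (f : ℝ →ᵇ ℝ) : ‖fstB f‖ ≤ ‖f‖ :=
  (BoundedContinuousFunction.norm_le (norm_nonneg _)).2 fun p => f.norm_coe_le_norm p.1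

/-! ### Strips -/

theorem volume_strip (a b : ℝ) : (volume : Measure Cyl) (Set.Icc a b ×ˢ Set.univ) =
    ENNReal.ofReal (b - a) * ENNReal.ofReal (2 * Real.pi) := by
  change ((volume : Measure ℝ).prod (volume : Measure Torus)) _ = _
  rw [Measure.prod_prod, Real.volume_Icc, AddCircle.measure_univ]

/-- The indicator function of `[a, b] × 𝕋`. -/
def strip (a b : ℝ) : L2Cyl :=
  indicatorConstLp 2 (measurableSet_Icc.prod MeasurableSet.univ : MeasurableSet (Set.Icc a b ×ˢ Set.univ))
    (by rw [volume_strip]; exact ENNReal.mul_ne_top ENNReal.ofReal_ne_top ENNReal.ofReal_ne_top)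
    (1 : ℝ)

theorem inner_strip (a b : ℝ) (u : L2Cyl) :
    inner ℝ (strip a b) u = ∫ p in Set.Icc a b ×ˢ Set.univ, u p :=
  L2.inner_indicatorConstLp_one _ _ u

theorem norm_strip (a b : ℝ) (h : a ≤ b) : ‖strip a b‖ ^ 2 = 2 * Real.pi * (b - a) := by
  rw [← real_inner_self_eq_norm_sq, inner_strip, strip]
  have h1 : ∫ p in Set.Icc a b ×ˢ (Set.univ : Set Torus), (strip a b) p =
      ∫ p in Set.Icc a b ×ˢ (Set.univ : Set Torus), (1 : ℝ) := by
    refine setIntegral_congr_ae (measurableSet_Icc.prod MeasurableSet.univ) ?_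
    filter_upwards [indicatorConstLp_coeFn (p := 2) (c := (1 : ℝ))
      (hs := (measurableSet_Icc.prod MeasurableSet.univ :
        MeasurableSet (Set.Icc a b ×ˢ (Set.univ : Set Torus))))
      (hμs := by
        rw [volume_strip]; exact ENNReal.mul_ne_top ENNReal.ofReal_ne_top ENNReal.ofReal_ne_top)]
      with p hp hs
    rw [strip, hp, Set.indicator_of_mem hs]
  refine h1.trans ?_
  rw [setIntegral_const, Measure.real, volume_strip, ENNReal.toReal_mul,
    ENNReal.toReal_ofReal (sub_nonneg.2 h), ENNReal.toReal_ofReal Real.two_pi_pos.le]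
  simp; ring

theorem integral_strip_fst (a b : ℝ) (h : a ≤ b) (g : ℝ → ℝ) :
    ∫ p in Set.Icc a b ×ˢ (Set.univ : Set Torus), g p.1 = 2 * Real.pi * ∫ x in a..b, g x := by
  rw [intervalIntegral.integral_of_le h, ← integral_Icc_eq_integral_Ioc,
    ← integral_indicator measurableSet_Icc, ← integral_fst,
    ← integral_indicator (measurableSet_Icc.prod MeasurableSet.univ)]
  refine integral_congr_ae (Eventually.of_forall fun p => ?_)
  simp only [Set.indicator, Set.mem_prod, Set.mem_univ, and_true]
  congr

/-! ### Continuous representatives of zero modes -/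

/-- The real part of a Schwartz function, as a bounded continuous function. -/
def reB (θ : 𝓢(ℝ, ℂ)) : ℝ →ᵇ ℝ :=
  BoundedContinuousFunction.ofNormedAddCommGroup (fun x => (θ x).re)
    (Complex.continuous_re.comp θ.continuous) ‖zeroWave θ‖ (abs_re_le_zeroWave θ)

theorem cauchySeq_of_norm_sub_le {E F : Type*} [NormedAddCommGroup E] [NormedAddCommGroup F]
    {u : ℕ → E} {w : ℕ → F} {K : ℝ} (hw : CauchySeq w)
    (h : ∀ j k, ‖u j - u k‖ ≤ K * ‖w j - w k‖) : CauchySeq u := by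
  rw [cauchySeq_iff_tendsto_dist_atTop_0] at hw ⊢
  have h2 : Tendsto (fun n : ℕ × ℕ => K * dist (w n.1) (w n.2)) atTop (𝓝 0) := by
    simpa using hw.const_mul K
  refine squeeze_zero (fun _ => dist_nonneg) (fun n => ?_) h2
  rw [dist_eq_norm, dist_eq_norm]
  exact h _ _

/-- Schwartz approximations converge uniformly by the one-dimensional Sobolev bound. The last clause
is the fundamental theorem of calculus in a form that survives L² convergence of the derivative; 2π
is the length of the circle. -/
theorem exists_zeroMode_rep {v : EnergySpace} (hv : IsZeroMode v.fn) :
    ∃ z : ℝ →ᵇ ℝ, v.fn =ᵐ[volume] (fun p => z p.1) ∧ ‖z‖ ≤ ‖v‖ ∧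
      ∀ a b, a ≤ b → inner ℝ (strip a b) v.dx = 2 * Real.pi * (z b - z a) := by
  obtain ⟨θ, hθ⟩ := exists_zeroWave_tendsto hv
  have hc : CauchySeq fun k => reB (θ k) := by
    refine cauchySeq_of_norm_sub_le (K := 1) hθ.cauchySeq fun j k => ?_
    rw [one_mul]
    refine (BoundedContinuousFunction.norm_le (norm_nonneg _)).2 fun x => ?_
    have := abs_re_le_zeroWave (θ j - θ k) x
    rw [show zeroWave (θ j - θ k) = zeroWave (θ j) - zeroWave (θ k) from map_sub zeroWaveₗ _ _,
      sub_apply, Complex.sub_re] at this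
    exact this
  obtain ⟨z, hz⟩ := cauchySeq_tendsto_of_complete hc
  have hzx : ∀ x, Tendsto (fun k => (θ k x).re) atTop (𝓝 (z x)) := fun x =>
    (BoundedContinuousFunction.tendsto_iff_tendstoUniformly.1 hz).tendsto_at x
  refine ⟨z, ?_, ?_, fun a b hab => ?_⟩
  · have h1 : Tendsto (fun k => (zeroWave (θ k)).fn) atTop (𝓝 v.fn) :=
      (EnergySpace.fnL.continuous.tendsto v).comp hθ
    obtain ⟨φ, hφ, hae⟩ := Lp.exists_subseq_tendsto_ae h1
    have h2 : ∀ᵐ p : Cyl, ∀ k, (zeroWave (θ k)).fn p = (θ k p.1).re := by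
      rw [ae_all_iff]; intro k
      filter_upwards [schwartzWave_coeFn 0 (θ k)] with p hp
      refine hp.trans ?_
      simp [wave]
    filter_upwards [hae, h2] with p h3 h4
    refine tendsto_nhds_unique h3 ?_
    simp only [h4]
    exact (hzx p.1).comp hφ.tendsto_atTop
  · refine le_of_tendsto_of_tendsto hz.norm hθ.norm (Eventually.of_forall fun k => ?_)
    exact (BoundedContinuousFunction.norm_le (norm_nonneg _)).2 (abs_re_le_zeroWave (θ k))
  · have h1 : Tendsto (fun k => inner ℝ (strip a b) (zeroWave (θ k)).dx) atTop
        (𝓝 (inner ℝ (strip a b) v.dx)) :=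
      tendsto_const_nhds.inner ((EnergySpace.dxL.continuous.tendsto v).comp hθ)
    refine tendsto_nhds_unique h1 ?_
    have h2 : ∀ k, inner ℝ (strip a b) (zeroWave (θ k)).dx =
        2 * Real.pi * ((θ k b).re - (θ k a).re) := fun k => by
      rw [inner_strip, ← intervalIntegral.integral_eq_sub_of_hasDerivAt
        (fun x _ => hasDerivAt_re_schwartz (θ k) x)
        ((Complex.continuous_re.comp (sderiv (θ k)).continuous).intervalIntegrable _ _),
        ← integral_strip_fst a b hab]
      refine setIntegral_congr_ae (measurableSet_Icc.prod MeasurableSet.univ) ?_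
      filter_upwards [schwartzWave_coeFn 0 (sderiv (θ k))] with p hp _
      refine hp.trans ?_
      simp [wave]
    simp only [h2]
    exact ((hzx b).sub (hzx a)).const_mul _

/-! ### Potentials of functions without zero mode -/

/-- A trigonometric potential as a bounded continuous function. -/
def trigPotentialB (Θ : ℕ →₀ 𝓢(ℝ, ℂ)) : Cyl →ᵇ ℝ :=
  BoundedContinuousFunction.ofNormedAddCommGroup (trigPotential Θ)
    (continuous_trigSum (fun _ θ => θ) Θ)
    (bound_trigSum (fun _ θ => θ) Θ).choose (bound_trigSum (fun _ θ => θ) Θ).choose_spec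

/-- The sup bound turns energy convergence into uniform convergence of the potentials. The
approximating sequence is kept in the conclusion because later integrations by parts with e^{-V} are
carried out on it and then passed to the limit. -/
theorem exists_potential_rep : ∃ K : ℝ, 0 < K ∧ ∀ v : EnergySpace, mode 0 v.fn = 0 →
    ∃ (Θ : ℕ → ℕ →₀ 𝓢(ℝ, ℂ)) (V : Cyl →ᵇ ℝ), Tendsto (fun k => trigEnergy (Θ k)) atTop (𝓝 v) ∧
      Tendsto (fun k => trigPotentialB (Θ k)) atTop (𝓝 V) ∧ ‖V‖ ≤ K * ‖v‖ := by
  obtain ⟨K, hK, hsup⟩ := exists_sup_bound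
  refine ⟨K, hK, fun v hv => ?_⟩
  obtain ⟨Θ, hΘ⟩ := exists_trigEnergy_tendsto hv
  have hle : ∀ Θ, ‖trigPotentialB Θ‖ ≤ K * ‖trigEnergy Θ‖ := fun Θ =>
    (BoundedContinuousFunction.norm_le (by positivity)).2 fun p => hsup Θ p
  have hc : CauchySeq fun k => trigPotentialB (Θ k) := by
    refine cauchySeq_of_norm_sub_le (K := K) hΘ.cauchySeq fun j k => ?_
    rw [← trigEnergy_sub]
    refine (BoundedContinuousFunction.norm_le (by positivity)).2 fun p => ?_
    have := hsup (Θ j - Θ k) p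
    rw [trigPotential_sub] at this
    exact this
  obtain ⟨V, hV⟩ := cauchySeq_tendsto_of_complete hc
  exact ⟨Θ, V, hΘ, hV, le_of_tendsto_of_tendsto hV.norm (hΘ.norm.const_mul K)
    (Eventually.of_forall fun k => hle _)⟩

/-! ### Products of functions with an `x`-derivative -/

/-- The weak criterion reduces this to integrating the x-derivative of ψ times a Schwartz wave. -/
theorem isMultiplier_symDx_of_hasDerivAt {ψ ψ' : Cyl → ℝ}
    (h : ∀ x y, HasDerivAt (fun x => ψ (x, y)) (ψ' (x, y)) x) (hψ : MemLp ψ 2)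
    (hψ' : MemLp ψ' 2) : IsMultiplier symDx (hψ.toLp ψ) (hψ'.toLp ψ') := by
  refine isMultiplier_symDx_of_weak fun n θ => ?_
  have hm : ∀ θ : 𝓢(ℝ, ℂ), MemLp (wave n θ) 2 := fun θ => memLp_wave n (θ.memLp 2)
  have e : ∀ {f : Cyl → ℝ} (hf : MemLp f 2) (θ : 𝓢(ℝ, ℂ)),
      inner ℝ (hf.toLp f) (schwartzWave n θ) = ∫ p, f p * wave n θ p := fun {f} hf θ => by
    rw [← inner_toLp hf (hm θ)]
    congr 1
    exact Lp.ext ((schwartzWave_coeFn n θ).trans (hm θ).coeFn_toLp.symm)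
  have i1 : Integrable fun p => ψ p * wave n (sderiv θ) p := hψ.integrable_mul (hm (sderiv θ))
  have i2 : Integrable fun p => ψ' p * wave n θ p := hψ'.integrable_mul (hm θ)
  rw [e hψ, e hψ', eq_neg_iff_add_eq_zero]
  have h0 := integral_eq_zero_of_hasDerivAt_fst (G := fun p => ψ p * wave n θ p)
    (G' := fun p => ψ p * wave n (sderiv θ) p + ψ' p * wave n θ p)
    (fun x y => by
      have := (h x y).mul (hasDerivAt_wave_fst n (hasDerivAt_schwartz θ x) y)
      refine this.congr_deriv ?_
      rw [add_comm]; rfl) (hψ.integrable_mul (hm θ)) (i1.add i2)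
  rwa [integral_add i1 i2] at h0

/-- The product rule for a smooth bounded factor. -/
theorem IsMultiplier.mulB {f g : L2Cyl} (h : IsMultiplier symDx f g) {q q' : Cyl →ᵇ ℝ}
    (hq : ∀ x y, HasDerivAt (fun x => q (x, y)) (q' (x, y)) x) :
    IsMultiplier symDx (mulB q f) (mulB q g + mulB q' f) := by
  refine isMultiplier_symDx_of_weak fun n θ => ?_
  have hm : ∀ θ : 𝓢(ℝ, ℂ), MemLp (wave n θ) 2 := fun θ => memLp_wave n (θ.memLp 2)
  have e : ∀ (q : Cyl →ᵇ ℝ) (θ : 𝓢(ℝ, ℂ)), KPMiura.mulB q (schwartzWave n θ) =ᵐ[volume]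
      fun p => q p * wave n θ p := fun q θ => by
    filter_upwards [mulB_ae q (schwartzWave n θ), schwartzWave_coeFn n θ] with p h1 h2
    rw [h1, h2]
  have m : ∀ (q : Cyl →ᵇ ℝ) (θ : 𝓢(ℝ, ℂ)), MemLp (fun p => q p * wave n θ p) 2 := fun q θ =>
    (hm θ).mul_of_bound q.continuous.aestronglyMeasurable q.norm_coe_le_norm
  have hψ' : MemLp (fun p => q p * wave n (sderiv θ) p + q' p * wave n θ p) 2 :=
    (m _ _).add (m _ _)
  have h1 := isMultiplier_symDx_of_hasDerivAt (ψ := fun p => q p * wave n θ p) (fun x y => by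
      have := (hq x y).mul (hasDerivAt_wave_fst n (hasDerivAt_schwartz θ x) y)
      refine this.congr_deriv ?_
      rw [add_comm]; rfl) (m q θ) hψ'
  have e1 : (m q θ).toLp _ = KPMiura.mulB q (schwartzWave n θ) :=
    Lp.ext ((m q θ).coeFn_toLp.trans (e q θ).symm)
  have e2 : hψ'.toLp _ = KPMiura.mulB q (schwartzWave n (sderiv θ)) +
      KPMiura.mulB q' (schwartzWave n θ) := by
    refine Lp.ext ?_
    filter_upwards [hψ'.coeFn_toLp, e q (sderiv θ), e q' θ, Lp.coeFn_add
      (KPMiura.mulB q (schwartzWave n (sderiv θ))) (KPMiura.mulB q' (schwartzWave n θ))]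
      with p h1 h2 h3 h4
    rw [h1, h4, Pi.add_apply, h2, h3]
  rw [e1, e2] at h1
  have h2 := inner_eq_neg_of_symDx h h1
  rw [inner_add_right] at h2
  rw [inner_mulB_comm, inner_add_left, inner_mulB_comm, inner_mulB_comm]
  linarith

/-- `2 ⟨∂_x f, q f⟩ = -⟨f, q' f⟩`. -/
theorem two_mul_inner_mulB {f g : L2Cyl} (h : IsMultiplier symDx f g) {q q' : Cyl →ᵇ ℝ}
    (hq : ∀ x y, HasDerivAt (fun x => q (x, y)) (q' (x, y)) x) :
    2 * inner ℝ g (mulB q f) = -inner ℝ f (mulB q' f) := by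
  have h1 := inner_eq_neg_of_symDx h (h.mulB hq)
  rw [inner_add_right, ← inner_mulB_comm q, real_inner_comm] at h1
  rw [← inner_mulB_comm, real_inner_comm]
  linarith

/-! ### Modes of products with functions of `x` -/

theorem mode_mulB_fstB (n : ℤ) (q : ℝ →ᵇ ℝ) (u : L2Cyl) :
    (mode n (mulB (fstB q) u) : ℝ → ℂ) =ᵐ[volume] fun x => q x * mode n u x := by
  have h0 : ∀ᵐ p ∂((volume : Measure ℝ).prod (volume : Measure Torus)),
      mulB (fstB q) u p = q p.1 * u p := mulB_ae (fstB q) u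
  filter_upwards [mode_coeFn (mulB (fstB q) u) n, mode_coeFn u n, Measure.ae_ae_of_ae_prod h0]
    with x h1 h2 h3
  rw [h1, h2, modeFun, modeFun, mul_left_comm]
  congr 1
  rw [← integral_const_mul]
  refine integral_congr_ae ?_
  filter_upwards [h3] with y hy
  rw [hy]; push_cast; ring

theorem mode_mulB_eq_zero {n : ℤ} (q : ℝ →ᵇ ℝ) {u : L2Cyl} (h : mode n u = 0) :
    mode n (mulB (fstB q) u) = 0 := by
  refine Lp.ext ?_
  filter_upwards [mode_mulB_fstB n q u, Lp.coeFn_zero ℂ 2 (volume : Measure ℝ)] with x h1 h2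
  rw [h1, h, h2]; simp

theorem IsZeroMode.mulB {u : L2Cyl} (h : IsZeroMode u) (q : ℝ →ᵇ ℝ) :
    IsZeroMode (mulB (fstB q) u) := fun n hn => mode_mulB_eq_zero q (h n hn)

theorem IsMultiplier.mulB_symDy {u a : L2Cyl} (h : IsMultiplier symDy u a) (q : ℝ →ᵇ ℝ) :
    IsMultiplier symDy (KPMiura.mulB (fstB q) u) (KPMiura.mulB (fstB q) a) := by
  refine isMultiplier_symDy_of_mode fun n => Lp.ext ?_
  have h1 := h.mode_symDy n
  filter_upwards [mode_mulB_fstB n q u, mode_mulB_fstB n q a,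
    Lp.coeFn_smul (Complex.I * n : ℂ) (mode n u),
    Lp.coeFn_smul (Complex.I * n : ℂ) (mode n (KPMiura.mulB (fstB q) u))] with x e1 e2 e3 e4
  rw [e2, e4, Pi.smul_apply, e1, h1, e3]
  simp only [Pi.smul_apply, smul_eq_mul]; ring

theorem isZeroMode_fst {g : ℝ → ℝ} (hg : MemLp g 2) : IsZeroMode ((memLp_fst hg).toLp _) := by
  intro n hn
  refine Lp.ext ?_
  have h0 : ∀ᵐ p ∂((volume : Measure ℝ).prod (volume : Measure Torus)),
      (memLp_fst hg).toLp _ p = g p.1 := (memLp_fst hg).coeFn_toLp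
  filter_upwards [mode_coeFn ((memLp_fst hg).toLp _) n, Lp.coeFn_zero ℂ 2 (volume : Measure ℝ),
    Measure.ae_ae_of_ae_prod h0] with x h1 h2 h3
  rw [h1, h2, modeFun]
  have : ∫ y : Torus, _root_.fourier (-n) y * (((memLp_fst hg).toLp _ (x, y) : ℝ) : ℂ) =
      ∫ y : Torus, _root_.fourier (-n) y * (g x : ℂ) := by
    refine integral_congr_ae ?_
    filter_upwards [h3] with y hy
    rw [hy]
  rw [this, integral_mul_const, integral_torus_fourier]
  simp [hn]

theorem inner_eq_zero_of_modes {u v : L2Cyl} (hu : IsZeroMode u) (hv : mode 0 v = 0) :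
    inner ℝ u v = 0 := by
  refine (hasSum_re_inner_mode u v).unique ?_
  convert! hasSum_zero (α := ℝ) (β := ℤ) with n
  by_cases hn : n = 0
  · rw [hn, hv]; simp
  · rw [hu n hn]; simp

/-! ### Hyperbolic profiles -/

theorem hasDerivAt_tanh (x : ℝ) : HasDerivAt Real.tanh (1 / Real.cosh x ^ 2) x := by
  have h := (Real.hasDerivAt_sinh x).div (Real.hasDerivAt_cosh x) (Real.cosh_pos x).ne'
  have e : Real.tanh = fun x => Real.sinh x / Real.cosh x := funext Real.tanh_eq_sinh_div_cosh
  rw [e]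
  refine h.congr_deriv ?_
  rw [← pow_two, ← pow_two, Real.cosh_sq]
  congr 1; ring

theorem continuous_tanh : Continuous Real.tanh :=
  continuous_iff_continuousAt.2 fun x => (hasDerivAt_tanh x).continuousAt

theorem tanh_sq_add (x : ℝ) : Real.tanh x ^ 2 + 1 / Real.cosh x ^ 2 = 1 := by
  have h := (Real.cosh_pos x).ne'
  rw [Real.tanh_eq_sinh_div_cosh, div_pow, ← add_div, div_eq_one_iff_eq (pow_ne_zero 2 h),
    Real.cosh_sq]

theorem abs_tanh_le (x : ℝ) : |Real.tanh x| ≤ 1 := by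
  rw [← sq_le_one_iff_abs_le_one]
  have := tanh_sq_add x
  have h : 0 ≤ 1 / Real.cosh x ^ 2 := by positivity
  linarith

/-- The kink of amplitude `a`. -/
def kinkA (a x : ℝ) : ℝ := a * Real.tanh (a * x)
/-- The derivative of the kink of amplitude `a`. -/
def sechA (a x : ℝ) : ℝ := a ^ 2 * (1 / Real.cosh (a * x) ^ 2)

/-- The Riccati equation Q' = a² - Q² of the kink. The cancellations between Q and its derivative S
below rest on it, together with S' = -2QS. -/
theorem kinkA_sq_add (a x : ℝ) : kinkA a x ^ 2 + sechA a x = a ^ 2 := by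
  rw [kinkA, sechA, mul_pow, ← mul_add, tanh_sq_add, mul_one]

theorem sechA_nonneg (a x : ℝ) : 0 ≤ sechA a x := by unfold sechA; positivity

theorem hasDerivAt_kinkA (a x : ℝ) : HasDerivAt (kinkA a) (sechA a x) x := by
  have h := ((hasDerivAt_tanh (a * x)).comp x ((hasDerivAt_id x).const_mul a)).const_mul a
  refine h.congr_deriv ?_
  rw [sechA]; ring

theorem hasDerivAt_sechA (a x : ℝ) : HasDerivAt (sechA a) (-2 * kinkA a x * sechA a x) x := by
  have e : sechA a = fun x => a ^ 2 - kinkA a x ^ 2 := funext fun x => by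
    rw [← kinkA_sq_add a x]; ring
  rw [e]
  refine (((hasDerivAt_kinkA a x).pow 2).const_sub _).congr_deriv ?_
  simp only [← kinkA_sq_add a x]; push_cast; ring

theorem continuous_kinkA (a : ℝ) : Continuous (kinkA a) :=
  continuous_iff_continuousAt.2 fun x => (hasDerivAt_kinkA a x).continuousAt

theorem continuous_sechA (a : ℝ) : Continuous (sechA a) :=
  continuous_iff_continuousAt.2 fun x => (hasDerivAt_sechA a x).continuousAt

theorem abs_kinkA_le (a x : ℝ) : |kinkA a x| ≤ |a| := by
  rw [kinkA, abs_mul]; exact mul_le_of_le_one_right (abs_nonneg _) (abs_tanh_le _)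

theorem abs_sechA_le (a x : ℝ) : |sechA a x| ≤ a ^ 2 := by
  rw [abs_of_nonneg (sechA_nonneg a x), ← kinkA_sq_add a x]
  nlinarith [sq_nonneg (kinkA a x)]

/-- The kink as a bounded continuous function. -/
def kinkB (a : ℝ) : ℝ →ᵇ ℝ :=
  BoundedContinuousFunction.ofNormedAddCommGroup (kinkA a) (continuous_kinkA a) |a| (abs_kinkA_le a)
/-- The derivative of the kink as a bounded continuous function. -/
def sechB (a : ℝ) : ℝ →ᵇ ℝ :=
  BoundedContinuousFunction.ofNormedAddCommGroup (sechA a) (continuous_sechA a) (a ^ 2)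
    (abs_sechA_le a)

theorem norm_fstB_kinkB_le (a : ℝ) : ‖fstB (kinkB a)‖ ≤ |a| :=
  (norm_fstB_le _).trans
    (BoundedContinuousFunction.norm_ofNormedAddCommGroup_le _ (abs_nonneg a) _)

theorem exp_abs_le_cosh (y : ℝ) : Real.exp |y| ≤ 2 * Real.cosh y := by
  rw [← Real.cosh_abs, Real.cosh_eq]
  have := Real.exp_pos (-|y|)
  linarith

/-- Polynomial decay of `cosh⁻²(a x)`, uniformly in `a ≥ a₁`. -/
theorem exists_decay {a₁ : ℝ} (h : 0 < a₁) : ∃ B : ℝ, 0 < B ∧ ∀ a, a₁ ≤ a → ∀ x,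
    (1 + |x|) ^ 4 * (1 / Real.cosh (a * x) ^ 2) ≤ B := by
  refine ⟨4 * (24 * Real.exp (2 * a₁) / (2 * a₁) ^ 4), by positivity, fun a ha x => ?_⟩
  have h1 : (2 * a₁ * (1 + |x|)) ^ 4 / 24 ≤ Real.exp (2 * a₁ * (1 + |x|)) :=
    Real.pow_div_factorial_le_exp _ (by positivity) 4
  have h2 : Real.exp (2 * a₁ * (1 + |x|)) = Real.exp (2 * a₁) * Real.exp (2 * (a₁ * |x|)) := by
    rw [← Real.exp_add]; ring_nf
  have h3 : Real.exp (2 * (a₁ * |x|)) ≤ 4 * Real.cosh (a * x) ^ 2 := by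
    have h4 : Real.exp (a₁ * |x|) ≤ 2 * Real.cosh (a * x) := by
      refine le_trans (Real.exp_le_exp.2 ?_) (exp_abs_le_cosh _)
      rw [abs_mul, abs_of_pos (h.trans_le ha)]
      exact mul_le_mul_of_nonneg_right ha (abs_nonneg _)
    calc Real.exp (2 * (a₁ * |x|)) = Real.exp (a₁ * |x|) ^ 2 := by rw [← Real.exp_nat_mul]; norm_num
      _ ≤ (2 * Real.cosh (a * x)) ^ 2 := by gcongr
      _ = _ := by ring
  have hc : 0 < Real.cosh (a * x) ^ 2 := by have := Real.cosh_pos (a * x); positivity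
  rw [mul_one_div, div_le_iff₀ hc]
  rw [h2, mul_pow] at h1
  have h5 : (1 + |x|) ^ 4 ≤ 24 * Real.exp (2 * a₁) / (2 * a₁) ^ 4 * Real.exp (2 * (a₁ * |x|)) := by
    rw [div_mul_eq_mul_div, le_div_iff₀ (by positivity)]
    linarith
  refine h5.trans ?_
  rw [show 4 * (24 * Real.exp (2 * a₁) / (2 * a₁) ^ 4) * Real.cosh (a * x) ^ 2 =
    24 * Real.exp (2 * a₁) / (2 * a₁) ^ 4 * (4 * Real.cosh (a * x) ^ 2) by ring]
  gcongr

/-- The weight `(1 + x²)⁻¹`. -/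
def weight (x : ℝ) : ℝ := (1 + x ^ 2)⁻¹

theorem weight_pos (x : ℝ) : 0 < weight x := by unfold weight; positivity

theorem weight_le_one (x : ℝ) : weight x ≤ 1 := inv_le_one_of_one_le₀ (by nlinarith [sq_nonneg x])

theorem continuous_weight : Continuous weight :=
  Continuous.inv₀ (by fun_prop) fun x => by positivity

theorem integrable_weight : Integrable weight := integrable_inv_one_add_sq

theorem memLp_weight : MemLp weight 2 := by
  rw [memLp_two_iff_integrable_sq continuous_weight.aestronglyMeasurable]
  refine integrable_weight.mono' (continuous_weight.pow 2).aestronglyMeasurable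
    (Eventually.of_forall fun x => ?_)
  rw [Real.norm_of_nonneg (by positivity), pow_two]
  exact mul_le_of_le_one_right (weight_pos x).le (weight_le_one x)

theorem exists_sechA_le_weight {a : ℝ} (h : 0 < a) : ∃ C : ℝ, 0 ≤ C ∧ ∀ x,
    sechA a x ≤ C * weight x := by
  obtain ⟨B, hB, hd⟩ := exists_decay h
  refine ⟨a ^ 2 * B, by positivity, fun x => ?_⟩
  rw [sechA, mul_assoc]
  refine mul_le_mul_of_nonneg_left ?_ (by positivity)
  rw [weight, ← div_eq_mul_inv, le_div_iff₀ (by positivity), mul_comm]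
  refine le_trans (mul_le_mul_of_nonneg_right ?_ (by positivity)) (hd a le_rfl x)
  have h1 : x ^ 2 = |x| ^ 2 := (sq_abs x).symm
  nlinarith [abs_nonneg x, pow_nonneg (abs_nonneg x) 3, pow_nonneg (abs_nonneg x) 4]

theorem memLp_sechA {a : ℝ} (h : 0 < a) : MemLp (sechA a) 2 := by
  obtain ⟨C, hC, h⟩ := exists_sechA_le_weight h
  refine (memLp_weight.const_mul C).mono (continuous_sechA a).aestronglyMeasurable
    (Eventually.of_forall fun x => ?_)
  rw [Real.norm_of_nonneg (sechA_nonneg a x)]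
  exact (h x).trans (le_abs_self _)

/-! ### The linearized Miura transform -/

/-- Multiplication by the kink. -/
def mulKink (a : ℝ) : L2Cyl →L[ℝ] L2Cyl := mulB (fstB (kinkB a))

theorem norm_mulKink_le {a : ℝ} (ha : 0 < a) (u : L2Cyl) : ‖mulKink a u‖ ≤ a * ‖u‖ :=
  (norm_mulB_le _ _).trans (mul_le_mul_of_nonneg_right
    ((norm_fstB_kinkB_le a).trans_eq (abs_of_pos ha)) (norm_nonneg _))

/-- `v ↦ ∂_x v + ∂_x⁻¹ ∂_y v - 2 Q v`. -/
def linOp (a : ℝ) : EnergySpace →L[ℝ] L2Cyl :=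
  EnergySpace.dxL + EnergySpace.dxInvDyL - (2 : ℝ) • (mulKink a).comp EnergySpace.fnL

theorem linOp_apply (a : ℝ) (v : EnergySpace) :
    linOp a v = v.dx + v.dxInvDy - (2 : ℝ) • mulKink a v.fn := rfl

/-- `w ↦ -∂_x w + ∂_x⁻¹ ∂_y w - 2 Q w`. -/
def adjOp (a : ℝ) : EnergySpace →L[ℝ] L2Cyl :=
  EnergySpace.dxInvDyL - EnergySpace.dxL - (2 : ℝ) • (mulKink a).comp EnergySpace.fnL

theorem adjOp_apply (a : ℝ) (v : EnergySpace) :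
    adjOp a v = v.dxInvDy - v.dx - (2 : ℝ) • mulKink a v.fn := rfl

theorem hasDerivAt_fstB_kinkB (a x : ℝ) (y : Torus) :
    HasDerivAt (fun x => fstB (kinkB a) (x, y)) (fstB (sechB a) (x, y)) x := hasDerivAt_kinkA a x

theorem inner_mulKink (a : ℝ) (u v : L2Cyl) :
    inner ℝ (mulKink a u) v = inner ℝ u (mulKink a v) := inner_mulB_comm _ _ _

theorem inner_mulB_nonneg {q : Cyl →ᵇ ℝ} (h : ∀ p, 0 ≤ q p) (u : L2Cyl) :
    0 ≤ inner ℝ u (mulB q u) := by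
  rw [L2.inner_def]
  refine integral_nonneg_of_ae ?_
  filter_upwards [mulB_ae q u] with p hp
  rw [hp]
  simp only [RCLike.inner_apply, conj_trivial, Pi.zero_apply, mul_assoc]
  exact mul_nonneg (h p) (mul_self_nonneg _)

theorem eq_zero_of_inner_mulB {q : Cyl →ᵇ ℝ} (h : ∀ p, 0 < q p) {u : L2Cyl}
    (hu : inner ℝ u (mulB q u) = 0) : u = 0 := by
  have hi : Integrable fun p => u p * (mulB q u) p :=
    (Lp.memLp u).integrable_mul (Lp.memLp (mulB q u))
  rw [L2.inner_def] at hu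
  have e : ∫ p, u p * (mulB q u) p = 0 := by
    rw [← hu]; exact integral_congr_ae (Eventually.of_forall fun p => mul_comm _ _)
  have h0 : 0 ≤ᵐ[volume] fun p => u p * (mulB q u) p := by
    filter_upwards [mulB_ae q u] with p hp
    rw [hp, mul_left_comm]
    exact mul_nonneg (h p).le (mul_self_nonneg _)
  have h1 := (integral_eq_zero_iff_of_nonneg_ae h0 hi).1 e
  rw [Lp.eq_zero_iff_ae_eq_zero]
  filter_upwards [h1, mulB_ae q u] with p e1 e2
  rw [e2, mul_left_comm] at e1
  exact mul_self_eq_zero.1 ((mul_eq_zero.1 e1).resolve_left (h p).ne')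

theorem norm_sq_mulKink_add (a : ℝ) (u : L2Cyl) :
    ‖mulKink a u‖ ^ 2 + inner ℝ u (mulB (fstB (sechB a)) u) = a ^ 2 * ‖u‖ ^ 2 := by
  rw [← real_inner_self_eq_norm_sq, ← real_inner_self_eq_norm_sq, inner_mulKink, ← inner_add_right,
    ← inner_smul_right]
  congr 1
  refine Lp.ext ?_
  filter_upwards [mulB_ae (fstB (kinkB a)) (mulKink a u), mulB_ae (fstB (kinkB a)) u,
    mulB_ae (fstB (sechB a)) u, Lp.coeFn_smul (a ^ 2) u,
    Lp.coeFn_add (mulKink a (mulKink a u)) (mulB (fstB (sechB a)) u)] with p h1 h2 h3 h4 h5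
  rw [h5, h4, Pi.add_apply, Pi.smul_apply, smul_eq_mul, ← kinkA_sq_add a p.1]
  change mulB (fstB (kinkB a)) (mulKink a u) p + _ = _
  change mulKink a u p = _ at h2
  rw [h1, h2, h3]
  change kinkA a p.1 * (kinkA a p.1 * u p) + sechA a p.1 * u p = _
  ring

/-- Coercivity of the linearization on zero modes. -/
theorem norm_linOp_zero {a : ℝ} {z : EnergySpace} (hz : z.dxInvDy = 0) :
    ‖z.dx‖ ^ 2 + 2 * a ^ 2 * ‖z.fn‖ ^ 2 ≤ ‖linOp a z‖ ^ 2 := by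
  have e : 2 * inner ℝ z.dx (mulKink a z.fn) = -inner ℝ z.fn (mulB (fstB (sechB a)) z.fn) :=
    two_mul_inner_mulB z.isMultiplier_dx (hasDerivAt_fstB_kinkB a)
  rw [linOp_apply, hz, add_zero, @norm_sub_sq ℝ, inner_smul_right, norm_smul, mul_pow,
    RCLike.re_to_real, e]
  -- The cross term -4⟨z', Qz⟩ equals 2⟨z, Sz⟩. Combined with |Qz|² + ⟨z, Sz⟩ = a²|z|² this gives
  -- |Lz|² = |z'|² + 2a²|z|² + 2|Qz|².
  have h := norm_sq_mulKink_add a z.fn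
  rw [Real.norm_of_nonneg zero_le_two]
  nlinarith [sq_nonneg ‖mulKink a z.fn‖]

/-- Coercivity of the adjoint of the linearization, in the absence of a zero mode. -/
theorem norm_le_adjOp {a : ℝ} (ha : 0 < a) {w : EnergySpace} (hw : mode 0 w.fn = 0) :
    ‖w‖ ≤ (3 + 8 * a ^ 2) * ‖adjOp a w‖ := by
  -- D is the test function: ⟨-∂_x w, D⟩ = |w|², the ∂_y term vanishes, and -2⟨Qw, D⟩ = ⟨D, SD⟩ ≥ 0.
  -- Hence |w|² ≤ |adjOp w| |D|.
  obtain ⟨D, h1, h2, h3⟩ := exists_potential hw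
  set l := ‖adjOp a w‖
  have hl0 : 0 ≤ l := norm_nonneg _
  have hw0 := norm_nonneg w
  have e1 : inner ℝ w.dx D = -‖w.fn‖ ^ 2 := by
    rw [inner_eq_neg_of_symDx w.isMultiplier_dx h1, real_inner_self_eq_norm_sq]
  have e2 : inner ℝ w.dxInvDy D = 0 := inner_symDy_self h2
  have e3 := two_mul_inner_mulB h1 (hasDerivAt_fstB_kinkB a)
  have e4 : inner ℝ D (mulB (fstB (sechB a)) D) ≥ 0 :=
    inner_mulB_nonneg (fun p => sechA_nonneg a p.1) D
  have e5 : inner ℝ (adjOp a w) D ≥ ‖w.fn‖ ^ 2 := by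
    rw [adjOp_apply, inner_sub_left, inner_sub_left, e1, e2, real_inner_smul_left, inner_mulKink]
    change 2 * inner ℝ w.fn (mulKink a D) = _ at e3
    linarith
  have e6 : ‖w.fn‖ ^ 2 ≤ l * ‖w‖ :=
    e5.le.trans ((real_inner_le_norm _ _).trans
      (mul_le_mul_of_nonneg_left (h3.trans w.norm_dxInvDy_le) hl0))
  have e7 : ‖w.dxInvDy - w.dx‖ ≤ l + 2 * (a * ‖w.fn‖) := by
    have : w.dxInvDy - w.dx = adjOp a w + (2 : ℝ) • mulKink a w.fn := by
      rw [adjOp_apply, sub_add_cancel]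
    rw [this]
    refine (norm_add_le _ _).trans (add_le_add le_rfl ?_)
    rw [norm_smul, Real.norm_of_nonneg zero_le_two]
    exact mul_le_mul_of_nonneg_left (norm_mulKink_le ha _) zero_le_two
  have e8 : ‖w.dx‖ ^ 2 + ‖w.dxInvDy‖ ^ 2 ≤ 2 * l ^ 2 + 8 * a ^ 2 * ‖w.fn‖ ^ 2 := by
    rw [← norm_sq_dxInvDy_sub_dx]
    have := pow_le_pow_left₀ (norm_nonneg _) e7 2
    nlinarith [sq_nonneg (l - 2 * (a * ‖w.fn‖))]
  have e9 : ‖w‖ ^ 2 ≤ (1 + 8 * a ^ 2) * (l * ‖w‖) + 2 * l ^ 2 := by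
    rw [EnergySpace.norm_sq]
    nlinarith [mul_le_mul_of_nonneg_left e6 (by positivity : 0 ≤ 1 + 8 * a ^ 2)]
  -- If the bound failed, then l ≤ ‖w‖, so the term 2l² in the quadratic inequality is at most
  -- 2l‖w‖; dividing by ‖w‖ gives the constant 1 + 8a² + 2.
  by_contra! hlt
  have hlw : l ≤ ‖w‖ := by nlinarith [mul_nonneg (sq_nonneg a) hl0]
  have hwp : 0 < ‖w‖ := lt_of_le_of_lt (by positivity) hlt
  have h10 : l * l ≤ l * ‖w‖ := mul_le_mul_of_nonneg_left hlw hl0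
  have h11 := mul_lt_mul_of_pos_right hlt hwp
  nlinarith

/-! ### Kernel and range of the linearization -/

/-- A consequence of the Lax–Milgram theorem. -/
theorem exists_of_bounded_below {V H : Type*} [NormedAddCommGroup V] [InnerProductSpace ℝ V]
    [CompleteSpace V] [NormedAddCommGroup H] [InnerProductSpace ℝ H] (A : V →L[ℝ] H) {C : ℝ}
    (hC : 0 < C) (hA : ∀ w, ‖w‖ ≤ C * ‖A w‖) (l : V →L[ℝ] ℝ) :
    ∃ w, ∀ w', inner ℝ (A w) (A w') = l w' := by
  let B : V →L[ℝ] V →L[ℝ] ℝ := (innerSL ℝ (E := H)).bilinearComp A A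
  have hB : IsCoercive B := by
    refine ⟨(C ^ 2)⁻¹, by positivity, fun u => ?_⟩
    change (C ^ 2)⁻¹ * ‖u‖ * ‖u‖ ≤ inner ℝ (A u) (A u)
    rw [real_inner_self_eq_norm_sq, mul_assoc, inv_mul_le_iff₀ (by positivity), ← pow_two, ← mul_pow]
    exact pow_le_pow_left₀ (norm_nonneg _) (hA u) 2
  refine ⟨hB.continuousLinearEquivOfBilin.symm ((InnerProductSpace.toDual ℝ V).symm l),
    fun w' => ?_⟩
  have h := hB.continuousLinearEquivOfBilin_apply
    (hB.continuousLinearEquivOfBilin.symm ((InnerProductSpace.toDual ℝ V).symm l)) w'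
  rw [ContinuousLinearEquiv.apply_symm_apply, InnerProductSpace.toDual_symm_apply] at h
  exact h.symm

theorem exists_mem_of_bounded_below {E H : Type*} [NormedAddCommGroup E] [InnerProductSpace ℝ E]
    [CompleteSpace E] [NormedAddCommGroup H] [InnerProductSpace ℝ H] {W : Submodule ℝ E}
    (hW : IsClosed (W : Set E)) (A : E →L[ℝ] H) {C : ℝ} (hC : 0 < C)
    (hA : ∀ w ∈ W, ‖w‖ ≤ C * ‖A w‖) (l : E →L[ℝ] ℝ) :
    ∃ w ∈ W, ∀ w' ∈ W, inner ℝ (A w) (A w') = l w' := by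
  have : CompleteSpace W := hW.completeSpace_coe
  obtain ⟨w, hw⟩ := exists_of_bounded_below (A.comp W.subtypeL) hC (fun w => hA w w.2)
    (l.comp W.subtypeL)
  exact ⟨w, w.2, fun w' h' => hw ⟨w', h'⟩⟩

/-- The soliton (up to a factor), as an element of `L²`. -/
def eta {a : ℝ} (ha : 0 < a) : L2Cyl := (memLp_fst (memLp_sechA ha)).toLp _

theorem eta_ae {a : ℝ} (ha : 0 < a) : eta ha =ᵐ[volume] fun p => sechA a p.1 :=
  MemLp.coeFn_toLp _

theorem isZeroMode_eta {a : ℝ} (ha : 0 < a) : IsZeroMode (eta ha) :=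
  isZeroMode_fst (memLp_sechA ha)

theorem isMultiplier_eta {a : ℝ} (ha : 0 < a) :
    IsMultiplier symDx (eta ha) ((-2 : ℝ) • mulKink a (eta ha)) := by
  have hae : (((-2 : ℝ) • mulKink a (eta ha) : L2Cyl) : Cyl → ℝ) =ᵐ[volume]
      fun p => -2 * kinkA a p.1 * sechA a p.1 := by
    filter_upwards [Lp.coeFn_smul (-2 : ℝ) (mulKink a (eta ha)), mulB_ae (fstB (kinkB a)) (eta ha),
      eta_ae ha] with p h1 h2 h3
    rw [h1, Pi.smul_apply, smul_eq_mul, mul_assoc]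
    congr 1
    refine h2.trans ?_
    rw [h3]; rfl
  have hm : MemLp (fun p : Cyl => -2 * kinkA a p.1 * sechA a p.1) 2 :=
    (Lp.memLp ((-2 : ℝ) • mulKink a (eta ha))).ae_eq hae
  have h := isMultiplier_symDx_of_hasDerivAt (ψ := fun p => sechA a p.1)
    (ψ' := fun p => -2 * kinkA a p.1 * sechA a p.1)
    (fun x _ => hasDerivAt_sechA a x) (memLp_fst (memLp_sechA ha)) hm
  have e : hm.toLp _ = (-2 : ℝ) • mulKink a (eta ha) := Lp.ext (hm.coeFn_toLp.trans hae.symm)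
  rwa [e] at h

/-- The soliton (up to a factor), in the energy space. -/
def etaE {a : ℝ} (ha : 0 < a) : EnergySpace :=
  EnergySpace.mk (eta ha) ((-2 : ℝ) • mulKink a (eta ha)) 0 (isMultiplier_eta ha)
    (isMultiplier_dxInvDy_of_isZeroMode (isZeroMode_eta ha))

/-- The soliton is annihilated by the formal adjoint -∂_x + ∂_x⁻¹∂_y - 2Q, because S' = -2QS and S
does not depend on y. This is the only obstruction to solvability. -/
theorem inner_linOp_eta {a : ℝ} (ha : 0 < a) (v : EnergySpace) :
    inner ℝ (linOp a v) (eta ha) = 0 := by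
  have h1 := inner_dx_eq_neg v (etaE ha)
  have h2 := inner_dxInvDy_comm v (etaE ha)
  simp only [etaE, EnergySpace.mk_fn, EnergySpace.mk_dx, EnergySpace.mk_dxInvDy, inner_zero_right,
    inner_smul_right] at h1 h2
  rw [linOp_apply, inner_sub_left, inner_add_left, h1, h2, real_inner_smul_left, inner_mulKink]
  ring

theorem sechB_pos {a : ℝ} (ha : 0 < a) (p : Cyl) : 0 < fstB (sechB a) p := by
  change 0 < sechA a p.1
  have := Real.cosh_pos (a * p.1)
  unfold sechA; positivity

/-- On the zero mode this is the lower bound. On the other modes, with v = ∂_x D, the equation is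
paired with S·D: the weight S has S' = -2QS, so the two terms with Q cancel, the ∂_y term integrates
to zero, and -⟨v, Sv⟩ = 0 remains. Positivity of S concludes. -/
theorem linOp_injective {a : ℝ} (ha : 0 < a) : Function.Injective (linOp a) := by
  rw [injective_iff_map_eq_zero]
  intro v hv
  obtain ⟨v₀, v₁, rfl, h0, h1, -, -⟩ := exists_split_energy v
  have hb0 := dxInvDy_eq_zero_of_isZeroMode h0
  have z0 : IsZeroMode (linOp a v₀) := fun n hn => by
    rw [linOp_apply, hb0, map_sub, map_add, map_smul, v₀.isMultiplier_dx.mode_eq_zero (h0 n hn),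
      map_zero, mulKink, mode_mulB_eq_zero _ (h0 n hn)]
    simp
  have z1 : mode 0 (linOp a v₁) = 0 := by
    rw [linOp_apply, map_sub, map_add, map_smul, v₁.isMultiplier_dx.mode_eq_zero h1,
      mode_zero_dxInvDy, mulKink, mode_mulB_eq_zero _ h1]
    simp
  have hs : linOp a v₀ = 0 := by
    rw [map_add] at hv
    have := inner_eq_zero_of_modes z0 z1
    rw [eq_neg_of_add_eq_zero_right hv, inner_neg_right, neg_eq_zero] at this
    exact inner_self_eq_zero.1 this
  have hs1 : linOp a v₁ = 0 := by rwa [map_add, hs, zero_add] at hv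
  have hv0 : v₀ = 0 := by
    have := norm_linOp_zero (a := a) hb0
    rw [hs, norm_zero] at this
    have hn : ‖v₀.fn‖ ^ 2 = 0 := by
      have h1 : 0 < 2 * a ^ 2 := by positivity
      nlinarith [sq_nonneg ‖v₀.dx‖, sq_nonneg ‖v₀.fn‖]
    exact EnergySpace.ext_fn (norm_eq_zero.1 (pow_eq_zero_iff two_ne_zero |>.1 hn))
  have hv1 : v₁ = 0 := by
    obtain ⟨D, d1, d2, -⟩ := exists_potential h1
    have hS : ∀ x (y : Torus), HasDerivAt (fun x => fstB (sechB a) (x, y))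
        (((-2 : ℝ) • (fstB (kinkB a) * fstB (sechB a)) : Cyl →ᵇ ℝ) (x, y)) x := fun x y =>
      (hasDerivAt_sechA a x).congr_deriv (mul_assoc _ _ _)
    have e1 := inner_eq_neg_of_symDx v₁.isMultiplier_dx (d1.mulB hS)
    have e2 : inner ℝ v₁.dxInvDy (mulB (fstB (sechB a)) D) = 0 := by
      have h3 := d2.mulB_symDy (sechB a)
      have h4 := inner_symDy_self (d2.add h3)
      rw [inner_add_left, inner_add_right, inner_add_right, inner_symDy_self d2,
        inner_symDy_self h3, inner_mulB_comm] at h4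
      linarith
    have e3 : inner ℝ (linOp a v₁) (mulB (fstB (sechB a)) D) = 0 := by rw [hs1, inner_zero_left]
    rw [linOp_apply, inner_sub_left, inner_add_left, e1, e2, inner_add_right, map_smul,
      smul_apply, inner_smul_right, ← mulB_mulB, real_inner_smul_left] at e3
    rw [← inner_mulB_comm (fstB (kinkB a)) v₁.fn] at e3
    refine EnergySpace.ext_fn (eq_zero_of_inner_mulB (sechB_pos ha) ?_)
    change _ - 2 * inner ℝ (mulB (fstB (kinkB a)) v₁.fn) _ = _ at e3
    linarith
  rw [hv0, hv1, add_zero]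

theorem inner_schwartzWave_zero {u : L2Cyl} (hu : mode 0 u = 0) (θ : 𝓢(ℝ, ℂ)) :
    inner ℝ u (schwartzWave 0 θ) = 0 := by
  rw [real_inner_comm]; exact inner_eq_zero_of_modes (isZeroMode_schwartzWave θ) hu

theorem inner_schwartzWave_ne {u : L2Cyl} (hu : IsZeroMode u) {n : ℤ} (hn : n ≠ 0) (θ : 𝓢(ℝ, ℂ)) :
    inner ℝ u (schwartzWave n θ) = 0 := by
  refine inner_eq_zero_of_modes hu ?_
  rw [schwartzWave, mode_synth, if_neg (by omega), if_neg (by omega)]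
  simp

/-- Lax–Milgram for the adjoint A yields w with ⟨Aw, Aw'⟩ = ⟨f, w'⟩ for all admissible w'. Then p =
Aw solves L p = f weakly, and weak solutions belong to the energy space. -/
theorem exists_linOp_eq_of_nonzero {a : ℝ} (ha : 0 < a) {f : L2Cyl} (hf : mode 0 f = 0) :
    ∃ v, linOp a v = f := by
  obtain ⟨w, hwz, hw⟩ := exists_mem_of_bounded_below isClosed_energyNonzero (adjOp a)
    (by positivity : 0 < 3 + 8 * a ^ 2) (fun w hw => norm_le_adjOp ha hw)
    ((innerSL ℝ f).comp EnergySpace.fnL)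
  change mode 0 w.fn = 0 at hwz
  set p := adjOp a w
  have hp : mode 0 p = 0 := by
    rw [show p = _ from adjOp_apply a w, map_sub, map_sub, map_smul,
      w.isMultiplier_dx.mode_eq_zero hwz,
      mode_zero_dxInvDy, mulKink, mode_mulB_eq_zero _ hwz]
    simp
  -- The test functions are x-derivatives of waves, so the weak equation is the x-derivative of the
  -- desired one. No information is lost, since both sides have no zero mode and the regularity
  -- lemma inverts ξ² - in.
  obtain ⟨v, hv, hvg⟩ := exists_energy_of_weak (p := p) (g := f + (2 : ℝ) • mulKink a p)
    fun n θ => by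
      by_cases hn : n = 0
      · subst hn
        have : mode 0 (f + (2 : ℝ) • mulKink a p) = 0 := by
          rw [map_add, map_smul, hf, mulKink, mode_mulB_eq_zero _ hp]; simp
        rw [inner_schwartzWave_zero hp, inner_schwartzWave_zero hp, inner_schwartzWave_zero this,
          sub_zero]
      · have h1 : inner ℝ p (adjOp a (dxWave n θ)) = inner ℝ f (dxWave n θ).fn :=
          hw _ (dxWave_mem hn θ)
        rw [adjOp_apply, inner_sub_right, inner_sub_right, inner_smul_right, ← inner_mulKink] at h1
        rw [inner_add_left, real_inner_smul_left]
        change inner ℝ p (schwartzWave n _) - inner ℝ p (schwartzWave n _) -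
          2 * inner ℝ (mulKink a p) (schwartzWave n _) = inner ℝ f (schwartzWave n _) at h1
        linarith
  exact ⟨v, by rw [linOp_apply, hvg, hv, add_sub_cancel_right]⟩

/-- The solutions of `g' = -2 Q g` among zero modes are the multiples of the soliton. -/
theorem eq_smul_eta {a : ℝ} (ha : 0 < a) {g : L2Cyl} (hg : IsZeroMode g)
    (h : IsMultiplier symDx g ((-2 : ℝ) • mulKink a g)) : ∃ r : ℝ, g = r • eta ha := by
  let w : EnergySpace := EnergySpace.mk g _ 0 h (isMultiplier_dxInvDy_of_isZeroMode hg)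
  obtain ⟨z, hz, -, hd⟩ := exists_zeroMode_rep (v := w) hg
  change g =ᵐ[volume] _ at hz
  have hc : Continuous fun x => -2 * kinkA a x * z x := by
    have := continuous_kinkA a
    fun_prop
  have h1 : ∀ s t, s ≤ t → z t - z s = ∫ x in s..t, -2 * kinkA a x * z x := fun s t hst => by
    have h2 := hd s t hst
    rw [inner_strip] at h2
    have h3 : ∫ p in Set.Icc s t ×ˢ Set.univ, w.dx p =
        ∫ p in Set.Icc s t ×ˢ (Set.univ : Set Torus), -2 * kinkA a p.1 * z p.1 := by
      refine setIntegral_congr_ae (measurableSet_Icc.prod MeasurableSet.univ) ?_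
      filter_upwards [Lp.coeFn_smul (-2 : ℝ) (mulKink a g), mulB_ae (fstB (kinkB a)) g, hz]
        with p e1 e2 e3 _
      refine e1.trans ?_
      rw [Pi.smul_apply, smul_eq_mul, mul_assoc]
      congr 1
      refine e2.trans ?_
      rw [e3]; rfl
    rw [h3, integral_strip_fst s t hst fun x => -2 * kinkA a x * z x] at h2
    exact (mul_left_cancel₀ Real.two_pi_pos.ne' h2).symm
  have h2 : ∀ x, HasDerivAt z (-2 * kinkA a x * z x) x := fun x => by
    have e : (z : ℝ → ℝ) =ᶠ[𝓝 x] fun t => z (x - 1) + ∫ s in (x - 1)..t, -2 * kinkA a s * z s := by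
      filter_upwards [lt_mem_nhds (sub_one_lt x)] with t ht
      rw [← h1 _ _ ht.le]; ring
    refine HasDerivAt.congr_of_eventuallyEq ?_ e
    exact (intervalIntegral.integral_hasDerivAt_right (hc.intervalIntegrable _ _)
      (hc.stronglyMeasurableAtFilter _ _) hc.continuousAt).const_add _
  have hS : ∀ x, 0 < sechA a x := fun x => sechB_pos ha (x, 0)
  -- z and S solve the same first-order linear equation, so their quotient is constant.
  have h3 : ∀ x, HasDerivAt (fun x => z x / sechA a x) 0 x := fun x => by
    refine ((h2 x).div (hasDerivAt_sechA a x) (hS x).ne').congr_deriv ?_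
    rw [div_eq_zero_iff]; left; ring
  have h4 : ∀ x, z x / sechA a x = z 0 / sechA a 0 := fun x =>
    is_const_of_deriv_eq_zero (fun x => (h3 x).differentiableAt) (fun x => (h3 x).deriv) x 0
  refine ⟨z 0 / sechA a 0, Lp.ext ?_⟩
  filter_upwards [hz, Lp.coeFn_smul (z 0 / sechA a 0) (eta ha), eta_ae ha] with p e1 e2 e3
  rw [e1, e2, Pi.smul_apply, smul_eq_mul, e3, ← h4 p.1, div_mul_cancel₀ _ (hS _).ne']

/-- Least squares: w minimizes |f - Lw| over zero modes, and the residual g is orthogonal to their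
images. This reads g' = -2Qg weakly, so g is a multiple of η; being also orthogonal to η, it
vanishes. The constant C is the lower bound of L rewritten in the energy norm. -/
theorem exists_linOp_eq_of_zero {a : ℝ} (ha : 0 < a) {f : L2Cyl} (hf : IsZeroMode f)
    (hη : inner ℝ f (eta ha) = 0) : ∃ v, linOp a v = f := by
  set C : ℝ := Real.sqrt (1 + (2 * a ^ 2)⁻¹)
  have hC : 0 < C := Real.sqrt_pos.2 (by positivity)
  obtain ⟨w, hwz, hw⟩ := exists_mem_of_bounded_below isClosed_energyZero (linOp a) hC
    (fun w hw => by
      have hz : w.dxInvDy = 0 := dxInvDy_eq_zero_of_isZeroMode hw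
      have h := norm_linOp_zero (a := a) hz
      refine le_of_sq_le_sq ?_ (by positivity)
      rw [EnergySpace.norm_sq, hz, norm_zero, mul_pow, Real.sq_sqrt (by positivity)]
      have e : ‖w.fn‖ ^ 2 = (2 * a ^ 2)⁻¹ * (2 * a ^ 2 * ‖w.fn‖ ^ 2) := by field_simp
      have h0 : 0 ≤ (2 * a ^ 2)⁻¹ := by positivity
      have h2 : 2 * a ^ 2 * ‖w.fn‖ ^ 2 ≤ ‖linOp a w‖ ^ 2 := by nlinarith [sq_nonneg ‖w.dx‖]
      have h3 := mul_le_mul_of_nonneg_left h2 h0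
      have h4 : ‖w.dx‖ ^ 2 ≤ ‖linOp a w‖ ^ 2 := by
        nlinarith [mul_nonneg (sq_nonneg a) (sq_nonneg ‖w.fn‖)]
      rw [e]; linarith)
    ((innerSL ℝ f).comp (linOp a))
  change IsZeroMode w.fn at hwz
  set g := f - linOp a w with hgdef
  have hgz : IsZeroMode g := fun n hn => by
    rw [hgdef, linOp_apply, dxInvDy_eq_zero_of_isZeroMode hwz, map_sub, map_sub, map_add, map_smul,
      hf n hn, w.isMultiplier_dx.mode_eq_zero (hwz n hn), map_zero, mulKink,
      mode_mulB_eq_zero _ (hwz n hn)]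
    simp
  have hgo : ∀ z : EnergySpace, IsZeroMode z.fn → inner ℝ g (linOp a z) = 0 := fun z hz => by
    have h1 : inner ℝ (linOp a w) (linOp a z) = inner ℝ f (linOp a z) := hw z hz
    rw [hgdef, inner_sub_left, h1, sub_self]
  have hgm : IsMultiplier symDx g ((-2 : ℝ) • mulKink a g) := isMultiplier_symDx_of_weak fun n θ => by
    by_cases hn : n = 0
    · subst hn
      have h1 := hgo (zeroWave θ) (isZeroMode_schwartzWave θ)
      rw [linOp_apply, inner_sub_right, inner_add_right, inner_smul_right] at h1
      rw [real_inner_smul_left, inner_mulKink]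
      change inner ℝ g (schwartzWave 0 (sderiv θ)) + inner ℝ g 0 -
        2 * inner ℝ g (mulKink a (schwartzWave 0 θ)) = 0 at h1
      rw [inner_zero_right] at h1
      linarith
    · rw [inner_schwartzWave_ne hgz hn, real_inner_smul_left, mulKink,
        inner_schwartzWave_ne (hgz.mulB _) hn]; simp
  obtain ⟨r, hr⟩ := eq_smul_eta ha hgz hgm
  have hg0 : inner ℝ g (eta ha) = 0 := by
    rw [hgdef, inner_sub_left, hη, inner_linOp_eta, sub_zero]
  have hg : g = 0 := by
    have : inner ℝ g g = 0 := by
      have h1 : inner ℝ g g = inner ℝ g (r • eta ha) := congrArg (inner ℝ g) hr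
      rw [h1, inner_smul_right, hg0, mul_zero]
    exact inner_self_eq_zero.1 this
  exact ⟨w, (sub_eq_zero.1 hg).symm⟩

theorem exists_linOp_eq {a : ℝ} (ha : 0 < a) {f : L2Cyl} (hη : inner ℝ f (eta ha) = 0) :
    ∃ v, linOp a v = f := by
  obtain ⟨f₀, f₁, rfl, h0, h1, -, -⟩ := exists_split f
  have h2 : inner ℝ f₁ (eta ha) = 0 := by
    rw [real_inner_comm]; exact inner_eq_zero_of_modes (isZeroMode_eta ha) h1
  rw [inner_add_left, h2, add_zero] at hη
  obtain ⟨v₀, e0⟩ := exists_linOp_eq_of_zero ha h0 hη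
  obtain ⟨v₁, e1⟩ := exists_linOp_eq_of_nonzero ha h1
  exact ⟨v₀ + v₁, by rw [map_add, e0, e1]⟩

/-- `(κ, v) ↦ κ p + L v`. -/
def augOp (a : ℝ) (p : L2Cyl) : ℝ × EnergySpace →L[ℝ] L2Cyl :=
  (ContinuousLinearMap.toSpanSingleton ℝ p).coprod (linOp a)

theorem augOp_apply (a : ℝ) (p : L2Cyl) (x : ℝ × EnergySpace) :
    augOp a p x = x.1 • p + linOp a x.2 := rfl

/-- L is injective with range the complement of η, and p is transversal to that range. The
coefficient κ is found by pairing with η. -/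
theorem augOp_bijective {a : ℝ} (ha : 0 < a) {p : L2Cyl} (hp : inner ℝ p (eta ha) ≠ 0) :
    Function.Bijective (augOp a p) := by
  constructor
  · rw [injective_iff_map_eq_zero]
    rintro ⟨κ, v⟩ h
    rw [augOp_apply] at h
    have h1 := congrArg (fun u => inner ℝ u (eta ha)) h
    simp only [inner_add_left, real_inner_smul_left, inner_linOp_eta, inner_zero_left, add_zero] at h1
    have hκ : κ = 0 := (mul_eq_zero.1 h1).resolve_right hp
    subst hκ
    rw [zero_smul, zero_add] at h
    have hv : v = 0 := linOp_injective ha (h.trans (map_zero _).symm)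
    rw [hv]; rfl
  · intro f
    set κ := inner ℝ f (eta ha) / inner ℝ p (eta ha)
    obtain ⟨v, hv⟩ := exists_linOp_eq ha (f := f - κ • p) (by
      rw [inner_sub_left, real_inner_smul_left, div_mul_cancel₀ _ hp, sub_self])
    exact ⟨(κ, v), by rw [augOp_apply, hv]; simp⟩

/-- The augmented linearization as an isomorphism. -/
def augEquiv {a : ℝ} (ha : 0 < a) {p : L2Cyl} (hp : inner ℝ p (eta ha) ≠ 0) :
    (ℝ × EnergySpace) ≃L[ℝ] L2Cyl :=
  ContinuousLinearEquiv.ofBijective (augOp a p)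
    (LinearMap.ker_eq_bot.2 (augOp_bijective ha hp).1)
    (LinearMap.range_eq_top.2 (augOp_bijective ha hp).2)

/-! ### Differentiable families of bounded continuous functions -/

/-- First-order Taylor expansion from the mean value inequality, applied twice. The constant depends
only on the bound of the second derivative, which makes it uniform over a family. -/
theorem sub_sub_le_of_hasDerivAt {s t M : ℝ} {f f1 f2 : ℝ → ℝ}
    (h1 : ∀ a ∈ Set.Icc s t, HasDerivAt f (f1 a) a)
    (h2 : ∀ a ∈ Set.Icc s t, HasDerivAt f1 (f2 a) a) (hM : ∀ a ∈ Set.Icc s t, |f2 a| ≤ M)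
    {a b : ℝ} (ha : a ∈ Set.Icc s t) (hb : b ∈ Set.Icc s t) :
    |f1 b - f1 a| ≤ M * |b - a| ∧ |f b - f a - (b - a) * f1 a| ≤ M * |b - a| ^ 2 := by
  have hsub : Set.uIcc a b ⊆ Set.Icc s t := Set.uIcc_subset_Icc ha hb
  have k1 : ∀ c ∈ Set.uIcc a b, |f1 c - f1 a| ≤ M * |c - a| := fun c hc => by
    have := (convex_Icc s t).norm_image_sub_le_of_norm_hasDerivWithin_le
      (fun x hx => (h2 x hx).hasDerivWithinAt) hM ha (hsub hc)
    simpa [Real.norm_eq_abs] using this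
  have hM0 : 0 ≤ M := (abs_nonneg _).trans (hM a ha)
  refine ⟨k1 b Set.right_mem_uIcc, ?_⟩
  have k2 := (convex_uIcc a b).norm_image_sub_le_of_norm_hasDerivWithin_le
    (f := fun c => f c - c * f1 a) (f' := fun c => f1 c - f1 a) (C := M * |b - a|)
    (fun x hx => ((h1 x (hsub hx)).sub (by simpa using (hasDerivAt_id x).mul_const (f1 a))).hasDerivWithinAt)
    (fun x hx => (k1 x hx).trans (mul_le_mul_of_nonneg_left (Set.abs_sub_left_of_mem_uIcc hx) hM0))
    Set.left_mem_uIcc Set.right_mem_uIcc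
  rw [Real.norm_eq_abs, Real.norm_eq_abs] at k2
  rw [show f b - f a - (b - a) * f1 a = f b - b * f1 a - (f a - a * f1 a) by ring]
  refine k2.trans (le_of_eq ?_)
  ring

/-- A family `f(a, ·)` with two derivatives in `a` that are bounded uniformly is `C¹` in the sup
norm. -/
theorem exists_contDiff_bcf {s t M : ℝ} (hst : s < t) {f f1 f2 : ℝ → ℝ → ℝ}
    (hc : ∀ a ∈ Set.Icc s t, Continuous (f a)) (hc1 : ∀ a ∈ Set.Icc s t, Continuous (f1 a))
    (h0 : ∀ a ∈ Set.Icc s t, ∀ x, |f a x| ≤ M) (h1 : ∀ a ∈ Set.Icc s t, ∀ x, |f1 a x| ≤ M)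
    (h2 : ∀ a ∈ Set.Icc s t, ∀ x, |f2 a x| ≤ M)
    (d1 : ∀ a ∈ Set.Icc s t, ∀ x, HasDerivAt (fun a => f a x) (f1 a x) a)
    (d2 : ∀ a ∈ Set.Icc s t, ∀ x, HasDerivAt (fun a => f1 a x) (f2 a x) a) :
    ∃ G G1 : ℝ → ℝ →ᵇ ℝ, (∀ a ∈ Set.Icc s t, ∀ x, G a x = f a x) ∧
      (∀ a ∈ Set.Icc s t, ∀ x, G1 a x = f1 a x) ∧ (∀ a ∈ Set.Ioo s t, HasDerivAt G (G1 a) a) ∧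
      ContDiffOn ℝ 1 G (Set.Ioo s t) := by
  -- Bounds are available only for parameters in [s, t]; clamping the parameter defines the family
  -- everywhere without changing it there.
  let P : ℝ → ℝ := fun a => max s (min a t)
  have hP : ∀ a, P a ∈ Set.Icc s t := fun a =>
    ⟨le_max_left _ _, max_le hst.le (min_le_right _ _)⟩
  have hPe : ∀ a ∈ Set.Icc s t, P a = a := fun a ha => by
    simp only [P, min_eq_left ha.2, max_eq_right ha.1]
  let G : ℝ → ℝ →ᵇ ℝ := fun a =>
    BoundedContinuousFunction.ofNormedAddCommGroup (f (P a)) (hc _ (hP a)) M (h0 _ (hP a))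
  let G1 : ℝ → ℝ →ᵇ ℝ := fun a =>
    BoundedContinuousFunction.ofNormedAddCommGroup (f1 (P a)) (hc1 _ (hP a)) M (h1 _ (hP a))
  have e0 : ∀ a ∈ Set.Icc s t, ∀ x, G a x = f a x := fun a ha x => by
    change f (P a) x = _; rw [hPe a ha]
  have e1 : ∀ a ∈ Set.Icc s t, ∀ x, G1 a x = f1 a x := fun a ha x => by
    change f1 (P a) x = _; rw [hPe a ha]
  have hM0 : 0 ≤ M := (abs_nonneg _).trans (h0 s ⟨le_rfl, hst.le⟩ 0)
  have key : ∀ a ∈ Set.Icc s t, ∀ b ∈ Set.Icc s t, ∀ x, _ := fun a ha b hb x =>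
    sub_sub_le_of_hasDerivAt (fun c hc => d1 c hc x) (fun c hc => d2 c hc x)
      (fun c hc => h2 c hc x) ha hb
  have hd : ∀ a ∈ Set.Ioo s t, HasDerivAt G (G1 a) a := fun a ha => by
    have ha' := Set.Ioo_subset_Icc_self ha
    rw [hasDerivAt_iff_isLittleO]
    refine Asymptotics.IsBigO.trans_isLittleO (g := fun b : ℝ => ‖b - a‖ ^ 2)
      (Asymptotics.IsBigO.of_bound M ?_) (Asymptotics.isLittleO_pow_sub_sub a one_lt_two)
    filter_upwards [Ioo_mem_nhds ha.1 ha.2] with b hb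
    have hb' := Set.Ioo_subset_Icc_self hb
    refine (BoundedContinuousFunction.norm_le (by positivity)).2 fun x => ?_
    have := (key a ha' b hb' x).2
    simp only [BoundedContinuousFunction.coe_sub, BoundedContinuousFunction.coe_smul, Pi.sub_apply,
      smul_eq_mul, e0 a ha', e0 b hb', e1 a ha']
    simpa using this
  have hcont : ContinuousOn G1 (Set.Ioo s t) := by
    refine (LipschitzOnWith.of_dist_le_mul (K := ⟨M, hM0⟩) fun a ha b hb => ?_).continuousOn
    have ha' := Set.Ioo_subset_Icc_self ha
    have hb' := Set.Ioo_subset_Icc_self hb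
    rw [dist_eq_norm, dist_eq_norm]
    refine (BoundedContinuousFunction.norm_le (by positivity)).2 fun x => ?_
    have := (key b hb' a ha' x).1
    simp only [BoundedContinuousFunction.coe_sub, Pi.sub_apply, e1 a ha', e1 b hb']
    exact this
  refine ⟨G, G1, e0, e1, hd, ?_⟩
  have := (contDiffOn_succ_iff_deriv_of_isOpen (𝕜 := ℝ) (n := 0) (f := G) (isOpen_Ioo (a := s) (b := t))).2
    ⟨fun a ha => (hd a ha).differentiableAt.differentiableWithinAt, by simp, ?_⟩
  · simpa using this
  · rw [contDiffOn_zero]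
    exact hcont.congr fun a ha => (hd a ha).deriv

/-! ### Smoothness of the kinks and of the solitons in the amplitude -/

theorem hasDerivAt_tanh_amp (a x : ℝ) :
    HasDerivAt (fun a => Real.tanh (a * x)) (x * (1 / Real.cosh (a * x) ^ 2)) a := by
  have h := (hasDerivAt_tanh (a * x)).comp a ((hasDerivAt_id a).mul_const x)
  exact h.congr_deriv (by ring)

theorem hasDerivAt_sechSq_amp (a x : ℝ) :
    HasDerivAt (fun a => 1 / Real.cosh (a * x) ^ 2)
      (-2 * x * Real.tanh (a * x) * (1 / Real.cosh (a * x) ^ 2)) a := by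
  have e : (fun a => 1 / Real.cosh (a * x) ^ 2) = fun a => 1 - Real.tanh (a * x) ^ 2 :=
    funext fun a => by linarith [tanh_sq_add (a * x)]
  rw [e]
  refine (((hasDerivAt_tanh_amp a x).pow 2).const_sub 1).congr_deriv ?_
  push_cast; ring

theorem sechSq_le_one (y : ℝ) : 1 / Real.cosh y ^ 2 ≤ 1 := by
  linarith [tanh_sq_add y, sq_nonneg (Real.tanh y)]

theorem continuous_sechSq (a : ℝ) : Continuous fun x => 1 / Real.cosh (a * x) ^ 2 :=
  Continuous.div (by fun_prop) (by fun_prop) fun x => by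
    have := Real.cosh_pos (a * x); positivity

/-- The kink does not decay, but its amplitude derivatives involve x only in products with
cosh⁻²(ax), which are bounded uniformly for a ≥ a₀/2. -/
theorem contDiffAt_kinkB {a₀ : ℝ} (h : 0 < a₀) : ContDiffAt ℝ 1 kinkB a₀ := by
  obtain ⟨B, hB, hd⟩ := exists_decay (half_pos h)
  have hk : ∀ (a : ℝ), a₀ / 2 ≤ a → ∀ x j, j ≤ 4 → |x| ^ j * (1 / Real.cosh (a * x) ^ 2) ≤ B :=
    fun a ha x j hj => by
      refine le_trans (mul_le_mul_of_nonneg_right ?_ (by positivity)) (hd a ha x)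
      exact (pow_le_pow_left₀ (abs_nonneg x) (by linarith) j).trans
        (pow_le_pow_right₀ (by linarith [abs_nonneg x]) hj)
  have hS : ∀ y : ℝ, 0 ≤ 1 / Real.cosh y ^ 2 := fun y => by positivity
  obtain ⟨G, G1, e0, -, -, hG⟩ := exists_contDiff_bcf (s := a₀ / 2) (t := 2 * a₀)
    -- A common bound for the kink (at most 2a₀) and its first two amplitude derivatives (at most 1
    -- + 2a₀B and 2B + 4a₀B).
    (M := 2 * a₀ + 1 + (2 + 6 * a₀) * B)
    (by linarith) (f := kinkA)
    (f1 := fun a x => Real.tanh (a * x) + a * (x * (1 / Real.cosh (a * x) ^ 2)))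
    (f2 := fun a x => 2 * (x * (1 / Real.cosh (a * x) ^ 2)) -
      2 * a * (Real.tanh (a * x) * (x ^ 2 * (1 / Real.cosh (a * x) ^ 2))))
    (fun a _ => continuous_kinkA a)
    (fun a _ => (continuous_tanh.comp (by fun_prop)).add
      (continuous_const.mul (continuous_id.mul (continuous_sechSq a))))
    (fun a ha x => by
      refine (abs_kinkA_le a x).trans ?_
      rw [abs_of_pos (by linarith [ha.1])]
      nlinarith [ha.2, mul_pos h hB])
    (fun a ha x => by
      have ha0 : 0 < a := by linarith [ha.1]
      refine (abs_add_le _ _).trans ?_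
      have k1 := hk a ha.1 x 1 (by norm_num)
      rw [abs_mul, abs_mul, abs_of_pos ha0, abs_of_nonneg (hS _)]
      rw [pow_one] at k1
      have := abs_tanh_le (a * x)
      nlinarith [ha.2, mul_pos h hB, mul_le_mul ha.2 k1 (by positivity) (by positivity)])
    (fun a ha x => by
      have ha0 : 0 < a := by linarith [ha.1]
      refine (abs_sub _ _).trans ?_
      have k1 := hk a ha.1 x 1 (by norm_num)
      have k2 := hk a ha.1 x 2 (by norm_num)
      have k3 : |Real.tanh (a * x)| * (|x| ^ 2 * (1 / Real.cosh (a * x) ^ 2)) ≤ 1 * B :=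
        mul_le_mul (abs_tanh_le _) k2 (by positivity) zero_le_one
      rw [abs_mul, abs_mul, abs_mul, abs_mul, abs_mul, abs_mul, abs_of_pos ha0,
        abs_of_nonneg (hS _), abs_pow, abs_two]
      rw [pow_one] at k1
      have k4 : a * (|Real.tanh (a * x)| * (|x| ^ 2 * (1 / Real.cosh (a * x) ^ 2))) ≤
        2 * a₀ * (1 * B) := mul_le_mul ha.2 k3 (by positivity) (by positivity)
      nlinarith [mul_pos h hB])
    (fun a _ x => by
      refine ((hasDerivAt_id a).mul (hasDerivAt_tanh_amp a x)).congr_deriv ?_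
      simp)
    (fun a _ x => by
      refine ((hasDerivAt_tanh_amp a x).add
        ((hasDerivAt_id a).mul ((hasDerivAt_sechSq_amp a x).const_mul x))).congr_deriv ?_
      simp only [id]; ring)
  have hmem : Set.Ioo (a₀ / 2) (2 * a₀) ∈ 𝓝 a₀ := Ioo_mem_nhds (by linarith) (by linarith)
  refine (hG.contDiffAt hmem).congr_of_eventuallyEq ?_
  filter_upwards [hmem] with a ha
  ext x
  exact (e0 a (Set.Ioo_subset_Icc_self ha) x).symm

/-- The weight `(1 + x²)⁻¹` as an element of `L²`. -/
def weightL : L2Cyl := (memLp_fst memLp_weight).toLp _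

theorem weightL_ae : weightL =ᵐ[volume] fun p => weight p.1 := MemLp.coeFn_toLp _

/-- The derivative of `2 a² cosh⁻²(a x)` with respect to `a`. -/
def dsech (a x : ℝ) : ℝ :=
  4 * a * (1 / Real.cosh (a * x) ^ 2) -
    4 * a ^ 2 * (x * Real.tanh (a * x) * (1 / Real.cosh (a * x) ^ 2))

theorem hasDerivAt_sechA_amp (a x : ℝ) : HasDerivAt (fun a => 2 * sechA a x) (dsech a x) a := by
  have h := (((hasDerivAt_id a).pow 2).mul (hasDerivAt_sechSq_amp a x)).const_mul 2
  refine h.congr_deriv ?_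
  simp only [dsech, id, Pi.pow_apply]; push_cast; ring

/-- The amplitude derivative of the soliton is not orthogonal to the soliton. -/
theorem integral_dsech_mul_pos {a : ℝ} (ha : 0 < a) : 0 < ∫ x, dsech a x * sechA a x := by
  obtain ⟨C, hC, hw⟩ := exists_sechA_le_weight ha
  have hm := memLp_sechA ha
  have i1 : Integrable fun x => sechA a x * sechA a x := hm.integrable_mul hm
  have hx : ∀ x, |x| * sechA a x ≤ C := fun x => by
    have h1 := hw x
    have h2 : |x| * weight x ≤ 1 := by
      rw [weight, ← div_eq_mul_inv, div_le_one (by positivity)]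
      nlinarith [sq_abs x, sq_nonneg (|x| - 1)]
    nlinarith [abs_nonneg x, sechA_nonneg a x, mul_le_mul_of_nonneg_left h1 (abs_nonneg x)]
  have iw : Integrable fun x => sechA a x :=
    (integrable_weight.const_mul C).mono' (continuous_sechA a).aestronglyMeasurable
      (Eventually.of_forall fun x => by rw [Real.norm_of_nonneg (sechA_nonneg a x)]; exact hw x)
  have ix : Integrable fun x => x * (sechA a x * sechA a x) := by
    refine (iw.const_mul C).mono' ?_ (Eventually.of_forall fun x => ?_)
    · have := continuous_sechA a
      exact (by fun_prop : Continuous _).aestronglyMeasurable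
    · rw [norm_mul, norm_mul, Real.norm_of_nonneg (sechA_nonneg a x), ← mul_assoc]
      exact mul_le_mul_of_nonneg_right (hx x) (sechA_nonneg a x)
  have ik : Integrable fun x => kinkA a x * (x * (sechA a x * sechA a x)) :=
    ix.bdd_mul (continuous_kinkA a).aestronglyMeasurable (Eventually.of_forall (abs_kinkA_le a))
  -- Integrating (xS²)' = S² - 4QxS² gives ∫ QxS² = ¼ ∫ S², so the pairing equals (3/a) ∫ S².
  have h0 := integral_eq_zero_of_hasDerivAt_of_integrable
    (f := fun x => x * (sechA a x * sechA a x))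
    (f' := fun x => sechA a x * sechA a x - 4 * (kinkA a x * (x * (sechA a x * sechA a x))))
    (fun x => by
      refine ((hasDerivAt_id x).mul ((hasDerivAt_sechA a x).mul (hasDerivAt_sechA a x))).congr_deriv ?_
      simp only [id, Pi.mul_apply]; ring) (i1.sub (ik.const_mul 4)) ix
  rw [integral_sub i1 (ik.const_mul 4), integral_const_mul] at h0
  have e : ∀ x, dsech a x * sechA a x = 4 / a * (sechA a x * sechA a x) -
      4 / a * (kinkA a x * (x * (sechA a x * sechA a x))) := fun x => by
    simp only [dsech, kinkA, sechA]; field_simp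
  simp only [e]
  rw [integral_sub (i1.const_mul _) (ik.const_mul _), integral_const_mul, integral_const_mul]
  have hpos : 0 < ∫ x, sechA a x * sechA a x := by
    have hp : ∀ x, 0 < sechA a x * sechA a x := fun x =>
      mul_pos (sechB_pos ha (x, 0)) (sechB_pos ha (x, 0))
    rw [integral_pos_iff_support_of_nonneg (fun x => (hp x).le) i1,
      Function.support_eq_univ fun x => (hp x).ne']
    simp
  have h4 : 0 < 4 / a := by positivity
  have : ∫ x, kinkA a x * (x * (sechA a x * sechA a x)) = (∫ x, sechA a x * sechA a x) / 4 := by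
    linarith
  rw [this]
  nlinarith [mul_pos h4 hpos]

/-- `fstB` as a continuous linear map. -/
def fstL : (ℝ →ᵇ ℝ) →L[ℝ] (Cyl →ᵇ ℝ) :=
  LinearMap.mkContinuous { toFun := fstB, map_add' := fun _ _ => rfl, map_smul' := fun _ _ => rfl } 1
    fun f => by rw [one_mul]; exact norm_fstB_le f

/-- Weighted amplitude derivatives of the soliton profile. -/
theorem exists_weighted_family {a₀ : ℝ} (h : 0 < a₀) :
    ∃ G G1 : ℝ → ℝ →ᵇ ℝ,
      (∀ a ∈ Set.Icc (a₀ / 2) (2 * a₀), ∀ x, G a x = (1 + x ^ 2) * (2 * sechA a x)) ∧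
      (∀ a ∈ Set.Icc (a₀ / 2) (2 * a₀), ∀ x, G1 a x = (1 + x ^ 2) * dsech a x) ∧
      (∀ a ∈ Set.Ioo (a₀ / 2) (2 * a₀), HasDerivAt G (G1 a) a) ∧
      ContDiffOn ℝ 1 G (Set.Ioo (a₀ / 2) (2 * a₀)) := by
  obtain ⟨B, hB, hd⟩ := exists_decay (half_pos h)
  set A := 2 * a₀ with hA
  have hA0 : 0 < A := by positivity
  have hS : ∀ y : ℝ, 0 ≤ 1 / Real.cosh y ^ 2 := fun y => by positivity
  have hk : ∀ (a : ℝ), a₀ / 2 ≤ a → ∀ x j τ, j ≤ 2 → |τ| ≤ 1 →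
      |(1 + x ^ 2) * (x ^ j * (τ * (1 / Real.cosh (a * x) ^ 2)))| ≤ B := fun a ha x j τ hj hτ => by
    refine le_trans ?_ (hd a ha x)
    rw [abs_mul, abs_mul, abs_mul, abs_of_nonneg (hS _), abs_pow,
      abs_of_nonneg (by positivity : 0 ≤ 1 + x ^ 2)]
    have e1 : 1 + x ^ 2 ≤ (1 + |x|) ^ 2 := by nlinarith [sq_abs x, abs_nonneg x]
    have e2 : |x| ^ j ≤ (1 + |x|) ^ 2 :=
      (pow_le_pow_left₀ (abs_nonneg x) (by linarith) j).trans
        (pow_le_pow_right₀ (by linarith [abs_nonneg x]) hj)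
    have e3 : |τ| * (1 / Real.cosh (a * x) ^ 2) ≤ 1 / Real.cosh (a * x) ^ 2 :=
      mul_le_of_le_one_left (hS _) hτ
    calc (1 + x ^ 2) * (|x| ^ j * (|τ| * (1 / Real.cosh (a * x) ^ 2)))
        ≤ (1 + |x|) ^ 2 * ((1 + |x|) ^ 2 * (1 / Real.cosh (a * x) ^ 2)) := by gcongr
      _ = _ := by ring
  have hm1 : ∀ {a k : ℝ}, a ∈ Set.Icc (a₀ / 2) A → |k| ≤ B → |a * k| ≤ A * B := fun {a k} ha hk => by
    rw [abs_mul, abs_of_pos (by linarith [ha.1] : 0 < a)]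
    exact mul_le_mul ha.2 hk (abs_nonneg _) hA0.le
  have hm2 : ∀ {a k : ℝ}, a ∈ Set.Icc (a₀ / 2) A → |k| ≤ B → |a ^ 2 * k| ≤ A ^ 2 * B :=
    fun {a k} ha hk => by
      have ha0 : 0 < a := by linarith [ha.1]
      rw [abs_mul, abs_of_pos (by positivity : 0 < a ^ 2)]
      exact mul_le_mul (pow_le_pow_left₀ ha0.le ha.2 2) hk (abs_nonneg _) (by positivity)
  have hAB : 0 < A * B := by positivity
  have hAB2 : 0 < A ^ 2 * B := by positivity
  have ht : ∀ y : ℝ, |Real.tanh y ^ 2| ≤ 1 := fun y => by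
    rw [abs_pow]; exact pow_le_one₀ (abs_nonneg _) (abs_tanh_le y)
  have hs1 : ∀ y : ℝ, |1 / Real.cosh y ^ 2| ≤ 1 := fun y => by
    rw [abs_of_nonneg (hS y)]; exact sechSq_le_one y
  have hone : |(1 : ℝ)| ≤ 1 := by simp
  refine exists_contDiff_bcf (s := a₀ / 2) (t := A)
    (M := 4 * B + 20 * (A * B) + 20 * (A ^ 2 * B)) (by linarith)
    (f := fun a x => (1 + x ^ 2) * (2 * sechA a x))
    (f1 := fun a x => (1 + x ^ 2) * dsech a x)
    (f2 := fun a x => (1 + x ^ 2) * (4 * (1 / Real.cosh (a * x) ^ 2) -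
      16 * a * (x * Real.tanh (a * x) * (1 / Real.cosh (a * x) ^ 2)) -
      4 * a ^ 2 * (x ^ 2 * (1 / Real.cosh (a * x) ^ 2 * (1 / Real.cosh (a * x) ^ 2))) +
      8 * a ^ 2 * (x ^ 2 * (Real.tanh (a * x) ^ 2 * (1 / Real.cosh (a * x) ^ 2)))))
    (fun a _ => by have := continuous_sechA a; fun_prop)
    (fun a _ => by
      have h1 := continuous_sechSq a
      have h2 : Continuous fun x => Real.tanh (a * x) := continuous_tanh.comp (by fun_prop)
      unfold dsech
      fun_prop)
    (fun a ha x => ?_) (fun a ha x => ?_) (fun a ha x => ?_) (fun a _ x => ?_) (fun a _ x => ?_)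
  · have k0 := abs_le.1 (hm2 ha (hk a ha.1 x 0 1 (by norm_num) hone))
    rw [show (1 + x ^ 2) * (2 * sechA a x) =
      2 * (a ^ 2 * ((1 + x ^ 2) * (x ^ 0 * (1 * (1 / Real.cosh (a * x) ^ 2))))) by
        rw [sechA]; ring]
    rw [abs_le]; constructor <;> linarith [k0.1, k0.2]
  · have k0 := abs_le.1 (hm1 ha (hk a ha.1 x 0 1 (by norm_num) hone))
    have k1 := abs_le.1 (hm2 ha (hk a ha.1 x 1 _ (by norm_num) (abs_tanh_le (a * x))))
    rw [show (1 + x ^ 2) * dsech a x =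
      4 * (a * ((1 + x ^ 2) * (x ^ 0 * (1 * (1 / Real.cosh (a * x) ^ 2))))) -
      4 * (a ^ 2 * ((1 + x ^ 2) * (x ^ 1 * (Real.tanh (a * x) * (1 / Real.cosh (a * x) ^ 2))))) by
        rw [dsech]; ring]
    rw [abs_le]; constructor <;> linarith [k0.1, k0.2, k1.1, k1.2]
  · have k0 := abs_le.1 (hk a ha.1 x 0 1 (by norm_num) hone)
    have k1 := abs_le.1 (hm1 ha (hk a ha.1 x 1 _ (by norm_num) (abs_tanh_le (a * x))))
    have k2 := abs_le.1 (hm2 ha (hk a ha.1 x 2 _ (by norm_num) (hs1 (a * x))))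
    have k3 := abs_le.1 (hm2 ha (hk a ha.1 x 2 _ (by norm_num) (ht (a * x))))
    rw [abs_le]; constructor <;> nlinarith [k0.1, k0.2, k1.1, k1.2, k2.1, k2.2, k3.1, k3.2]
  · exact (hasDerivAt_sechA_amp a x).const_mul _
  · refine HasDerivAt.const_mul (1 + x ^ 2) ?_
    have e1 := ((hasDerivAt_id a).const_mul 4).mul (hasDerivAt_sechSq_amp a x)
    have e2 := (((hasDerivAt_id a).pow 2).const_mul 4).mul
      ((((hasDerivAt_tanh_amp a x).const_mul x)).mul (hasDerivAt_sechSq_amp a x))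
    refine (e1.sub e2).congr_deriv ?_
    simp only [id, Pi.mul_apply, Pi.pow_apply]
    push_cast
    ring

theorem mulB_weightL_ae {g : ℝ →ᵇ ℝ} {f : ℝ → ℝ} (h : ∀ x, g x = (1 + x ^ 2) * f x) :
    mulB (fstB g) weightL =ᵐ[volume] fun q => f q.1 := by
  filter_upwards [mulB_ae (fstB g) weightL, weightL_ae] with q h1 h2
  rw [h1, h2, fstB_apply, h, weight]
  have : 1 + q.1 ^ 2 ≠ 0 := by positivity
  field_simp

/-- The solitons form a `C¹` family in `L²`. -/
theorem exists_soliton_family {a₀ : ℝ} (h : 0 < a₀) :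
    ∃ (σ : ℝ → L2Cyl) (p : L2Cyl), ContDiffAt ℝ 1 σ a₀ ∧ HasDerivAt σ p a₀ ∧
      (∀ᶠ a in 𝓝 a₀, σ a =ᵐ[volume] fun q => 2 * sechA a q.1) ∧ inner ℝ p (eta h) ≠ 0 ∧
      ∃ C : ℝ, ∀ s t, s ≤ t → |inner ℝ (strip s t) p| ≤ C := by
  obtain ⟨G, G1, e0, e1, hd, hG⟩ := exists_weighted_family h
  have hmem : Set.Ioo (a₀ / 2) (2 * a₀) ∈ 𝓝 a₀ := Ioo_mem_nhds (by linarith) (by linarith)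
  have ha₀ : a₀ ∈ Set.Icc (a₀ / 2) (2 * a₀) := ⟨by linarith, by linarith⟩
  -- The soliton is (1 + x²) times itself, a C¹ family in the sup norm, multiplied by the fixed L²
  -- function (1 + x²)⁻¹. The continuous linear map T transfers differentiability to L².
  let T : (ℝ →ᵇ ℝ) →L[ℝ] L2Cyl := (mulB.flip weightL).comp fstL
  have hT : ∀ g, T g = mulB (fstB g) weightL := fun g => rfl
  have hp : T (G1 a₀) =ᵐ[volume] fun q => dsech a₀ q.1 := mulB_weightL_ae (e1 a₀ ha₀)
  refine ⟨fun a => T (G a), T (G1 a₀), T.contDiff.contDiffAt.comp a₀ (hG.contDiffAt hmem),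
    T.hasFDerivAt.comp_hasDerivAt a₀ (hd a₀ (mem_of_mem_nhds hmem)), ?_, ?_, ?_⟩
  · filter_upwards [hmem] with a ha
    exact mulB_weightL_ae (e0 a (Set.Ioo_subset_Icc_self ha))
  · have : inner ℝ (T (G1 a₀)) (eta h) = 2 * Real.pi * ∫ x, dsech a₀ x * sechA a₀ x := by
      rw [← integral_fst fun x => dsech a₀ x * sechA a₀ x, L2.inner_def]
      refine integral_congr_ae ?_
      filter_upwards [hp, eta_ae h] with q h1 h2
      rw [h1, h2]; simp [mul_comm]
    rw [this]
    exact (mul_pos Real.two_pi_pos (integral_dsech_mul_pos h)).ne'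
  -- The derivative p is dominated by an integrable weight, so its integrals over strips are bounded
  -- independently of their length. A general L² function has no such bound.
  · refine ⟨2 * Real.pi * ∫ x, ‖G1 a₀‖ * weight x, fun s t hst => ?_⟩
    have hb : ∀ x, |dsech a₀ x| ≤ ‖G1 a₀‖ * weight x := fun x => by
      rw [weight, ← div_eq_mul_inv, le_div_iff₀ (by positivity), mul_comm,
        ← abs_of_pos (by positivity : 0 < 1 + x ^ 2), ← abs_mul, ← e1 a₀ ha₀]
      exact (G1 a₀).norm_coe_le_norm x
    have : inner ℝ (strip s t) (T (G1 a₀)) = 2 * Real.pi * ∫ x in s..t, dsech a₀ x := by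
      rw [inner_strip, ← integral_strip_fst s t hst]
      refine setIntegral_congr_ae (measurableSet_Icc.prod MeasurableSet.univ) ?_
      filter_upwards [hp] with q hq _ using hq
    rw [this, abs_mul, abs_of_pos Real.two_pi_pos]
    refine mul_le_mul_of_nonneg_left ?_ Real.two_pi_pos.le
    rw [intervalIntegral.integral_of_le hst, ← Real.norm_eq_abs]
    refine (norm_integral_le_of_norm_le (integrable_weight.const_mul ‖G1 a₀‖).integrableOn
      (Eventually.of_forall hb)).trans ?_
    exact setIntegral_le_integral (integrable_weight.const_mul _) (Eventually.of_forall fun x =>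
      mul_nonneg (norm_nonneg _) (weight_pos x).le)

/-! ### The Miura transform near the kink -/

theorem kink_eq {a : ℝ} (ha : 0 ≤ a) : kink (2 * a ^ 2) = kinkA a := by
  funext x
  rw [kink, kinkA, mul_div_cancel_left₀ _ two_ne_zero, Real.sqrt_sq ha]

theorem soliton_eq {a : ℝ} (ha : 0 ≤ a) (x : ℝ) : soliton (2 * a ^ 2) x = 2 * sechA a x := by
  rw [soliton, sechA, mul_div_cancel_left₀ _ two_ne_zero, Real.sqrt_sq ha]; ring

/-- With k/2 = a² = Q² + Q', the terms without v reduce to 2Q', which is the soliton. -/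
theorem miuraPlus_eq {a : ℝ} (ha : 0 ≤ a) (v : EnergySpace) (q : Cyl) :
    miuraPlus (2 * a ^ 2) (kink (2 * a ^ 2)) v q =
      2 * sechA a q.1 + v.dx q + v.dxInvDy q - 2 * kinkA a q.1 * v.fn q - v.fn q ^ 2 := by
  rw [miuraPlus, kink_eq ha, (hasDerivAt_kinkA a q.1).deriv, mul_div_cancel_left₀ _ two_ne_zero,
    ← kinkA_sq_add a q.1]
  ring

/-- The difference of the Miura transform and of the soliton, as an element of `L²`. -/
def miuraF (σ : ℝ → L2Cyl) (a₀ : ℝ) (x : ℝ × EnergySpace) : L2Cyl :=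
  σ x.1 - σ a₀ + linOp x.1 x.2 - mulE x.2 x.2

theorem miuraF_eq_iff {σ : ℝ → L2Cyl} {a₀ : ℝ} (ha₀ : 0 ≤ a₀) {x : ℝ × EnergySpace} (hx : 0 ≤ x.1)
    (h₀ : σ a₀ =ᵐ[volume] fun q => 2 * sechA a₀ q.1)
    (h : σ x.1 =ᵐ[volume] fun q => 2 * sechA x.1 q.1) (u : L2Cyl) :
    miuraF σ a₀ x = u ↔ ∀ᵐ q : Cyl, miuraPlus (2 * x.1 ^ 2) (kink (2 * x.1 ^ 2)) x.2 q =
      soliton (2 * a₀ ^ 2) q.1 + u q := by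
  have hF : (miuraF σ a₀ x : Cyl → ℝ) =ᵐ[volume] fun q =>
      miuraPlus (2 * x.1 ^ 2) (kink (2 * x.1 ^ 2)) x.2 q - soliton (2 * a₀ ^ 2) q.1 := by
    filter_upwards [h₀, h, Lp.coeFn_sub (σ x.1 - σ a₀ + linOp x.1 x.2) (mulE x.2 x.2),
      Lp.coeFn_add (σ x.1 - σ a₀) (linOp x.1 x.2), Lp.coeFn_sub (σ x.1) (σ a₀),
      Lp.coeFn_sub (x.2.dx + x.2.dxInvDy) ((2 : ℝ) • mulKink x.1 x.2.fn),
      Lp.coeFn_add x.2.dx x.2.dxInvDy, Lp.coeFn_smul (2 : ℝ) (mulKink x.1 x.2.fn),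
      mulB_ae (fstB (kinkB x.1)) x.2.fn, mulE_ae x.2 x.2] with q e1 e2 e3 e4 e5 e6 e7 e8 e9 e10
    rw [miuraF, e3, Pi.sub_apply, e4, Pi.add_apply, e5, Pi.sub_apply, e1, e2, linOp_apply, e6,
      Pi.sub_apply, e7, Pi.add_apply, e8, Pi.smul_apply, e10, miuraPlus_eq hx, soliton_eq ha₀]
    rw [show mulKink x.1 x.2.fn q = kinkA x.1 q.1 * x.2.fn q from e9]
    simp only [smul_eq_mul]; ring
  constructor
  · rintro rfl
    filter_upwards [hF] with q e
    rw [e]; ring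
  · intro hu
    refine Lp.ext ?_
    filter_upwards [hF, hu] with q e1 e2
    rw [e1, e2]; ring

/-! ### Quadratic maps with a parameter and the inverse function theorem -/

section Abstract

variable {E H M : Type*} [NormedAddCommGroup E] [NormedSpace ℝ E] [NormedAddCommGroup H]
  [NormedSpace ℝ H] [NormedAddCommGroup M] [NormedSpace ℝ M]

/-- A family of quadratic maps depending smoothly on a real parameter is `C¹`. -/
theorem contDiffAt_quadratic {σ : ℝ → H} {K : ℝ → M} {a₀ : ℝ} (hσ : ContDiffAt ℝ 1 σ a₀)
    (hK : ContDiffAt ℝ 1 K a₀) (s : H) (A f : E →L[ℝ] H) (m : M →L[ℝ] H →L[ℝ] H)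
    (e : E →L[ℝ] E →L[ℝ] H) :
    ContDiffAt ℝ 1 (fun x : ℝ × E => σ x.1 - s + (A x.2 - (2 : ℝ) • m (K x.1) (f x.2)) - e x.2 x.2)
      (a₀, 0) := by
  have h1 : ContDiffAt ℝ 1 (fun x : ℝ × E => σ x.1) (a₀, 0) :=
    hσ.comp (a₀, (0 : E)) contDiffAt_fst
  have h2 : ContDiffAt ℝ 1 (fun x : ℝ × E => m (K x.1)) (a₀, 0) :=
    m.contDiff.contDiffAt.comp (a₀, (0 : E)) (hK.comp (a₀, (0 : E)) contDiffAt_fst)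
  have h3 : ∀ B : E →L[ℝ] H, ContDiffAt ℝ 1 (fun x : ℝ × E => B x.2) (a₀, 0) := fun B =>
    B.contDiff.contDiffAt.comp (a₀, (0 : E)) contDiffAt_snd
  have h4 : ContDiffAt ℝ 1 (fun x : ℝ × E => e x.2) (a₀, 0) :=
    e.contDiff.contDiffAt.comp (a₀, (0 : E)) contDiffAt_snd
  exact ((h1.sub contDiffAt_const).add ((h3 A).sub
    (contDiffAt_const.smul (h2.clm_apply (h3 f))))).sub (h4.clm_apply contDiffAt_snd)

/-- At v = 0 the quadratic term has zero derivative, and the derivative of K does not contribute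
because it multiplies f 0 = 0. -/
theorem hasFDerivAt_quadratic {σ : ℝ → H} {K : ℝ → M} {a₀ : ℝ} {p : H} (hσ : HasDerivAt σ p a₀)
    (hK : ContDiffAt ℝ 1 K a₀) (s : H) (A f : E →L[ℝ] H) (m : M →L[ℝ] H →L[ℝ] H)
    (e : E →L[ℝ] E →L[ℝ] H) :
    HasFDerivAt (fun x : ℝ × E => σ x.1 - s + (A x.2 - (2 : ℝ) • m (K x.1) (f x.2)) - e x.2 x.2)
      ((ContinuousLinearMap.toSpanSingleton ℝ p).coprod (A - (2 : ℝ) • (m (K a₀)).comp f))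
      (a₀, 0) := by
  have h1 : HasFDerivAt (fun x : ℝ × E => σ x.1)
      ((ContinuousLinearMap.toSpanSingleton ℝ p).comp (ContinuousLinearMap.fst ℝ ℝ E))
      (a₀, 0) := hσ.hasFDerivAt.comp (a₀, (0 : E)) hasFDerivAt_fst
  have h2 : ContDiffAt ℝ 1 (fun x : ℝ × E => m (K x.1)) (a₀, 0) :=
    m.contDiff.contDiffAt.comp (a₀, (0 : E)) (hK.comp (a₀, (0 : E)) contDiffAt_fst)
  have h3 : ∀ A : E →L[ℝ] H, HasFDerivAt (fun x : ℝ × E => A x.2)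
      (A.comp (ContinuousLinearMap.snd ℝ ℝ E)) (a₀, 0) := fun A =>
    A.hasFDerivAt.comp (a₀, (0 : E)) hasFDerivAt_snd
  have h4 := (h2.differentiableAt one_ne_zero).hasFDerivAt.clm_apply (h3 f)
  have h5 : HasFDerivAt (fun x : ℝ × E => e x.2)
      (e.comp (ContinuousLinearMap.snd ℝ ℝ E)) (a₀, 0) :=
    e.hasFDerivAt.comp (a₀, (0 : E)) hasFDerivAt_snd
  have h6 := h5.clm_apply (hasFDerivAt_snd (𝕜 := ℝ) (p := (a₀, (0 : E))))
  have h7 := ((h1.sub (hasFDerivAt_const s _)).add ((h3 A).sub (h4.const_smul (2 : ℝ)))).sub h6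
  refine h7.congr_fderiv (ContinuousLinearMap.ext fun x => ?_)
  simp

/-- The inverse function theorem, with balls. -/
theorem exists_inverse_ball [CompleteSpace E] {F : E → H} {x₀ : E} {F' : E ≃L[ℝ] H}
    (hF : ContDiffAt ℝ 1 F x₀) (hF' : HasFDerivAt F (F' : E →L[ℝ] H) x₀) (hF0 : F x₀ = 0) :
    ∃ (r : ℝ) (g : H → E), 0 < r ∧ ∀ ρ, 0 < ρ → ∃ δ, 0 < δ ∧
      ContDiffOn ℝ 1 g {u | ‖u‖ < δ} ∧ (∀ u, ‖u‖ < δ → dist (g u) x₀ < ρ ∧ F (g u) = u) ∧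
      (∀ u, ‖u‖ < δ → ∀ x, dist x x₀ < r → F x = u → x = g u) := by
  let e := hF.toOpenPartialHomeomorph F hF' one_ne_zero
  have he : ∀ x, e x = F x := fun x => rfl
  have hs : x₀ ∈ e.source := hF.mem_toOpenPartialHomeomorph_source hF' one_ne_zero
  have ht : (0 : H) ∈ e.target := by
    have := e.map_source hs
    rwa [he, hF0] at this
  have h0 : e.symm 0 = x₀ := by
    have := e.left_inv hs
    rwa [he, hF0] at this
  have hC : ContDiffAt ℝ 1 e.symm 0 := by
    have := hF.to_localInverse hF' one_ne_zero
    rwa [hF0] at this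
  -- The uniqueness radius r is fixed before the precision ρ: a priori smallness can first be
  -- established at scale r, and existence can still be sharpened to any ρ.
  obtain ⟨r, hr, hrs⟩ := Metric.isOpen_iff.1 e.open_source _ hs
  refine ⟨r, e.symm, hr, fun ρ hρ => ?_⟩
  have hcont : Tendsto e.symm (𝓝 0) (𝓝 x₀) := by
    have := hC.continuousAt.tendsto
    rwa [h0] at this
  have hev : ∀ᶠ u in 𝓝 (0 : H), ContDiffAt ℝ 1 e.symm u ∧ dist (e.symm u) x₀ < ρ ∧
      u ∈ e.target :=
    (hC.eventually (by simp)).and ((hcont.eventually (Metric.ball_mem_nhds _ hρ)).and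
      (e.open_target.mem_nhds ht))
  obtain ⟨δ, hδ, hb⟩ := Metric.eventually_nhds_iff.1 hev
  simp only [dist_zero_right] at hb
  refine ⟨δ, hδ, fun u hu => (hb hu).1.contDiffWithinAt, fun u hu => ⟨(hb hu).2.1, ?_⟩,
    fun u hu x hx hxu => ?_⟩
  · rw [← he]; exact e.right_inv (hb hu).2.2
  · rw [← hxu, ← he]; exact (e.left_inv (hrs hx)).symm

end Abstract

theorem miuraF_eq (σ : ℝ → L2Cyl) (a₀ : ℝ) : miuraF σ a₀ = fun x => σ x.1 - σ a₀ +
    ((EnergySpace.dxL + EnergySpace.dxInvDyL) x.2 - (2 : ℝ) •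
      (mulB.comp fstL) (kinkB x.1) (EnergySpace.fnL x.2)) - mulE x.2 x.2 := rfl

/-- Local solvability: the inverse function theorem at the kink. -/
theorem exists_local_inverse {σ : ℝ → L2Cyl} {a₀ : ℝ} {p : L2Cyl} (ha₀ : 0 < a₀)
    (hσ : ContDiffAt ℝ 1 σ a₀) (hp : HasDerivAt σ p a₀) (hη : inner ℝ p (eta ha₀) ≠ 0) :
    ∃ (r : ℝ) (g : L2Cyl → ℝ × EnergySpace), 0 < r ∧ ∀ ρ, 0 < ρ → ∃ δ, 0 < δ ∧
      ContDiffOn ℝ 1 g {u | ‖u‖ < δ} ∧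
      (∀ u, ‖u‖ < δ → dist (g u) (a₀, 0) < ρ ∧ miuraF σ a₀ (g u) = u) ∧
      (∀ u, ‖u‖ < δ → ∀ x, dist x (a₀, 0) < r → miuraF σ a₀ x = u → x = g u) := by
  refine exists_inverse_ball (F' := augEquiv ha₀ hη) ?_ ?_ (by simp [miuraF])
  · rw [miuraF_eq]
    exact contDiffAt_quadratic hσ (contDiffAt_kinkB ha₀) _ _ _ _ _
  · rw [miuraF_eq]
    exact hasFDerivAt_quadratic hp (contDiffAt_kinkB ha₀) _ _ _ _ _

/-! ### The exponential of an antiderivative -/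

/-- The data describing an `x`-antiderivative of `v`: the continuous zero mode `z`, and the bounded
antiderivative `V` of the remaining modes as a uniform limit of trigonometric potentials. -/
structure Antiderivative (v : EnergySpace) where
  /-- The zero mode. -/
  z : ℝ →ᵇ ℝ
  /-- The zero mode in the energy space. -/
  v₀ : EnergySpace
  /-- The sum of the other modes. -/
  v₁ : EnergySpace
  /-- Approximating coefficients. -/
  Θ : ℕ → ℕ →₀ 𝓢(ℝ, ℂ)
  /-- The antiderivative of the sum of the nonzero modes. -/
  V : Cyl →ᵇ ℝ
  split : v = v₀ + v₁
  rep : v₀.fn =ᵐ[volume] fun p => z p.1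
  dxInvDy_eq : v₀.dxInvDy = 0
  mode_eq : mode 0 v₁.fn = 0
  norm_le : ‖v₀‖ ≤ ‖v‖
  norm_z_le : ‖z‖ ≤ ‖v‖
  inner_dx : ∀ a b, a ≤ b → inner ℝ (strip a b) v₀.dx = 2 * Real.pi * (z b - z a)
  tendsto_energy : Tendsto (fun k => trigEnergy (Θ k)) atTop (𝓝 v₁)
  tendsto_potential : Tendsto (fun k => trigPotentialB (Θ k)) atTop (𝓝 V)

theorem exists_antiderivative : ∃ K : ℝ, 0 < K ∧ ∀ v : EnergySpace,
    ∃ P : Antiderivative v, ‖P.V‖ ≤ K * ‖v‖ := by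
  obtain ⟨K, hK, h⟩ := exists_potential_rep
  refine ⟨K, hK, fun v => ?_⟩
  obtain ⟨v₀, v₁, e, h0, h1, n0, n1⟩ := exists_split_energy v
  obtain ⟨z, hz, hzn, hd⟩ := exists_zeroMode_rep h0
  obtain ⟨Θ, V, t1, t2, hV⟩ := h v₁ h1
  exact ⟨⟨z, v₀, v₁, Θ, V, e, hz, dxInvDy_eq_zero_of_isZeroMode h0, h1, n0, hzn.trans n0, hd, t1, t2⟩,
    hV.trans (mul_le_mul_of_nonneg_left n1 hK.le)⟩

theorem tendsto_clm₂_apply {E F G : Type*} [NormedAddCommGroup E] [NormedSpace ℝ E]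
    [NormedAddCommGroup F] [NormedSpace ℝ F] [NormedAddCommGroup G] [NormedSpace ℝ G]
    (B : E →L[ℝ] F →L[ℝ] G) {ι : Type*} {l : Filter ι} {f : ι → E} {u : ι → F} {f₀ : E} {u₀ : F}
    (hf : Tendsto f l (𝓝 f₀)) (hu : Tendsto u l (𝓝 u₀)) :
    Tendsto (fun k => B (f k) (u k)) l (𝓝 (B f₀ u₀)) :=
  (B.continuous₂.tendsto (f₀, u₀)).comp (hf.prodMk_nhds hu)

namespace Antiderivative

variable {v : EnergySpace} (P : Antiderivative v)

/-- The antiderivative of the zero mode. -/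
def V₀ (x : ℝ) : ℝ := ∫ s in (0 : ℝ)..x, P.z s

theorem hasDerivAt_V₀ (x : ℝ) : HasDerivAt P.V₀ (P.z x) x :=
  intervalIntegral.integral_hasDerivAt_right (P.z.continuous.intervalIntegrable _ _)
    (P.z.continuous.stronglyMeasurableAtFilter _ _) P.z.continuous.continuousAt

theorem continuous_V₀ : Continuous P.V₀ :=
  continuous_iff_continuousAt.2 fun x => (P.hasDerivAt_V₀ x).continuousAt

theorem inner_strip_v₀ {a b : ℝ} (h : a ≤ b) :
    inner ℝ (strip a b) P.v₀.fn = 2 * Real.pi * ∫ s in a..b, P.z s := by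
  rw [inner_strip, ← integral_strip_fst a b h]
  refine setIntegral_congr_ae (measurableSet_Icc.prod MeasurableSet.univ) ?_
  filter_upwards [P.rep] with p hp _ using hp

/-- Cauchy–Schwarz on a strip. Consequently the antiderivative of the zero mode grows at most like
√|x| for any v in the energy space. -/
theorem abs_integral_z_le {a b : ℝ} (h : a ≤ b) :
    |∫ s in a..b, P.z s| ≤ ‖v‖ * Real.sqrt (b - a) := by
  have h1 := P.inner_strip_v₀ h
  have h2 := abs_real_inner_le_norm (strip a b) P.v₀.fn
  have h3 : ‖strip a b‖ = Real.sqrt (2 * Real.pi) * Real.sqrt (b - a) := by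
    rw [← Real.sqrt_mul Real.two_pi_pos.le, ← norm_strip a b h, Real.sqrt_sq (norm_nonneg _)]
  have h4 : ‖P.v₀.fn‖ ≤ ‖v‖ := P.v₀.norm_fn_le.trans P.norm_le
  rw [h1, h3, abs_mul, abs_of_pos Real.two_pi_pos] at h2
  have h5 : Real.sqrt (2 * Real.pi) * Real.sqrt (2 * Real.pi) = 2 * Real.pi :=
    Real.mul_self_sqrt Real.two_pi_pos.le
  have h6 : 1 ≤ Real.sqrt (2 * Real.pi) := by
    rw [Real.one_le_sqrt]; nlinarith [Real.pi_gt_three]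
  set s := Real.sqrt (2 * Real.pi)
  have h7 : 0 ≤ Real.sqrt (b - a) := Real.sqrt_nonneg _
  have h8 : s * |∫ s in a..b, P.z s| ≤ Real.sqrt (b - a) * ‖v‖ := by
    have : s * (s * |∫ s in a..b, P.z s|) ≤ s * (Real.sqrt (b - a) * ‖v‖) := by
      rw [← mul_assoc, h5]
      refine h2.trans ?_
      rw [mul_assoc]
      gcongr
    exact le_of_mul_le_mul_left this (by linarith)
  calc |∫ s in a..b, P.z s| ≤ s * |∫ s in a..b, P.z s| := le_mul_of_one_le_left (abs_nonneg _) h6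
    _ ≤ _ := h8.trans_eq (mul_comm _ _)

theorem abs_V₀_le (x : ℝ) : |P.V₀ x| ≤ ‖v‖ * Real.sqrt |x| := by
  rcases le_total 0 x with h | h
  · have := P.abs_integral_z_le h
    rw [sub_zero] at this
    rw [abs_of_nonneg h]; exact this
  · have := P.abs_integral_z_le h
    rw [V₀, intervalIntegral.integral_symm, abs_neg, abs_of_nonpos h]
    rwa [zero_sub] at this

/-- `e^{-V₀(x)} Re (θ(x) e^{iny})`. -/
def tw (n : ℤ) (θ : ℝ → ℂ) (p : Cyl) : ℝ := Real.exp (-P.V₀ p.1) * wave n θ p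

/-- Admissible test functions. -/
structure Adm (θ : ℝ → ℂ) : Prop where
  cont : Continuous θ
  bound : ∃ C : ℝ, ∀ x, Real.exp (-P.V₀ x) * ‖θ x‖ ≤ C * weight x

variable {P} {θ θ' : ℝ → ℂ} (n : ℤ)

theorem continuous_tw (h : P.Adm θ) : Continuous (P.tw n θ) := by
  have h1 := P.continuous_V₀
  have h2 := continuous_wave n h.cont
  unfold tw
  fun_prop

theorem Adm.exists_bound (h : P.Adm θ) : ∃ C : ℝ, 0 ≤ C ∧ ∀ p, |P.tw n θ p| ≤ C * weight p.1 := by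
  obtain ⟨C, hC⟩ := h.bound
  have h0 : 0 ≤ C := by
    have h1 : 0 ≤ Real.exp (-P.V₀ 0) * ‖θ 0‖ := by positivity
    exact nonneg_of_mul_nonneg_left (h1.trans (hC 0)) (weight_pos 0)
  refine ⟨C, h0, fun p => le_trans ?_ (hC p.1)⟩
  rw [tw, abs_mul, Real.abs_exp]
  exact mul_le_mul_of_nonneg_left (abs_wave_le _ _ _) (Real.exp_pos _).le

theorem integrable_weight_fst : Integrable fun p : Cyl => weight p.1 :=
  Integrable.comp_fst integrable_weight (volume : Measure Torus)

theorem Adm.memLp (h : P.Adm θ) : MemLp (P.tw n θ) 2 := by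
  obtain ⟨C, -, hC⟩ := h.exists_bound n
  exact ((memLp_fst memLp_weight).const_mul C).mono (continuous_tw n h).aestronglyMeasurable
    (Eventually.of_forall fun p => (hC p).trans (le_abs_self _))

theorem Adm.integrable (h : P.Adm θ) : Integrable (P.tw n θ) := by
  obtain ⟨C, -, hC⟩ := h.exists_bound n
  exact (integrable_weight_fst.const_mul C).mono' (continuous_tw n h).aestronglyMeasurable
    (Eventually.of_forall hC)

theorem Adm.bounded (h : P.Adm θ) : ∃ C : ℝ, ∀ p, ‖P.tw n θ p‖ ≤ C := by
  obtain ⟨C, h0, hC⟩ := h.exists_bound n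
  exact ⟨C, fun p => (hC p).trans (mul_le_of_le_one_right h0 (weight_le_one _))⟩

/-- The test function in `L²`. -/
def Adm.toL (h : P.Adm θ) : L2Cyl := (h.memLp n).toLp _

theorem Adm.toL_ae (h : P.Adm θ) : h.toL n =ᵐ[volume] P.tw n θ := MemLp.coeFn_toLp _

/-- The test function as a bounded continuous function. -/
def Adm.toB (h : P.Adm θ) : Cyl →ᵇ ℝ :=
  BoundedContinuousFunction.ofNormedAddCommGroup (P.tw n θ) (continuous_tw n h)
    (h.bounded n).choose (h.bounded n).choose_spec

theorem Adm.const_mul (h : P.Adm θ) (c : ℂ) : P.Adm fun x => c * θ x := by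
  obtain ⟨C, hC⟩ := h.bound
  refine ⟨continuous_const.mul h.cont, ‖c‖ * C, fun x => ?_⟩
  rw [norm_mul, mul_left_comm, mul_assoc]
  exact mul_le_mul_of_nonneg_left (hC x) (norm_nonneg c)

variable (P)

/-- The approximations of `e^{-V}`. -/
def R (k : ℕ) : Cyl →ᵇ ℝ := expNeg (trigPotentialB (P.Θ k))

theorem R_apply (k : ℕ) (p : Cyl) : P.R k p = Real.exp (-trigPotential (P.Θ k) p) := rfl

theorem tendsto_R : Tendsto P.R atTop (𝓝 (expNeg P.V)) := tendsto_expNeg P.tendsto_potential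

/-- The approximations of `v`. -/
def w (k : ℕ) : EnergySpace := P.v₀ + trigEnergy (P.Θ k)

theorem tendsto_w : Tendsto P.w atTop (𝓝 v) := by
  have := P.tendsto_energy.const_add P.v₀
  rwa [← P.split] at this

theorem w_fn_ae (k : ℕ) : (P.w k).fn =ᵐ[volume] fun p => P.z p.1 + trigX (P.Θ k) p := by
  filter_upwards [Lp.coeFn_add P.v₀.fn (trigEnergy (P.Θ k)).fn, P.rep, trigEnergy_fn_ae (P.Θ k)]
    with p h1 h2 h3
  rw [← h2, ← h3]; exact h1

theorem w_dxInvDy_ae (k : ℕ) : (P.w k).dxInvDy =ᵐ[volume] trigY (P.Θ k) := by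
  have : (P.w k).dxInvDy = (trigEnergy (P.Θ k)).dxInvDy := by
    change P.v₀.dxInvDy + (trigEnergy (P.Θ k)).dxInvDy = _
    rw [P.dxInvDy_eq, zero_add]
  rw [this]; exact trigEnergy_dxInvDy_ae _

theorem hasDerivAt_tw (h : ∀ x, HasDerivAt θ (θ' x) x) (x : ℝ) (y : Torus) :
    HasDerivAt (fun x => P.tw n θ (x, y)) (P.tw n θ' (x, y) - P.z x * P.tw n θ (x, y)) x := by
  refine (((P.hasDerivAt_V₀ x).neg.exp).mul (hasDerivAt_wave_fst n (h x) y)).congr_deriv ?_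
  simp only [tw, wave, Pi.neg_apply]; ring

theorem hasDerivAt_R_tw (h : ∀ x, HasDerivAt θ (θ' x) x) (k : ℕ) (x : ℝ) (y : Torus) :
    HasDerivAt (fun x => P.R k (x, y) * P.tw n θ (x, y))
      (P.R k (x, y) * P.tw n θ' (x, y) -
        P.R k (x, y) * ((P.z x + trigX (P.Θ k) (x, y)) * P.tw n θ (x, y))) x := by
  simp only [R_apply]
  refine (((hasDerivAt_trigPotential (P.Θ k) x y).neg.exp).mul (P.hasDerivAt_tw n h x y)).congr_deriv ?_
  simp only [Pi.neg_apply]; ring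

theorem hasDerivAt_R_tw_snd (k : ℕ) (x t : ℝ) :
    HasDerivAt (fun t : ℝ => P.R k (x, (t : Torus)) * P.tw n θ (x, (t : Torus)))
      (P.R k (x, (t : Torus)) * P.tw n (fun x => Complex.I * n * θ x) (x, (t : Torus)) -
        P.R k (x, (t : Torus)) * (trigY (P.Θ k) (x, (t : Torus)) * P.tw n θ (x, (t : Torus)))) t := by
  simp only [R_apply]
  refine (((hasDerivAt_trigPotential_snd (P.Θ k) x t).neg.exp).mul
    ((hasDerivAt_wave_snd n θ x t).const_mul (Real.exp (-P.V₀ x)))).congr_deriv ?_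
  simp only [tw, Pi.neg_apply]; ring

theorem bound_z_add (k : ℕ) : ∃ C, ∀ p : Cyl, |P.z p.1 + trigX (P.Θ k) p| ≤ C := by
  obtain ⟨C, hC⟩ : ∃ C, ∀ p, |trigX (P.Θ k) p| ≤ C := bound_trigSum _ _
  exact ⟨‖P.z‖ + C, fun p => (abs_add_le _ _).trans (add_le_add (P.z.norm_coe_le_norm _) (hC p))⟩

theorem continuous_z_add (k : ℕ) : Continuous fun p : Cyl => P.z p.1 + trigX (P.Θ k) p :=
  (P.z.continuous.comp continuous_fst).add (continuous_trigSum _ _)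

theorem integrable_R_mul (k : ℕ) {f : Cyl → ℝ} (hf : Integrable f) :
    Integrable fun p => P.R k p * f p :=
  hf.bdd_mul (P.R k).continuous.aestronglyMeasurable
    (Eventually.of_forall (P.R k).norm_coe_le_norm)

theorem inner_mulB_toL (h : P.Adm θ) (f : Cyl →ᵇ ℝ) {u : L2Cyl} {g : Cyl → ℝ}
    (hu : u =ᵐ[volume] g) :
    inner ℝ u (mulB f (h.toL n)) = ∫ p, f p * (g p * P.tw n θ p) := by
  rw [L2.inner_def]
  refine integral_congr_ae ?_
  filter_upwards [mulB_ae f (h.toL n), h.toL_ae n, hu] with p h1 h2 h3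
  rw [h1, h2, h3]; simp only [RCLike.inner_apply, conj_trivial]; ring

theorem tendsto_inner_mulB {u : ℕ → L2Cyl} {u' : L2Cyl} (hu : Tendsto u atTop (𝓝 u')) (a : L2Cyl) :
    Tendsto (fun k => inner ℝ (u k) (mulB (P.R k) a)) atTop (𝓝 (inner ℝ u' (mulB (expNeg P.V) a))) :=
  hu.inner ((mulB.flip a).continuous.tendsto _ |>.comp P.tendsto_R)

/-- `∫ v e^{-V} χ = ∫ e^{-V} ∂_x χ`. -/
theorem inner_fn (h : ∀ x, HasDerivAt θ (θ' x) x) (hθ : P.Adm θ) (hθ' : P.Adm θ') :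
    inner ℝ v.fn (mulB (expNeg P.V) (hθ.toL n)) = ∫ p, expNeg P.V p * P.tw n θ' p := by
  have h1 := P.tendsto_inner_mulB ((EnergySpace.fnL.continuous.tendsto v).comp P.tendsto_w)
    (hθ.toL n)
  -- For the smooth approximations the identity is the vanishing integral of an exact x-derivative.
  -- Both sides pass to the limit, since the exponentials converge uniformly and the approximations
  -- of v converge in L².
  refine tendsto_nhds_unique h1 ?_
  refine (tendsto_integral_mul P.tendsto_R (hθ'.integrable n)).congr fun k => ?_
  obtain ⟨C, hC⟩ := P.bound_z_add k
  have i1 := P.integrable_R_mul k (hθ'.integrable n)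
  have i2 : Integrable fun p => P.R k p * ((P.z p.1 + trigX (P.Θ k) p) * P.tw n θ p) :=
    P.integrable_R_mul k ((hθ.integrable n).bdd_mul (P.continuous_z_add k).aestronglyMeasurable
      (Eventually.of_forall hC))
  have h2 := integral_eq_zero_of_hasDerivAt_fst (P.hasDerivAt_R_tw n h k)
    (P.integrable_R_mul k (hθ.integrable n)) (i1.sub i2)
  have h3 := integral_sub i1 i2
  rw [Function.comp_apply, EnergySpace.fnL_apply, P.inner_mulB_toL n hθ _ (P.w_fn_ae k)]
  linarith [h2.symm.trans h3]

/-- `∫ (∂_x⁻¹ ∂_y v) e^{-V} χ = ∫ e^{-V} ∂_y χ`. -/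
theorem inner_dxInvDy (hθ : P.Adm θ) :
    inner ℝ v.dxInvDy (mulB (expNeg P.V) (hθ.toL n)) =
      ∫ p, expNeg P.V p * P.tw n (fun x => Complex.I * n * θ x) p := by
  have hθ' := hθ.const_mul (Complex.I * n)
  have h1 := P.tendsto_inner_mulB ((EnergySpace.dxInvDyL.continuous.tendsto v).comp P.tendsto_w)
    (hθ.toL n)
  refine tendsto_nhds_unique h1 ?_
  refine (tendsto_integral_mul P.tendsto_R (hθ'.integrable n)).congr fun k => ?_
  obtain ⟨C, hC⟩ : ∃ C, ∀ p, |trigY (P.Θ k) p| ≤ C := bound_trigSum _ _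
  have cY : Continuous (trigY (P.Θ k)) := continuous_trigSum _ _
  have i1 := P.integrable_R_mul k (hθ'.integrable n)
  have i2 : Integrable fun p => P.R k p * (trigY (P.Θ k) p * P.tw n θ p) :=
    P.integrable_R_mul k ((hθ.integrable n).bdd_mul cY.aestronglyMeasurable
      (Eventually.of_forall hC))
  have hc : Continuous fun p => P.R k p * P.tw n (fun x => Complex.I * n * θ x) p -
      P.R k p * (trigY (P.Θ k) p * P.tw n θ p) :=
    ((P.R k).continuous.mul (continuous_tw n hθ')).sub
      ((P.R k).continuous.mul (cY.mul (continuous_tw n hθ)))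
  have h2 := integral_eq_zero_of_hasDerivAt_snd (G := fun p => P.R k p * P.tw n θ p)
    (P.hasDerivAt_R_tw_snd (θ := θ) n k) hc (i1.sub i2)
  have h3 := integral_sub i1 i2
  rw [Function.comp_apply, EnergySpace.dxInvDyL_apply, P.inner_mulB_toL n hθ _ (P.w_dxInvDy_ae k)]
  linarith [h2.symm.trans h3]

/-- `∫ ∂_x v R χ = -∫ v R ∂_x χ + ∫ v w R χ` for the approximations `R` and `w`. -/
theorem inner_dx_R (h : ∀ x, HasDerivAt θ (θ' x) x) (hθ : P.Adm θ) (hθ' : P.Adm θ') (k : ℕ) :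
    inner ℝ v.dx (mulB (P.R k) (hθ.toL n)) =
      -(inner ℝ v.fn (mulB (P.R k) (hθ'.toL n)) -
        inner ℝ v.fn (mulB (P.R k * hθ.toB n) (P.w k).fn)) := by
  have e1 := mulB_ae (P.R k) (hθ.toL n)
  have e2 := mulB_ae (P.R k) (hθ'.toL n)
  have e3 := mulB_ae (P.R k * hθ.toB n) (P.w k).fn
  have a1 : mulB (P.R k) (hθ.toL n) =ᵐ[volume] fun p => P.R k p * P.tw n θ p := by
    filter_upwards [e1, hθ.toL_ae n] with p h1 h2
    rw [h1, h2]
  have a2 : (mulB (P.R k) (hθ'.toL n) - mulB (P.R k * hθ.toB n) (P.w k).fn : L2Cyl) =ᵐ[volume]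
      fun p => P.R k p * P.tw n θ' p -
        P.R k p * ((P.z p.1 + trigX (P.Θ k) p) * P.tw n θ p) := by
    filter_upwards [e2, e3, hθ'.toL_ae n, P.w_fn_ae k, Lp.coeFn_sub (mulB (P.R k) (hθ'.toL n))
      (mulB (P.R k * hθ.toB n) (P.w k).fn)] with p h1 h2 h3 h4 h5
    rw [h5, Pi.sub_apply, h1, h2, h3, h4, BoundedContinuousFunction.mul_apply]
    change _ - P.R k p * P.tw n θ p * _ = _
    ring
  have m1 := (Lp.memLp (mulB (P.R k) (hθ.toL n))).ae_eq a1
  have m2 := (Lp.memLp (mulB (P.R k) (hθ'.toL n) - mulB (P.R k * hθ.toB n) (P.w k).fn)).ae_eq a2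
  have h2 := isMultiplier_symDx_of_hasDerivAt (P.hasDerivAt_R_tw n h k) m1 m2
  rw [show m1.toLp _ = mulB (P.R k) (hθ.toL n) from Lp.ext (m1.coeFn_toLp.trans a1.symm),
    show m2.toLp _ = _ from Lp.ext (m2.coeFn_toLp.trans a2.symm)] at h2
  rw [inner_eq_neg_of_symDx v.isMultiplier_dx h2, inner_sub_right]

theorem inner_mulB_toB (hθ : P.Adm θ) :
    inner ℝ v.fn (mulB (expNeg P.V * hθ.toB n) v.fn) =
      inner ℝ (mulE v v) (mulB (expNeg P.V) (hθ.toL n)) := by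
  rw [L2.inner_def, L2.inner_def]
  refine integral_congr_ae ?_
  filter_upwards [mulB_ae (expNeg P.V * hθ.toB n) v.fn, mulB_ae (expNeg P.V) (hθ.toL n),
    hθ.toL_ae n, mulE_ae v v] with p h1 h2 h3 h4
  rw [h1, h2, h3, h4, BoundedContinuousFunction.mul_apply]
  simp only [RCLike.inner_apply, conj_trivial]
  change expNeg P.V p * P.tw n θ p * _ * _ = _
  ring

/-- L² convergence of the approximations suffices for the product of v with them, because the
remaining factor converges in the sup norm. -/
theorem tendsto_inner_mulB_toB (hθ : P.Adm θ) :
    Tendsto (fun k => inner ℝ v.fn (mulB (P.R k * hθ.toB n) (P.w k).fn)) atTop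
      (𝓝 (inner ℝ v.fn (mulB (expNeg P.V * hθ.toB n) v.fn))) := by
  have s1 : Tendsto (fun k => P.R k * hθ.toB n) atTop (𝓝 (expNeg P.V * hθ.toB n)) :=
    P.tendsto_R.mul_const _
  have s2 : Tendsto (fun k => (P.w k).fn) atTop (𝓝 v.fn) :=
    (EnergySpace.fnL.continuous.tendsto v).comp P.tendsto_w
  have s3 := tendsto_clm₂_apply mulB s1 s2
  exact Tendsto.inner tendsto_const_nhds s3

/-- `∫ (∂_x v - v²) e^{-V} χ = -∫ v e^{-V} ∂_x χ`. -/
theorem inner_dx_sub (h : ∀ x, HasDerivAt θ (θ' x) x) (hθ : P.Adm θ) (hθ' : P.Adm θ') :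
    inner ℝ (v.dx - mulE v v) (mulB (expNeg P.V) (hθ.toL n)) =
      -inner ℝ v.fn (mulB (expNeg P.V) (hθ'.toL n)) := by
  have t1 := P.tendsto_inner_mulB (tendsto_const_nhds (x := v.dx)) (hθ.toL n)
  have t2 := P.tendsto_inner_mulB (tendsto_const_nhds (x := v.fn)) (hθ'.toL n)
  have t3 := P.tendsto_inner_mulB_toB n hθ
  have h3 := tendsto_nhds_unique t1 (((t2.sub t3).neg).congr fun k =>
    (P.inner_dx_R n h hθ hθ' k).symm)
  rw [inner_sub_left, h3, P.inner_mulB_toB n hθ]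
  ring

end Antiderivative

/-! ### The amplitude is controlled by the data -/

/-- The hyperbolic secant of `a x`. -/
def sech (a x : ℝ) : ℝ := 1 / Real.cosh (a * x)

theorem sech_pos (a x : ℝ) : 0 < sech a x := one_div_pos.2 (Real.cosh_pos _)

theorem sech_le_one (a x : ℝ) : sech a x ≤ 1 := by
  rw [sech, div_le_one (Real.cosh_pos _)]; exact Real.one_le_cosh _

theorem hasDerivAt_sech (a x : ℝ) : HasDerivAt (sech a) (-kinkA a x * sech a x) x := by
  have h := ((Real.hasDerivAt_cosh (a * x)).comp x ((hasDerivAt_id x).const_mul a)).inv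
    (Real.cosh_pos _).ne'
  have e : sech a = fun x => (Real.cosh (a * x))⁻¹ := funext fun x => one_div _
  rw [e]
  refine h.congr_deriv ?_
  have := (Real.cosh_pos (a * x)).ne'
  simp only [Function.comp_apply, kinkA, Real.tanh_eq_sinh_div_cosh]
  field_simp

theorem continuous_sech (a : ℝ) : Continuous (sech a) :=
  continuous_iff_continuousAt.2 fun x => (hasDerivAt_sech a x).continuousAt

theorem le_sech {a b x : ℝ} (h : |a * x| ≤ b) : 1 / Real.cosh b ≤ sech a x :=
  one_div_le_one_div_of_le (Real.cosh_pos _) (Real.cosh_le_cosh.2 (h.trans (le_abs_self b)))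

/-- Young's inequality gives M√|x| ≤ M²/(2a) + a|x|/2, so the growth costs half of the exponential
decay of sech; the other half still beats the weight. -/
theorem exists_exp_sqrt_le {a : ℝ} (ha : 0 < a) (M : ℝ) : ∃ C : ℝ, 0 ≤ C ∧ ∀ x,
    Real.exp (M * Real.sqrt |x|) * sech a x ≤ C * weight x := by
  obtain ⟨B, hB, hd⟩ := exists_decay (a₁ := a / 4) (by positivity)
  refine ⟨2 * Real.exp (M ^ 2 / (2 * a)) * B, by positivity, fun x => ?_⟩
  set s := Real.sqrt |x|
  have hs : s ^ 2 = |x| := Real.sq_sqrt (abs_nonneg x)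
  have h1 : M * s ≤ M ^ 2 / (2 * a) + a * |x| / 2 := by
    rw [← hs, div_add_div _ _ (by positivity) two_ne_zero, le_div_iff₀ (by positivity)]
    nlinarith [sq_nonneg (a * s - M)]
  have h2 : sech a x ≤ 2 * Real.exp (-(a * |x|)) := by
    have := exp_abs_le_cosh (a * x)
    rw [abs_mul, abs_of_pos ha] at this
    rw [sech, Real.exp_neg, ← div_eq_mul_inv, div_le_div_iff₀ (Real.cosh_pos _) (Real.exp_pos _)]
    linarith
  have h3 : Real.exp (-(a * |x| / 2)) ≤ B * weight x := by
    have hc : Real.cosh (a / 4 * x) ^ 2 ≤ Real.exp (a * |x| / 2) := by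
      have : Real.cosh (a / 4 * x) ≤ Real.exp (a / 4 * |x|) := by
        rw [← Real.cosh_abs, abs_mul, abs_of_pos (show 0 < a / 4 by positivity), Real.cosh_eq]
        have : Real.exp (-(a / 4 * |x|)) ≤ Real.exp (a / 4 * |x|) :=
          Real.exp_le_exp.2 (by have : 0 ≤ a / 4 * |x| := by positivity
                                linarith)
        linarith
      calc _ ≤ Real.exp (a / 4 * |x|) ^ 2 := by
            have := Real.cosh_pos (a / 4 * x)
            gcongr
        _ = _ := by rw [← Real.exp_nat_mul]; congr 1; push_cast; ring
    have h4 := hd (a / 4) le_rfl x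
    have hc0 : 0 < Real.cosh (a / 4 * x) ^ 2 := by have := Real.cosh_pos (a / 4 * x); positivity
    have h5 : Real.exp (-(a * |x| / 2)) ≤ 1 / Real.cosh (a / 4 * x) ^ 2 := by
      rw [Real.exp_neg, ← one_div]
      exact one_div_le_one_div_of_le hc0 hc
    rw [weight, ← div_eq_mul_inv, le_div_iff₀ (by positivity)]
    refine le_trans ?_ h4
    rw [mul_comm]
    refine mul_le_mul ?_ h5 (Real.exp_pos _).le (by positivity)
    have h1 : x ^ 2 = |x| ^ 2 := (sq_abs x).symm
    nlinarith [abs_nonneg x, pow_nonneg (abs_nonneg x) 3, pow_nonneg (abs_nonneg x) 4]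
  calc Real.exp (M * s) * sech a x
      ≤ Real.exp (M ^ 2 / (2 * a) + a * |x| / 2) * (2 * Real.exp (-(a * |x|))) :=
        mul_le_mul (Real.exp_le_exp.2 h1) h2 (sech_pos _ _).le (Real.exp_pos _).le
    _ = 2 * Real.exp (M ^ 2 / (2 * a)) * Real.exp (-(a * |x| / 2)) := by
        rw [mul_left_comm, ← Real.exp_add, mul_assoc, ← Real.exp_add]; congr 2; ring
    _ ≤ _ := by rw [mul_assoc _ B]; gcongr

namespace Antiderivative

variable {v : EnergySpace} (P : Antiderivative v)

theorem exp_neg_V₀_le {M : ℝ} (hM : ‖v‖ ≤ M) (x : ℝ) :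
    Real.exp (-P.V₀ x) ≤ Real.exp (M * Real.sqrt |x|) := by
  refine Real.exp_le_exp.2 ((neg_le_abs _).trans ((P.abs_V₀_le x).trans ?_))
  exact mul_le_mul_of_nonneg_right hM (Real.sqrt_nonneg _)

/-- The decay of sech absorbs the possible growth of e^{-V₀}, of order e^{‖v‖√|x|}. Such test
functions therefore work before V₀ is known to be bounded. -/
theorem adm_of_le_sech {a : ℝ} (ha : 0 < a) {f : ℝ → ℂ} (hf : Continuous f) {B : ℝ}
    (h : ∀ x, ‖f x‖ ≤ B * sech a x) : P.Adm f := by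
  obtain ⟨C, -, hC⟩ := exists_exp_sqrt_le ha ‖v‖
  refine ⟨hf, B * C, fun x => ?_⟩
  have hB : 0 ≤ B := nonneg_of_mul_nonneg_left ((norm_nonneg _).trans (h 0)) (sech_pos _ _)
  calc _ ≤ Real.exp (‖v‖ * Real.sqrt |x|) * (B * sech a x) :=
        mul_le_mul (P.exp_neg_V₀_le le_rfl x) (h x) (norm_nonneg _) (Real.exp_pos _).le
    _ = B * (Real.exp (‖v‖ * Real.sqrt |x|) * sech a x) := by ring
    _ ≤ _ := by rw [mul_assoc]; exact mul_le_mul_of_nonneg_left (hC x) hB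

theorem tw_zero (f : ℝ → ℝ) (p : Cyl) :
    P.tw 0 (fun x => (f x : ℂ)) p = Real.exp (-P.V₀ p.1) * f p.1 := by
  simp [tw, wave]

theorem tw_zero_of_zero (θ : ℝ → ℂ) (p : Cyl) :
    P.tw 0 (fun x => Complex.I * (0 : ℤ) * θ x) p = 0 := by
  simp [tw, wave]

/-- The integral identity that determines the amplitude. -/
theorem amplitude_identity {a a₀ : ℝ} (ha₀ : 0 < a₀) {s u : L2Cyl}
    (hs : s =ᵐ[volume] fun q => 2 * sechA a₀ q.1 - 2 * sechA a q.1)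
    (h : linOp a v - mulE v v = s + u) :
    ∃ hm : P.Adm (fun x => ((sech a x * sech a₀ x : ℝ) : ℂ)),
      (a ^ 2 - a₀ ^ 2) * (∫ p, expNeg P.V p * P.tw 0 (fun x => ((sech a x * sech a₀ x : ℝ) : ℂ)) p) =
        inner ℝ u (mulB (expNeg P.V) (hm.toL 0)) := by
  -- Here m' = -(Q_a + Q_{a₀})m, so adding 2Q_a m from the linearization leaves (Q_a - Q_{a₀})m. The
  -- derivative of that, by the Riccati equations, is (2S_a - 2S_{a₀} - (a² - a₀²))m, and its first
  -- part cancels against the source s.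
  set m : ℝ → ℝ := fun x => sech a x * sech a₀ x with hm
  have hmc : Continuous m := (continuous_sech a).mul (continuous_sech a₀)
  have hm0 : ∀ x, |m x| ≤ sech a₀ x := fun x => by
    rw [hm, abs_of_pos (mul_pos (sech_pos _ _) (sech_pos _ _))]
    exact mul_le_of_le_one_left (sech_pos _ _).le (sech_le_one _ _)
  have hadm : ∀ (f : ℝ → ℝ) (B : ℝ), Continuous f → (∀ x, |f x| ≤ B) →
      P.Adm (fun x => ((f x * m x : ℝ) : ℂ)) := fun f B hf hB => by
    refine P.adm_of_le_sech ha₀ (B := B) (Complex.continuous_ofReal.comp (hf.mul hmc)) fun x => ?_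
    rw [Complex.norm_real, norm_mul]
    exact mul_le_mul (hB x) (hm0 x) (abs_nonneg _) ((abs_nonneg _).trans (hB x))
  have kb : ∀ x, |kinkA a x| ≤ |a| := abs_kinkA_le a
  have kb₀ : ∀ x, |kinkA a₀ x| ≤ |a₀| := abs_kinkA_le a₀
  have c1 := continuous_kinkA a
  have c2 := continuous_kinkA a₀
  have c3 := continuous_sechA a
  have c4 := continuous_sechA a₀
  have A0 : P.Adm (fun x => ((m x : ℝ) : ℂ)) := by
    simpa using hadm (fun _ => 1) 1 continuous_const (by simp)
  have A1 : P.Adm (fun x => ((-(kinkA a x + kinkA a₀ x) * m x : ℝ) : ℂ)) :=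
    hadm (fun x => -(kinkA a x + kinkA a₀ x)) (|a| + |a₀|) (c1.add c2).neg fun x => by
      rw [abs_neg]; exact (abs_add_le _ _).trans (add_le_add (kb x) (kb₀ x))
  have A2 : P.Adm (fun x => (((kinkA a x - kinkA a₀ x) * m x : ℝ) : ℂ)) :=
    hadm (fun x => kinkA a x - kinkA a₀ x) (|a| + |a₀|) (c1.sub c2) fun x =>
      (abs_sub _ _).trans (add_le_add (kb x) (kb₀ x))
  have A3 : P.Adm (fun x => (((2 * sechA a x - 2 * sechA a₀ x - (a ^ 2 - a₀ ^ 2)) * m x : ℝ) : ℂ)) :=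
    hadm (fun x => 2 * sechA a x - 2 * sechA a₀ x - (a ^ 2 - a₀ ^ 2))
      (2 * a ^ 2 + 2 * a₀ ^ 2 + |a ^ 2 - a₀ ^ 2|) (by fun_prop) fun x => by
      refine (abs_sub _ _).trans (add_le_add ((abs_sub _ _).trans (add_le_add ?_ ?_)) le_rfl)
      · rw [abs_mul, abs_two]; linarith [abs_sechA_le a x]
      · rw [abs_mul, abs_two]; linarith [abs_sechA_le a₀ x]
  have d1 : ∀ x, HasDerivAt (fun x => ((m x : ℝ) : ℂ))
      ((-(kinkA a x + kinkA a₀ x) * m x : ℝ) : ℂ) x := fun x => by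
    refine HasDerivAt.ofReal_comp (((hasDerivAt_sech a x).mul (hasDerivAt_sech a₀ x)).congr_deriv ?_)
    simp only [hm]; ring
  have d2 : ∀ x, HasDerivAt (fun x => (((kinkA a x - kinkA a₀ x) * m x : ℝ) : ℂ))
      (((2 * sechA a x - 2 * sechA a₀ x - (a ^ 2 - a₀ ^ 2)) * m x : ℝ) : ℂ) x := fun x => by
    have e := ((hasDerivAt_kinkA a x).sub (hasDerivAt_kinkA a₀ x)).mul
      ((hasDerivAt_sech a x).mul (hasDerivAt_sech a₀ x))
    refine HasDerivAt.ofReal_comp (e.congr_deriv ?_)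
    rw [← kinkA_sq_add a x, ← kinkA_sq_add a₀ x]
    simp only [hm, Pi.sub_apply, Pi.mul_apply]; ring
  refine ⟨A0, ?_⟩
  have t1 := P.inner_fn 0 d2 A2 A3
  have t2 := P.inner_dx_sub 0 d1 A0 A1
  have t3 := P.inner_dxInvDy 0 A0
  have t4 := P.inner_mulB_toL 0 A0 (expNeg P.V) hs
  have z : ∫ p, expNeg P.V p * P.tw 0 (fun x => Complex.I * (0 : ℤ) * ((m x : ℝ) : ℂ)) p = 0 :=
    integral_eq_zero_of_ae (Eventually.of_forall fun p => by
      simp only [P.tw_zero_of_zero, mul_zero, Pi.zero_apply])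
  rw [z] at t3
  -- This is 2Q_a m + m' = (Q_a - Q_{a₀})m, multiplied by e^{-V-V₀}.
  have e1 : (2 : ℝ) • mulKink a (mulB (expNeg P.V) (A0.toL 0)) + mulB (expNeg P.V) (A1.toL 0) =
      mulB (expNeg P.V) (A2.toL 0) := by
    refine Lp.ext ?_
    filter_upwards [Lp.coeFn_add ((2 : ℝ) • mulKink a (mulB (expNeg P.V) (A0.toL 0)))
      (mulB (expNeg P.V) (A1.toL 0)), Lp.coeFn_smul (2 : ℝ) (mulKink a (mulB (expNeg P.V) (A0.toL 0))),
      mulB_ae (fstB (kinkB a)) (mulB (expNeg P.V) (A0.toL 0)), mulB_ae (expNeg P.V) (A0.toL 0),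
      mulB_ae (expNeg P.V) (A1.toL 0), mulB_ae (expNeg P.V) (A2.toL 0), A0.toL_ae 0, A1.toL_ae 0,
      A2.toL_ae 0] with p h1 h2 h3 h4 h5 h6 h7 h8 h9
    rw [h1, Pi.add_apply, h2, Pi.smul_apply, h5, h6, h8, h9, P.tw_zero, P.tw_zero,
      show mulKink a (mulB (expNeg P.V) (A0.toL 0)) p = _ from h3, h4, h7, P.tw_zero]
    change (2 : ℝ) * (kinkA a p.1 * _) + _ = _
    ring
  have e2 : inner ℝ (linOp a v - mulE v v) (mulB (expNeg P.V) (A0.toL 0)) =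
      -inner ℝ v.fn (mulB (expNeg P.V) (A2.toL 0)) := by
    rw [← e1, inner_add_right, inner_smul_right, ← inner_mulKink, linOp_apply,
      show v.dx + v.dxInvDy - (2 : ℝ) • mulKink a v.fn - mulE v v =
        (v.dx - mulE v v) + v.dxInvDy - (2 : ℝ) • mulKink a v.fn by abel, inner_sub_left,
      inner_add_left, t2, t3, real_inner_smul_left]
    ring
  rw [h, inner_add_left, t1, t4] at e2
  have i3 := A3.integrable 0
  have j1 : Integrable fun p => expNeg P.V p * P.tw 0
      (fun x => (((2 * sechA a x - 2 * sechA a₀ x - (a ^ 2 - a₀ ^ 2)) * m x : ℝ) : ℂ)) p :=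
    i3.bdd_mul (expNeg P.V).continuous.aestronglyMeasurable
      (Eventually.of_forall (expNeg P.V).norm_coe_le_norm)
  have j2 : Integrable fun p => expNeg P.V p * P.tw 0 (fun x => ((m x : ℝ) : ℂ)) p :=
    (A0.integrable 0).bdd_mul (expNeg P.V).continuous.aestronglyMeasurable
      (Eventually.of_forall (expNeg P.V).norm_coe_le_norm)
  have e3 : ∫ p, expNeg P.V p * ((2 * sechA a₀ p.1 - 2 * sechA a p.1) *
      P.tw 0 (fun x => ((m x : ℝ) : ℂ)) p) =
      -(∫ p, expNeg P.V p * P.tw 0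
        (fun x => (((2 * sechA a x - 2 * sechA a₀ x - (a ^ 2 - a₀ ^ 2)) * m x : ℝ) : ℂ)) p) -
      (a ^ 2 - a₀ ^ 2) * ∫ p, expNeg P.V p * P.tw 0 (fun x => ((m x : ℝ) : ℂ)) p := by
    have j3 := j1.neg
    have j4 := j2.const_mul (a ^ 2 - a₀ ^ 2)
    rw [← integral_neg, ← integral_const_mul]
    refine Eq.trans ?_ (integral_sub j3 j4)
    refine integral_congr_ae (Eventually.of_forall fun p => ?_)
    simp only [P.tw_zero]
    ring
  linarith

end Antiderivative

/-- The amplitude of a solution is controlled by the data. -/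
theorem exists_amplitude_bound {a₀ : ℝ} (ha₀ : 0 < a₀) {A M : ℝ} (hM : 0 ≤ M) :
    ∃ C : ℝ, 0 ≤ C ∧ ∀ (a : ℝ) (v : EnergySpace) (s u : L2Cyl), 0 < a → a ≤ A → ‖v‖ ≤ M →
      s =ᵐ[volume] (fun q => 2 * sechA a₀ q.1 - 2 * sechA a q.1) →
      linOp a v - mulE v v = s + u → |a ^ 2 - a₀ ^ 2| ≤ C * ‖u‖ := by
  obtain ⟨K, hK, hP⟩ := exists_antiderivative
  obtain ⟨C₀, hC₀, hd⟩ := exists_exp_sqrt_le ha₀ M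
  -- ℓ bounds the integrand from below on |x| ≤ 1, a strip of area 2π·2. The final constant is the
  -- norm of the test function divided by this lower bound of the integral.
  set ℓ : ℝ := Real.exp (-(K * M)) * (Real.exp (-M) * (1 / Real.cosh A * (1 / Real.cosh a₀)))
  have hℓ : 0 < ℓ := by
    have := Real.cosh_pos A
    have := Real.cosh_pos a₀
    positivity
  refine ⟨Real.exp (K * M) * (C₀ * ‖weightL‖) / (2 * Real.pi * (2 * ℓ)), by positivity,
    fun a v s u ha haA hv hs h => ?_⟩
  obtain ⟨P, hPV⟩ := hP v
  have hV : ‖P.V‖ ≤ K * M := hPV.trans (mul_le_mul_of_nonneg_left hv hK.le)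
  obtain ⟨hm, e⟩ := P.amplitude_identity ha₀ hs h
  set m : ℝ → ℝ := fun x => sech a x * sech a₀ x with hm'
  have m0 : ∀ x, 0 < m x := fun x => mul_pos (sech_pos _ _) (sech_pos _ _)
  have hE : ∀ p, Real.exp (-(K * M)) ≤ expNeg P.V p := fun p => by
    rw [expNeg_apply]
    exact Real.exp_le_exp.2 (neg_le_neg ((le_abs_self _).trans ((P.V.norm_coe_le_norm p).trans hV)))
  have upper : ‖mulB (expNeg P.V) (hm.toL 0)‖ ≤ Real.exp (K * M) * (C₀ * ‖weightL‖) := by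
    refine (norm_mulB_le _ _).trans (mul_le_mul ((norm_expNeg_le _).trans (Real.exp_le_exp.2 hV))
      ?_ (norm_nonneg _) (Real.exp_pos _).le)
    refine Lp.norm_le_mul_norm_of_ae_le_mul ?_
    filter_upwards [hm.toL_ae 0, weightL_ae] with p h1 h2
    rw [h1, h2, P.tw_zero, Real.norm_of_nonneg (by have := m0 p.1; positivity),
      Real.norm_of_nonneg (weight_pos _).le]
    refine le_trans ?_ (hd p.1)
    refine mul_le_mul (P.exp_neg_V₀_le hv _) ?_ (m0 _).le (Real.exp_pos _).le
    exact mul_le_of_le_one_left (sech_pos _ _).le (sech_le_one _ _)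
  have hi : Integrable fun p => expNeg P.V p * P.tw 0 (fun x => ((m x : ℝ) : ℂ)) p :=
    (hm.integrable 0).bdd_mul (expNeg P.V).continuous.aestronglyMeasurable
      (Eventually.of_forall (expNeg P.V).norm_coe_le_norm)
  have lower : 2 * Real.pi * (2 * ℓ) ≤
      ∫ p, expNeg P.V p * P.tw 0 (fun x => ((m x : ℝ) : ℂ)) p := by
    have h0 : ∀ p : Cyl, 0 ≤ expNeg P.V p * P.tw 0 (fun x => ((m x : ℝ) : ℂ)) p := fun p => by
      rw [P.tw_zero, expNeg_apply]; have := m0 p.1; positivity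
    have hmeas : MeasurableSet (Set.Icc (-1 : ℝ) 1 ×ˢ (Set.univ : Set Torus)) :=
      measurableSet_Icc.prod MeasurableSet.univ
    have h1 := setIntegral_le_integral (s := Set.Icc (-1 : ℝ) 1 ×ˢ (Set.univ : Set Torus)) hi
      (Eventually.of_forall h0)
    refine le_trans ?_ h1
    have h2 := integral_strip_fst (-1) 1 (by norm_num) fun _ => ℓ
    rw [intervalIntegral.integral_const, smul_eq_mul, show (1 : ℝ) - -1 = 2 by norm_num] at h2
    rw [← h2]
    refine setIntegral_mono_on (integrableOn_const (hs := ?_)) hi.integrableOn hmeas fun p hp => ?_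
    · rw [volume_strip]; exact ENNReal.mul_ne_top ENNReal.ofReal_ne_top ENNReal.ofReal_ne_top
    · have hx : |p.1| ≤ 1 := abs_le.2 hp.1
      have b1 : Real.exp (-M) ≤ Real.exp (-P.V₀ p.1) := by
        refine Real.exp_le_exp.2 (neg_le_neg ((le_abs_self _).trans ((P.abs_V₀_le _).trans ?_)))
        calc ‖v‖ * Real.sqrt |p.1| ≤ M * 1 :=
              mul_le_mul hv (Real.sqrt_le_one.2 hx) (Real.sqrt_nonneg _) hM
          _ = M := mul_one M
      have b2 : 1 / Real.cosh A ≤ sech a p.1 := le_sech (by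
        rw [abs_mul, abs_of_pos ha]
        exact (mul_le_mul haA hx (abs_nonneg _) (ha.le.trans haA)).trans_eq (mul_one A))
      have b3 : 1 / Real.cosh a₀ ≤ sech a₀ p.1 := le_sech (by
        rw [abs_mul, abs_of_pos ha₀]
        exact (mul_le_mul_of_nonneg_left hx ha₀.le).trans_eq (mul_one a₀))
      rw [P.tw_zero]
      have c1 := Real.cosh_pos A
      have c2 := Real.cosh_pos a₀
      have c3 := sech_pos a p.1
      have c4 := hE p
      have c5 : 0 < expNeg P.V p := Real.exp_pos _
      simp only [ℓ, hm']
      gcongr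
  have hpos : 0 < 2 * Real.pi * (2 * ℓ) := by positivity
  rw [div_mul_eq_mul_div, le_div_iff₀ hpos]
  calc |a ^ 2 - a₀ ^ 2| * (2 * Real.pi * (2 * ℓ))
      ≤ |a ^ 2 - a₀ ^ 2| * ∫ p, expNeg P.V p * P.tw 0 (fun x => ((m x : ℝ) : ℂ)) p :=
        mul_le_mul_of_nonneg_left lower (abs_nonneg _)
    _ = |inner ℝ u (mulB (expNeg P.V) (hm.toL 0))| := by
        rw [← e, abs_mul, abs_of_pos (hpos.trans_le lower)]
    _ ≤ ‖u‖ * ‖mulB (expNeg P.V) (hm.toL 0)‖ := abs_real_inner_le_norm _ _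
    _ ≤ ‖u‖ * (Real.exp (K * M) * (C₀ * ‖weightL‖)) :=
        mul_le_mul_of_nonneg_left upper (norm_nonneg _)
    _ = _ := mul_comm _ _

/-! ### Boundedness of the antiderivative of a solution -/

theorem isZeroMode_strip (a b : ℝ) : IsZeroMode (strip a b) := by
  have hg : MemLp ((Set.Icc a b).indicator fun _ => (1 : ℝ)) 2 :=
    memLp_indicator_const 2 measurableSet_Icc 1 (Or.inr (by
      rw [Real.volume_Icc]; exact ENNReal.ofReal_ne_top))
  have e : strip a b = (memLp_fst hg).toLp _ := by
    refine Lp.ext ?_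
    filter_upwards [(memLp_fst hg).coeFn_toLp, indicatorConstLp_coeFn (p := 2) (hs :=
      (measurableSet_Icc.prod MeasurableSet.univ :
        MeasurableSet (Set.Icc a b ×ˢ (Set.univ : Set Torus)))) (hμs := by
          rw [volume_strip]; exact ENNReal.mul_ne_top ENNReal.ofReal_ne_top ENNReal.ofReal_ne_top)
      (c := (1 : ℝ))] with p h1 h2
    rw [h1, strip, h2]
    by_cases h : p.1 ∈ Set.Icc a b
    · rw [Set.indicator_of_mem h, Set.indicator_of_mem (Set.mem_prod.2 ⟨h, Set.mem_univ p.2⟩)]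
    · rw [Set.indicator_of_notMem h, Set.indicator_of_notMem fun hp => h hp.1]
  rw [e]
  exact isZeroMode_fst hg

theorem integrable_mulE_self (v : EnergySpace) : Integrable (mulE v v : Cyl → ℝ) :=
  ((Lp.memLp v.fn).integrable_mul (Lp.memLp v.fn)).congr (mulE_ae v v).symm

/-- The square of an L² function is integrable, so the quadratic source has strip integrals bounded
independently of the strip. -/
theorem abs_inner_strip_mulE_le (a b : ℝ) (v : EnergySpace) :
    |inner ℝ (strip a b) (mulE v v)| ≤ ‖v‖ ^ 2 := by
  have h0 : 0 ≤ᵐ[volume] (mulE v v : Cyl → ℝ) := by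
    filter_upwards [mulE_ae v v] with p hp
    rw [hp]; exact mul_self_nonneg _
  have e : ∫ p, mulE v v p = ‖v.fn‖ ^ 2 := by
    rw [← real_inner_self_eq_norm_sq, L2.inner_def]
    exact integral_congr_ae (mulE_ae v v)
  rw [inner_strip, abs_of_nonneg (integral_nonneg_of_ae (ae_restrict_of_ae h0))]
  refine (setIntegral_le_integral (integrable_mulE_self v) h0).trans ?_
  rw [e]
  exact pow_le_pow_left₀ (norm_nonneg _) v.norm_fn_le 2

namespace Antiderivative

variable {v : EnergySpace} (P : Antiderivative v)

/-- The indicator of a strip has only the zero mode, so only the mean of v in y contributes and the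
term ∂_x⁻¹∂_y v disappears. -/
theorem inner_strip_linOp (a : ℝ) {s t : ℝ} (h : s ≤ t) :
    inner ℝ (strip s t) (linOp a v) =
      2 * Real.pi * (P.z t - P.z s) - 2 * (2 * Real.pi * ∫ x in s..t, kinkA a x * P.z x) := by
  have hS := isZeroMode_strip s t
  have e1 : linOp a v = linOp a P.v₀ + linOp a P.v₁ := by rw [← map_add, ← P.split]
  have e2 : mode 0 (linOp a P.v₁) = 0 := by
    rw [linOp_apply, map_sub, map_add, map_smul, P.v₁.isMultiplier_dx.mode_eq_zero P.mode_eq,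
      mode_zero_dxInvDy, mulKink, mode_mulB_eq_zero _ P.mode_eq]
    simp
  have e3 : inner ℝ (strip s t) (mulKink a P.v₀.fn) =
      2 * Real.pi * ∫ x in s..t, kinkA a x * P.z x := by
    rw [inner_strip, ← integral_strip_fst s t h fun x => kinkA a x * P.z x]
    refine setIntegral_congr_ae (measurableSet_Icc.prod MeasurableSet.univ) ?_
    filter_upwards [P.rep, mulB_ae (fstB (kinkB a)) P.v₀.fn] with p h1 h2 _
    rw [mulKink, h2, h1]; rfl
  rw [e1, inner_add_right, inner_eq_zero_of_modes hS e2, add_zero, linOp_apply, P.dxInvDy_eq,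
    add_zero, inner_sub_right, inner_smul_right, e3, P.inner_dx s t h]

theorem norm_z_apply_le (x : ℝ) : |P.z x| ≤ ‖v‖ := (P.z.norm_coe_le_norm x).trans P.norm_z_le

/-- S is the derivative of Q, which varies by at most 2a in total. -/
theorem abs_integral_of_near {a s t : ℝ} (ha : 0 < a) (h : s ≤ t) {f : ℝ → ℝ}
    (hfs : ∀ x ∈ Set.Ioc s t, |f x| ≤ a⁻¹ ^ 2 * sechA a x) :
    |∫ x in s..t, f x * P.z x| ≤ 2 * a⁻¹ * ‖v‖ := by
  have hint : IntervalIntegrable (fun x => ‖v‖ * (a⁻¹ ^ 2 * sechA a x)) volume s t := by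
    have := continuous_sechA a
    exact (by fun_prop : Continuous fun x => ‖v‖ * (a⁻¹ ^ 2 * sechA a x)).intervalIntegrable _ _
  have h1 : ‖∫ x in s..t, f x * P.z x‖ ≤ ∫ x in s..t, ‖v‖ * (a⁻¹ ^ 2 * sechA a x) := by
    refine intervalIntegral.norm_integral_le_of_norm_le h
      (Eventually.of_forall fun x hx => ?_) hint
    rw [norm_mul, mul_comm]
    exact mul_le_mul (P.norm_z_apply_le x) (hfs x hx) (norm_nonneg _) (norm_nonneg _)
  have h2 : ∫ x in s..t, ‖v‖ * (a⁻¹ ^ 2 * sechA a x) =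
      ‖v‖ * (a⁻¹ ^ 2 * kinkA a t) - ‖v‖ * (a⁻¹ ^ 2 * kinkA a s) :=
    intervalIntegral.integral_eq_sub_of_hasDerivAt (fun x _ =>
      ((hasDerivAt_kinkA a x).const_mul _).const_mul _) hint
  rw [h2] at h1
  refine h1.trans ?_
  have k1 := (abs_le.1 (abs_kinkA_le a t)).2
  have k2 := (abs_le.1 (abs_kinkA_le a s)).1
  rw [abs_of_pos ha] at k1 k2
  rw [← mul_sub, ← mul_sub, mul_comm]
  refine mul_le_mul_of_nonneg_right ?_ (norm_nonneg _)
  calc a⁻¹ ^ 2 * (kinkA a t - kinkA a s) ≤ a⁻¹ ^ 2 * (2 * a) := by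
        gcongr; linarith
    _ = _ := by field_simp

/-- On each half-line, z = ±a⁻¹Qz + (1 - |tanh(ax)|)z. The first part is controlled by hypothesis;
for the second, 1 - |tanh| ≤ 1 - tanh² = a⁻²S, which is integrable. -/
theorem abs_V₀_le_of_kink {a B : ℝ} (ha : 0 < a)
    (hB : ∀ s t, s ≤ t → |∫ x in s..t, kinkA a x * P.z x| ≤ B) (x : ℝ) :
    |P.V₀ x| ≤ a⁻¹ * B + 2 * a⁻¹ * ‖v‖ := by
  have ct := continuous_kinkA a
  have hi : ∀ {f : ℝ → ℝ} (s t : ℝ), Continuous f →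
      IntervalIntegrable (fun x => f x * P.z x) volume s t := fun s t hf =>
    (hf.mul P.z.continuous).intervalIntegrable _ _
  have ksq : ∀ y, (a⁻¹ * kinkA a y) ^ 2 + a⁻¹ ^ 2 * sechA a y = 1 := fun y => by
    rw [mul_pow, ← mul_add, kinkA_sq_add]; field_simp
  have kle : ∀ y, |a⁻¹ * kinkA a y| ≤ 1 := fun y => by
    rw [abs_mul, abs_of_pos (inv_pos.2 ha), inv_mul_le_iff₀ ha, mul_one]
    exact (abs_kinkA_le a y).trans_eq (abs_of_pos ha)
  have hpos : ∀ y, 0 ≤ y → 0 ≤ a⁻¹ * kinkA a y := fun y hy => by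
    have h0 : 0 ≤ Real.tanh (a * y) := by
      rw [Real.tanh_eq_sinh_div_cosh]
      exact div_nonneg (Real.sinh_nonneg_iff.2 (by positivity)) (Real.cosh_pos _).le
    unfold kinkA; positivity
  have hodd : ∀ y, kinkA a (-y) = -kinkA a y := fun y => by simp [kinkA]
  have main : ∀ (ε : ℝ) (s t : ℝ), |ε| = 1 → s ≤ t →
      (∀ y ∈ Set.Ioc s t, 0 ≤ ε * (a⁻¹ * kinkA a y)) →
      |∫ x in s..t, P.z x| ≤ a⁻¹ * B + 2 * a⁻¹ * ‖v‖ := fun ε s t hε hst hs => by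
    have hε2 : ε ^ 2 = 1 := by rw [← sq_abs, hε, one_pow]
    have e : ∫ x in s..t, P.z x = ε * a⁻¹ * (∫ x in s..t, kinkA a x * P.z x) +
        ∫ x in s..t, (1 - ε * (a⁻¹ * kinkA a x)) * P.z x := by
      rw [← intervalIntegral.integral_const_mul, ← intervalIntegral.integral_add
        ((hi s t ct).const_mul _) (hi s t (by fun_prop))]
      refine intervalIntegral.integral_congr fun x _ => ?_
      ring
    have h1 := P.abs_integral_of_near ha hst (f := fun x => 1 - ε * (a⁻¹ * kinkA a x))
      fun y hy => by
        have q0 := hs y hy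
        have q1 := kle y
        have q2 := ksq y
        set T := ε * (a⁻¹ * kinkA a y)
        have q3 : T ^ 2 + a⁻¹ ^ 2 * sechA a y = 1 := by
          rw [← q2, mul_pow, hε2, one_mul]
        have q4 : T ≤ 1 := (le_abs_self _).trans (by rwa [abs_mul, hε, one_mul])
        rw [abs_of_nonneg (by linarith)]
        nlinarith
    rw [e]
    refine (abs_add_le _ _).trans (add_le_add ?_ h1)
    rw [abs_mul, abs_mul, hε, one_mul, abs_of_pos (inv_pos.2 ha)]
    exact mul_le_mul_of_nonneg_left (hB s t hst) (inv_pos.2 ha).le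
  rcases le_total 0 x with h | h
  · exact main 1 0 x (by simp) h fun y hy => by rw [one_mul]; exact hpos y hy.1.le
  · rw [V₀, intervalIntegral.integral_symm, abs_neg]
    refine main (-1) x 0 (by simp) h fun y hy => ?_
    have := hpos (-y) (by linarith [hy.2])
    rw [hodd] at this
    linarith

end Antiderivative

/-- The antiderivative of a solution of the linearized equation with a quadratic source is
bounded. -/
theorem abs_V₀_le_of_linOp_eq {a : ℝ} (ha : 0 < a) {p : L2Cyl} {Cp M : ℝ}
    (hp : ∀ s t, s ≤ t → |inner ℝ (strip s t) p| ≤ Cp) {κ : ℝ} {h w : EnergySpace}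
    (hκ : |κ| ≤ 1) (hh : ‖h‖ ≤ 1) (hw : ‖w‖ ≤ M)
    (e : linOp a w = κ • p + mulE (h + w) (h + w)) (P : Antiderivative w) (x : ℝ) :
    |P.V₀ x| ≤ a⁻¹ * (M + (Cp + (1 + M) ^ 2)) + 2 * a⁻¹ * M := by
  have hM : 0 ≤ M := (norm_nonneg _).trans hw
  refine (P.abs_V₀_le_of_kink ha (B := M + (Cp + (1 + M) ^ 2)) (fun s t hst => ?_) x).trans
    (by gcongr)
  have h1 := P.inner_strip_linOp a hst
  rw [e, inner_add_right, inner_smul_right] at h1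
  have b1 : |κ * inner ℝ (strip s t) p| ≤ Cp := by
    rw [abs_mul]
    exact (mul_le_of_le_one_left (abs_nonneg _) hκ).trans (hp s t hst)
  have b2 : |inner ℝ (strip s t) (mulE (h + w) (h + w))| ≤ (1 + M) ^ 2 :=
    (abs_inner_strip_mulE_le _ _ _).trans (pow_le_pow_left₀ (norm_nonneg _)
      ((norm_add_le _ _).trans (add_le_add hh hw)) 2)
  have b3 := (P.norm_z_apply_le t).trans hw
  have b4 := (P.norm_z_apply_le s).trans hw
  set I := ∫ x in s..t, kinkA a x * P.z x
  rw [abs_le] at b1 b2 b3 b4 ⊢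
  have hpi := Real.pi_gt_three
  set X := κ * inner ℝ (strip s t) p
  set Y := inner ℝ (strip s t) (mulE (h + w) (h + w))
  have hCp : 0 ≤ Cp := (abs_nonneg _).trans (hp 0 0 le_rfl)
  have hN : 0 ≤ Cp + (1 + M) ^ 2 := by positivity
  -- The strip identity solved for ∫ Qz. The values of z are bounded by M, and the strip integrals
  -- of the source by Cp and (1 + M)²; the slack 4π ≥ 1 simplifies the constant.
  have e2 : 4 * Real.pi * I = 2 * Real.pi * (P.z t - P.z s) - (X + Y) := by linarith
  have hN' : Cp + (1 + M) ^ 2 ≤ 4 * Real.pi * (Cp + (1 + M) ^ 2) :=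
    le_mul_of_one_le_left hN (by linarith)
  have hpi0 : 0 < 4 * Real.pi := by linarith
  constructor
  · refine le_of_mul_le_mul_left ?_ hpi0
    rw [e2]
    nlinarith
  · refine le_of_mul_le_mul_left ?_ hpi0
    rw [e2]
    nlinarith

/-! ### The gauge transform of a solution -/

theorem exists_schwartz_le_weight (θ : 𝓢(ℝ, ℂ)) : ∃ C : ℝ, 0 ≤ C ∧ ∀ x, ‖θ x‖ ≤ C * weight x := by
  obtain ⟨C₀, hC₀, h0⟩ := θ.decay 0 0
  obtain ⟨C₂, hC₂, h2⟩ := θ.decay 2 0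
  refine ⟨C₀ + C₂, by positivity, fun x => ?_⟩
  have e0 := h0 x
  have e2 := h2 x
  simp only [norm_iteratedFDeriv_zero, pow_zero, one_mul] at e0 e2
  rw [weight, ← div_eq_mul_inv, le_div_iff₀ (by positivity), mul_add, mul_one, mul_comm _ (x ^ 2)]
  rw [Real.norm_eq_abs, sq_abs] at e2
  exact add_le_add e0 e2

namespace Antiderivative

variable {v : EnergySpace} (P : Antiderivative v) {B : ℝ}

theorem adm_schwartz (hB : ∀ x, |P.V₀ x| ≤ B) (θ : 𝓢(ℝ, ℂ)) : P.Adm θ := by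
  obtain ⟨C, hC, h⟩ := exists_schwartz_le_weight θ
  refine ⟨θ.continuous, Real.exp B * C, fun x => ?_⟩
  rw [mul_assoc]
  exact mul_le_mul (Real.exp_le_exp.2 ((neg_le_abs _).trans (hB x))) (h x) (norm_nonneg _)
    (Real.exp_pos _).le

/-- The weight `e^{-V₀}` of the zero mode. -/
def rho₀ (hB : ∀ x, |P.V₀ x| ≤ B) : ℝ →ᵇ ℝ :=
  BoundedContinuousFunction.ofNormedAddCommGroup (fun x => Real.exp (-P.V₀ x))
    (by have := P.continuous_V₀; fun_prop) (Real.exp B) fun x => by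
      rw [Real.norm_eq_abs, Real.abs_exp]
      exact Real.exp_le_exp.2 ((neg_le_abs _).trans (hB x))

/-- The integrating factor `e^{-∂_x⁻¹ v}`. -/
def rho (hB : ∀ x, |P.V₀ x| ≤ B) : Cyl →ᵇ ℝ := expNeg P.V * fstB (P.rho₀ hB)

theorem rho_apply (hB : ∀ x, |P.V₀ x| ≤ B) (p : Cyl) :
    P.rho hB p = Real.exp (-P.V p) * Real.exp (-P.V₀ p.1) := rfl

theorem norm_rho_le (hB : ∀ x, |P.V₀ x| ≤ B) : ‖P.rho hB‖ ≤ Real.exp (‖P.V‖ + B) := by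
  refine (norm_mul_le _ _).trans ?_
  rw [Real.exp_add]
  exact mul_le_mul (norm_expNeg_le _) ((norm_fstB_le _).trans
    (BoundedContinuousFunction.norm_ofNormedAddCommGroup_le _ (Real.exp_pos _).le _))
    (norm_nonneg _) (Real.exp_pos _).le

theorem one_le_exp_mul_rho (hB : ∀ x, |P.V₀ x| ≤ B) (p : Cyl) :
    1 ≤ Real.exp (‖P.V‖ + B) * P.rho hB p := by
  rw [rho_apply, ← Real.exp_add, ← Real.exp_add]
  refine Real.one_le_exp ?_
  have h1 := (le_abs_self _).trans (hB p.1)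
  have h2 : P.V p ≤ ‖P.V‖ := (le_abs_self _).trans (P.V.norm_coe_le_norm p)
  linarith

theorem mulB_toL_schwartz (hB : ∀ x, |P.V₀ x| ≤ B) (n : ℤ) (θ : 𝓢(ℝ, ℂ)) (h : P.Adm θ) :
    mulB (expNeg P.V) (h.toL n) = mulB (P.rho hB) (schwartzWave n θ) := by
  refine Lp.ext ?_
  filter_upwards [mulB_ae (expNeg P.V) (h.toL n), mulB_ae (P.rho hB) (schwartzWave n θ), h.toL_ae n,
    schwartzWave_coeFn n θ] with p h1 h2 h3 h4
  rw [h1, h2, h3, h4, rho_apply, tw, expNeg_apply, mul_assoc]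

/-- Formally r = ∂_xρ with ρ = e^{-V-V₀}, and r.dx + r.dxInvDy = ∂_x²ρ + ∂_yρ: this is the Cole–Hopf
substitution. As ρ need not lie in L², the equation is verified weakly; the boundedness of V₀ makes
Schwartz functions admissible tests. -/
theorem exists_gauge (hB : ∀ x, |P.V₀ x| ≤ B) : ∃ r : EnergySpace,
    r.fn = -mulB (P.rho hB) v.fn ∧
      r.dx + r.dxInvDy = -mulB (P.rho hB) (v.dx + v.dxInvDy - mulE v v) := by
  refine exists_energy_of_weak fun n θ => ?_
  have A := P.adm_schwartz hB
  have e : ∀ (n : ℤ) (θ : 𝓢(ℝ, ℂ)), mulB (P.rho hB) (schwartzWave n θ) =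
      mulB (expNeg P.V) ((A θ).toL n) := fun n θ => (P.mulB_toL_schwartz hB n θ (A θ)).symm
  have t1 := P.inner_fn n (hasDerivAt_schwartz ((Complex.I * n) • θ)) (A _) (A _)
  have t2 := P.inner_dx_sub n (hasDerivAt_schwartz (sderiv θ)) (A _) (A _)
  have t3 := P.inner_dxInvDy n (A (sderiv θ))
  have hd : (fun x => Complex.I * n * sderiv θ x) = sderiv ((Complex.I * n) • θ) := by
    funext x
    exact congrArg (fun φ : 𝓢(ℝ, ℂ) => φ x)
      (ContinuousLinearMap.map_smul (SchwartzMap.derivCLM ℂ ℂ) (Complex.I * n) θ).symm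
  rw [hd] at t3
  rw [inner_neg_left, inner_neg_left, inner_neg_left, inner_mulB_comm, inner_mulB_comm,
    inner_mulB_comm, e, e, e, t1, ← t3,
    show v.dx + v.dxInvDy - mulE v v = (v.dx - mulE v v) + v.dxInvDy by abel, inner_add_left, t2]
  ring

end Antiderivative

variable {v : EnergySpace}

theorem mulE_eq_of_fn_eq {r h : EnergySpace} {q : Cyl →ᵇ ℝ} (hr : r.fn = -mulB q v.fn) :
    mulE h r = -mulB q (mulE h v) := by
  refine Lp.ext ?_
  filter_upwards [mulE_ae h r, mulE_ae h v, mulB_ae q (mulE h v), mulB_ae q v.fn,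
    Lp.coeFn_neg (mulB q (mulE h v)), Lp.coeFn_neg (mulB q v.fn)] with p h1 h2 h3 h4 h5 h6
  rw [h1, hr, h6, h5, Pi.neg_apply, Pi.neg_apply, h3, h4, h2]
  ring

/-- Pointwise v = -r/q with 1/q ≤ D, hence v² ≤ D²r². Only the squares are compared, so no
derivative of 1/q enters. -/
theorem norm_mulE_self_le {r : EnergySpace} {q : Cyl →ᵇ ℝ} (hr : r.fn = -mulB q v.fn) {D : ℝ}
    (hq : ∀ p, 1 ≤ D * q p) : ‖mulE v v‖ ≤ D ^ 2 * ‖mulE r r‖ := by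
  refine Lp.norm_le_mul_norm_of_ae_le_mul ?_
  filter_upwards [mulE_ae v v, mulE_ae r r, mulB_ae q v.fn, Lp.coeFn_neg (mulB q v.fn)]
    with p h1 h2 h3 h4
  rw [h1, h2, hr, h4, Pi.neg_apply, h3, Real.norm_of_nonneg (mul_self_nonneg _),
    Real.norm_of_nonneg (mul_self_nonneg _)]
  have h5 : 1 ≤ (D * q p) ^ 2 := one_le_pow₀ (hq p)
  calc v.fn p * v.fn p ≤ (D * q p) ^ 2 * (v.fn p * v.fn p) :=
        le_mul_of_one_le_left (mul_self_nonneg _) h5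
    _ = _ := by ring

theorem mulE_comm (v w : EnergySpace) : mulE v w = mulE w v := by
  refine Lp.ext ?_
  filter_upwards [mulE_ae v w, mulE_ae w v] with p h1 h2
  rw [h1, h2, mul_comm]

/-- The equation for the gauge transform. -/
theorem linOp_gauge {a κ : ℝ} {p : L2Cyl} {h r : EnergySpace} {q : Cyl →ᵇ ℝ}
    (e : linOp a v = κ • p + mulE (h + v) (h + v)) (hr : r.fn = -mulB q v.fn)
    (hr' : r.dx + r.dxInvDy = -mulB q (v.dx + v.dxInvDy - mulE v v)) :
    linOp a r = (2 : ℝ) • mulE h r - mulB q (κ • p + mulE h h) := by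
  -- Multiplication by Q commutes with that by q, so the gauge acts on the whole operator and
  -- removes the square of v.
  have h1 : linOp a r = -mulB q (linOp a v - mulE v v) := by
    have hk : mulKink a (mulB q v.fn) = mulB q (mulKink a v.fn) := by
      rw [mulKink, mulB_mulB, mulB_mulB, mul_comm (fstB (kinkB a)) q]
    rw [linOp_apply, linOp_apply, hr', hr, map_neg, hk, smul_neg, sub_neg_eq_add, ← map_smul,
      neg_add_eq_sub, ← map_sub, ← map_neg]
    congr 1
    abel
  have h2 : mulE (h + v) (h + v) = mulE h h + (2 : ℝ) • mulE h v + mulE v v := by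
    rw [map_add, map_add, add_apply, add_apply,
      mulE_comm v h, two_smul]
    abel
  rw [h1, e, h2, mulE_eq_of_fn_eq hr, show κ • p + (mulE h h + (2 : ℝ) • mulE h v + mulE v v) -
    mulE v v = (κ • p + mulE h h) + (2 : ℝ) • mulE h v by abel, map_add, map_smul, smul_neg]
  abel

/-! ### Smallness of the solutions -/

theorem exists_augEquiv_bound {a : ℝ} (ha : 0 < a) {p : L2Cyl} (hp : inner ℝ p (eta ha) ≠ 0) :
    ∃ C : ℝ, 0 < C ∧ (∀ w, ‖w‖ ≤ C * ‖linOp a w‖) ∧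
      ∀ f : L2Cyl, ∃ (κ : ℝ) (h : EnergySpace), κ • p + linOp a h = f ∧ |κ| ≤ C * ‖f‖ ∧
        ‖h‖ ≤ C * ‖f‖ := by
  obtain ⟨C, hC, hb⟩ := (augEquiv ha hp).symm.toContinuousLinearMap.bound
  refine ⟨C, hC, fun w => ?_, fun f => ?_⟩
  · have h1 := hb (augEquiv ha hp (0, w))
    have h2 : augEquiv ha hp (0, w) = linOp a w := by
      change augOp a p (0, w) = _
      rw [augOp_apply, zero_smul, zero_add]
    have h3 : (augEquiv ha hp).symm.toContinuousLinearMap (augEquiv ha hp (0, w)) = (0, w) :=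
      (augEquiv ha hp).symm_apply_apply _
    rw [h3, h2] at h1
    exact (norm_snd_le ((0 : ℝ), w)).trans h1
  · set x := (augEquiv ha hp).symm f
    have h1 : ‖x‖ ≤ C * ‖f‖ := hb f
    exact ⟨x.1, x.2, (augEquiv ha hp).apply_symm_apply f, (norm_fst_le x).trans h1,
      (norm_snd_le x).trans h1⟩

theorem le_two_mul_of_absorb {y A B : ℝ} (h : y ≤ A * y + B) (hA : A ≤ 1 / 2) (hy : 0 ≤ y) :
    y ≤ 2 * B := by nlinarith

/-- A bounded solution of the linearized equation with a quadratic source is small. -/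
theorem exists_gauge_bound {a : ℝ} (ha : 0 < a) {p : L2Cyl} (hη : inner ℝ p (eta ha) ≠ 0)
    {Cp : ℝ} (hp : ∀ s t, s ≤ t → |inner ℝ (strip s t) p| ≤ Cp) (M : ℝ) :
    ∃ δ C : ℝ, 0 < δ ∧ 0 ≤ C ∧ ∀ (κ : ℝ) (h w : EnergySpace), |κ| ≤ 1 → ‖h‖ ≤ δ → ‖w‖ ≤ M →
      linOp a w = κ • p + mulE (h + w) (h + w) → ‖w‖ ≤ C * (|κ| + ‖h‖) := by
  obtain ⟨C₁, hC₁, hL, -⟩ := exists_augEquiv_bound ha hη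
  obtain ⟨m, hm, hE⟩ := exists_mulE_bound
  obtain ⟨K, hK, hP⟩ := exists_antiderivative
  set B : ℝ := a⁻¹ * (M + (Cp + (1 + M) ^ 2)) + 2 * a⁻¹ * M
  set D : ℝ := Real.exp (K * M + B)
  have hD : 0 < D := Real.exp_pos _
  set N := ‖p‖ + m
  have hN : 0 ≤ N := by positivity
  set R : ℝ := 2 * (C₁ * (D * N))
  have hR : 0 ≤ R := by positivity
  -- The second bound on ‖h‖ makes C₁ · 2m‖h‖ ≤ 1/2, so the terms linear in r and in w can be
  -- absorbed on the left.
  refine ⟨min 1 (1 / (4 * (C₁ * m + 1))), 2 * (C₁ * (N + 2 * (D ^ 2 * (m * R ^ 2)))),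
    by positivity, by positivity, fun κ h w hκ hh hw e => ?_⟩
  have hh1 : ‖h‖ ≤ 1 := hh.trans (min_le_left _ _)
  have hh2 : C₁ * (2 * (m * ‖h‖)) ≤ 1 / 2 := by
    have h1 := hh.trans (min_le_right _ _)
    rw [le_div_iff₀ (by positivity)] at h1
    nlinarith [norm_nonneg h]
  set s := |κ| + ‖h‖
  have hs0 : 0 ≤ s := by positivity
  have hs2 : s ≤ 2 := by linarith
  have src : ‖κ • p + mulE h h‖ ≤ N * s := by
    refine (norm_add_le _ _).trans ?_
    rw [norm_smul, Real.norm_eq_abs]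
    have h1 : ‖mulE h h‖ ≤ m * ‖h‖ := (hE h h).trans
      (mul_le_of_le_one_right (by positivity) hh1)
    have h2 : 0 ≤ m * |κ| := by positivity
    have h3 : 0 ≤ ‖p‖ * ‖h‖ := by positivity
    simp only [N, s]
    linarith
  obtain ⟨P, hPV⟩ := hP w
  have hB := abs_V₀_le_of_linOp_eq ha hp hκ hh1 hw e P
  obtain ⟨r, hr, hr'⟩ := P.exists_gauge hB
  have hVD : Real.exp (‖P.V‖ + B) ≤ D :=
    Real.exp_le_exp.2 (add_le_add_left (hPV.trans (mul_le_mul_of_nonneg_left hw hK.le)) B)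
  have hρ : ‖P.rho hB‖ ≤ D := (P.norm_rho_le hB).trans hVD
  have hr_le : ‖r‖ ≤ R * s := by
    -- The equation for r is linear, so its smallness follows without any smallness of w; that of w
    -- was not available.
    have h1 := hL r
    rw [linOp_gauge e hr hr'] at h1
    have h2 : ‖(2 : ℝ) • mulE h r - mulB (P.rho hB) (κ • p + mulE h h)‖ ≤
        2 * (m * ‖h‖ * ‖r‖) + D * (N * s) := by
      refine (norm_sub_le _ _).trans (add_le_add ?_ ((norm_mulB_le _ _).trans
        (mul_le_mul hρ src (norm_nonneg _) hD.le)))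
      rw [norm_smul, Real.norm_two]
      exact mul_le_mul_of_nonneg_left (hE h r) zero_le_two
    have h3 : ‖r‖ ≤ C₁ * (2 * (m * ‖h‖)) * ‖r‖ + C₁ * (D * (N * s)) := by
      refine h1.trans ((mul_le_mul_of_nonneg_left h2 hC₁.le).trans_eq ?_)
      ring
    refine (le_two_mul_of_absorb h3 hh2 (norm_nonneg _)).trans_eq ?_
    simp only [R]; ring
  -- The square of w inherits the bound on r², of order s². Since s ≤ 2, this is linear in s and can
  -- serve as a source in the equation for w.
  have hsq : ‖mulE w w‖ ≤ 2 * (D ^ 2 * (m * R ^ 2)) * s := by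
    have h1 := norm_mulE_self_le hr (D := D) fun p =>
      (P.one_le_exp_mul_rho hB p).trans (mul_le_mul_of_nonneg_right hVD
        (by rw [P.rho_apply]; positivity))
    have h2 : ‖mulE r r‖ ≤ m * R ^ 2 * (2 * s) := by
      calc ‖mulE r r‖ ≤ m * ‖r‖ * ‖r‖ := hE r r
        _ ≤ m * (R * s) * (R * s) := by gcongr
        _ = m * R ^ 2 * (s * s) := by ring
        _ ≤ _ := by gcongr
    refine h1.trans ((mul_le_mul_of_nonneg_left h2 (by positivity)).trans_eq ?_)
    ring
  have h1 := hL w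
  have h2 : linOp a w = (2 : ℝ) • mulE h w + ((κ • p + mulE h h) + mulE w w) := by
    rw [e, map_add, map_add, add_apply, add_apply, mulE_comm w h, two_smul]
    abel
  rw [h2] at h1
  have h3 : ‖(2 : ℝ) • mulE h w + ((κ • p + mulE h h) + mulE w w)‖ ≤
      2 * (m * ‖h‖ * ‖w‖) + (N * s + 2 * (D ^ 2 * (m * R ^ 2)) * s) := by
    refine (norm_add_le _ _).trans (add_le_add ?_ ((norm_add_le _ _).trans (add_le_add src hsq)))
    rw [norm_smul, Real.norm_two]
    exact mul_le_mul_of_nonneg_left (hE h w) zero_le_two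
  have h4 : ‖w‖ ≤ C₁ * (2 * (m * ‖h‖)) * ‖w‖ + C₁ * (N * s + 2 * (D ^ 2 * (m * R ^ 2)) * s) := by
    refine h1.trans ((mul_le_mul_of_nonneg_left h3 hC₁.le).trans_eq ?_)
    ring
  refine (le_two_mul_of_absorb h4 hh2 (norm_nonneg _)).trans_eq ?_
  ring

/-- Bounded solutions whose amplitude is close to that of the kink are small. -/
theorem exists_norm_lt_of_miuraF_eq {σ : ℝ → L2Cyl} {a₀ : ℝ} (ha₀ : 0 < a₀)
    (hσ : ContinuousAt σ a₀) {p : L2Cyl} (hη : inner ℝ p (eta ha₀) ≠ 0)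
    {Cp : ℝ} (hp : ∀ s t, s ≤ t → |inner ℝ (strip s t) p| ≤ Cp) {M : ℝ} (hM : 0 ≤ M) {ρ : ℝ}
    (hρ : 0 < ρ) :
    ∃ δ : ℝ, 0 < δ ∧ ∀ (a : ℝ) (v : EnergySpace) (u : L2Cyl), |a - a₀| < δ → ‖v‖ ≤ M → ‖u‖ < δ →
      miuraF σ a₀ (a, v) = u → ‖v‖ < ρ := by
  obtain ⟨C₁, hC₁, -, haug⟩ := exists_augEquiv_bound ha₀ hη
  obtain ⟨δ₀, C, hδ₀, hC, hb⟩ := exists_gauge_bound ha₀ hη hp (M + 1)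
  -- τ bounds |κ| and ‖h‖. Then ‖v‖ ≤ ‖w‖ + ‖h‖ ≤ 2Cτ + τ < ρ. The radius M + 1 above leaves room
  -- for w = v - h.
  set τ := min (min 1 δ₀) (ρ / (4 * (C + 1)))
  have hτ : 0 < τ := by positivity
  set μ := τ / C₁
  have hμ : 0 < μ := by positivity
  have hk : ContinuousAt kinkB a₀ := (contDiffAt_kinkB ha₀).continuousAt
  obtain ⟨δ₁, hδ₁, h1⟩ := Metric.continuousAt_iff.1 hσ (μ / 3) (by positivity)
  obtain ⟨δ₂, hδ₂, h2⟩ := Metric.continuousAt_iff.1 hk (μ / (6 * (M + 1))) (by positivity)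
  refine ⟨min (μ / 3) (min δ₁ δ₂), by positivity, fun a v u ha hv hu e => ?_⟩
  have s1 : ‖σ a₀ - σ a‖ < μ / 3 := by
    have := h1 (x := a) (ha.trans_le ((min_le_right _ _).trans (min_le_left _ _)))
    rwa [dist_comm, dist_eq_norm] at this
  have s2 : ‖kinkB a - kinkB a₀‖ < μ / (6 * (M + 1)) := by
    have := h2 (x := a) (ha.trans_le ((min_le_right _ _).trans (min_le_right _ _)))
    rwa [dist_eq_norm] at this
  have s3 : ‖u‖ < μ / 3 := hu.trans_le (min_le_left _ _)
  set d : L2Cyl := mulKink a v.fn - mulKink a₀ v.fn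
  have hd : ‖(2 : ℝ) • d‖ ≤ μ / 3 := by
    have e1 : d = mulB (fstB (kinkB a - kinkB a₀)) v.fn := by
      rw [show fstB (kinkB a - kinkB a₀) = fstB (kinkB a) - fstB (kinkB a₀) from rfl, map_sub]
      rfl
    have e2 : ‖d‖ ≤ μ / (6 * (M + 1)) * (M + 1) := by
      rw [e1]
      refine (norm_mulB_le _ _).trans (mul_le_mul ((norm_fstB_le _).trans s2.le) ?_
        (norm_nonneg _) (by positivity))
      exact v.norm_fn_le.trans (hv.trans (by linarith))
    rw [norm_smul, Real.norm_two]
    calc 2 * ‖d‖ ≤ 2 * (μ / (6 * (M + 1)) * (M + 1)) := by gcongr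
      _ = μ / 3 := by field_simp; norm_num
  -- All errors from freezing the amplitude at a₀, so that L v = v² + f. As an L² function f may
  -- have unbounded strip integrals; replacing v by v - h trades it for κp, whose strip integrals
  -- are bounded.
  set f : L2Cyl := u + (σ a₀ - σ a) + (2 : ℝ) • d
  have hf : ‖f‖ ≤ μ := by
    refine (norm_add_le _ _).trans ?_
    have := norm_add_le u (σ a₀ - σ a)
    linarith
  obtain ⟨κ, h, hκh, hκ, hh⟩ := haug f
  have hτf : C₁ * ‖f‖ ≤ τ :=
    (mul_le_mul_of_nonneg_left hf hC₁.le).trans_eq (mul_div_cancel₀ _ hC₁.ne')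
  have hκτ := hκ.trans hτf
  have hhτ := hh.trans hτf
  have τ1 : τ ≤ 1 := (min_le_left _ _).trans (min_le_left _ _)
  have τδ : τ ≤ δ₀ := (min_le_left _ _).trans (min_le_right _ _)
  have τρ : τ ≤ ρ / (4 * (C + 1)) := min_le_right _ _
  have hw : linOp a₀ (v - h) = κ • p + mulE (h + (v - h)) (h + (v - h)) := by
    have e1 : linOp a₀ h = f - κ • p := by rw [← hκh]; abel
    have e2 : linOp a₀ v = mulE v v + f := by
      have e3 : σ a - σ a₀ + linOp a v - mulE v v = u := e
      have e4 : linOp a₀ v = linOp a v + (2 : ℝ) • d := by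
        rw [linOp_apply, linOp_apply, smul_sub]; abel
      rw [e4]
      simp only [f]
      rw [← e3]
      abel
    rw [map_sub, e1, e2, add_sub_cancel]
    abel
  have hb1 := hb κ h (v - h) (hκτ.trans τ1) (hhτ.trans τδ)
    ((norm_sub_le _ _).trans (add_le_add hv (hhτ.trans τ1))) hw
  have h5 : ‖v‖ ≤ ‖v - h‖ + ‖h‖ := by
    have := norm_add_le (v - h) h
    rwa [sub_add_cancel] at this
  rw [le_div_iff₀ (by positivity)] at τρ
  have h6 : C * (|κ| + ‖h‖) ≤ C * (2 * τ) := mul_le_mul_of_nonneg_left (by linarith) hC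
  nlinarith

/-! ### The main theorem -/

/-- The solitons, as elements of `L²`. -/
def solitonL (a : ℝ) : L2Cyl := if h : 0 < a then (2 : ℝ) • eta h else 0

theorem solitonL_ae {a : ℝ} (ha : 0 < a) : solitonL a =ᵐ[volume] fun q => 2 * sechA a q.1 := by
  rw [solitonL, dif_pos ha]
  filter_upwards [Lp.coeFn_smul (2 : ℝ) (eta ha), eta_ae ha] with q h1 h2
  rw [h1, Pi.smul_apply, h2, smul_eq_mul]

theorem two_mul_sqrt_sq {k : ℝ} (hk : 0 ≤ k) : 2 * Real.sqrt (k / 2) ^ 2 = k := by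
  rw [Real.sq_sqrt (by positivity)]; ring

/-- Any solution has its amplitude controlled by the data. -/
theorem exists_amplitude_bound_of_miuraPlus {a₀ ε : ℝ} (ha₀ : 0 < a₀) (hε : 0 ≤ ε) :
    ∃ C : ℝ, 0 ≤ C ∧ ∀ (a : ℝ) (v : EnergySpace) (u : L2Cyl), 0 < a →
      |2 * a ^ 2 - 2 * a₀ ^ 2| ≤ ε → ‖v‖ ≤ ε →
      (∀ᵐ q : Cyl, miuraPlus (2 * a ^ 2) (kink (2 * a ^ 2)) v q =
        soliton (2 * a₀ ^ 2) q.1 + u q) → |a - a₀| ≤ C * ‖u‖ := by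
  -- The bound A on the amplitude comes from a₀|a - a₀| ≤ |a² - a₀²| ≤ ε.
  obtain ⟨C, hC, h⟩ := exists_amplitude_bound ha₀ (A := a₀ + ε / a₀) hε
  refine ⟨C / a₀, by positivity, fun a v u ha hk hv hu => ?_⟩
  have e1 : |a ^ 2 - a₀ ^ 2| = |a - a₀| * (a + a₀) := by
    rw [show a ^ 2 - a₀ ^ 2 = (a - a₀) * (a + a₀) by ring, abs_mul, abs_of_pos (add_pos ha ha₀)]
  have e2 : |a - a₀| * a₀ ≤ |a ^ 2 - a₀ ^ 2| := by
    rw [e1]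
    exact mul_le_mul_of_nonneg_left (by linarith) (abs_nonneg _)
  have e3 : |a ^ 2 - a₀ ^ 2| ≤ ε := by
    rw [← mul_sub, abs_mul, abs_two] at hk
    linarith [abs_nonneg (a ^ 2 - a₀ ^ 2)]
  have e4 : a ≤ a₀ + ε / a₀ := by
    have : a - a₀ ≤ ε / a₀ := by
      rw [le_div_iff₀ ha₀]
      exact (mul_le_mul_of_nonneg_right (le_abs_self _) ha₀.le).trans (e2.trans e3)
    linarith
  -- The amplitude is not yet known to be near a₀, so the family defined for every positive
  -- amplitude is used instead of the smooth local one.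
  have e5 := (miuraF_eq_iff (σ := solitonL) (x := (a, v)) ha₀.le ha.le (solitonL_ae ha₀)
    (solitonL_ae ha) u).2 hu
  have e6 := h a v (solitonL a₀ - solitonL a) u ha e4 hv (by
    filter_upwards [Lp.coeFn_sub (solitonL a₀) (solitonL a), solitonL_ae ha₀, solitonL_ae ha]
      with q h1 h2 h3
    rw [h1, Pi.sub_apply, h2, h3]) (by
    rw [← e5, miuraF]; abel)
  rw [div_mul_eq_mul_div, le_div_iff₀ ha₀]
  exact e2.trans e6

/-- The solution map near the kink, together with uniqueness in a ball of arbitrary size. -/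
theorem exists_solution_map {a₀ ε : ℝ} (ha₀ : 0 < a₀) (hε : 0 < ε) :
    ∃ (δ : ℝ) (g : L2Cyl → ℝ × EnergySpace), 0 < δ ∧ ContDiffOn ℝ 1 g {u | ‖u‖ < δ} ∧
      (∀ u, ‖u‖ < δ → 0 < (g u).1 ∧ |2 * (g u).1 ^ 2 - 2 * a₀ ^ 2| < ε ∧ ‖(g u).2‖ < ε ∧
        ∀ᵐ q : Cyl, miuraPlus (2 * (g u).1 ^ 2) (kink (2 * (g u).1 ^ 2)) (g u).2 q =
          soliton (2 * a₀ ^ 2) q.1 + u q) ∧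
      ∀ u, ‖u‖ < δ → ∀ (a : ℝ) (v : EnergySpace), 0 < a → |2 * a ^ 2 - 2 * a₀ ^ 2| < ε → ‖v‖ < ε →
        (∀ᵐ q : Cyl, miuraPlus (2 * a ^ 2) (kink (2 * a ^ 2)) v q =
          soliton (2 * a₀ ^ 2) q.1 + u q) → (a, v) = g u := by
  obtain ⟨σ, p, hσ, hp, hae, hη, Cp, hstrip⟩ := exists_soliton_family ha₀
  obtain ⟨r, g, hr, hg⟩ := exists_local_inverse ha₀ hσ hp hη
  obtain ⟨δ₁, hδ₁, hae⟩ := Metric.eventually_nhds_iff.1 hae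
  obtain ⟨δ₂, hδ₂, hsmall⟩ := exists_norm_lt_of_miuraF_eq ha₀ hσ.continuousAt hη hstrip hε.le hr
  obtain ⟨C, hC, hamp⟩ := exists_amplitude_bound_of_miuraPlus ha₀ hε.le
  have hσ₀ : σ a₀ =ᵐ[volume] fun q => 2 * sechA a₀ q.1 := hae (by rwa [dist_self])
  -- a₀ keeps the amplitude positive and below 2a₀, and δ₁ keeps σ equal to the soliton. Then |2a² -
  -- 2a₀²| ≤ 6a₀|a - a₀|, which explains the last entry.
  set ρ := min (min a₀ δ₁) (min ε (ε / (6 * a₀)))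
  have hρ : 0 < ρ := by positivity
  obtain ⟨δ₃, hδ₃, hgC, hge, hgu⟩ := hg ρ hρ
  -- For an arbitrary solution in the ball of size ε, the amplitude must first come within δ₁ and
  -- δ₂, so that v has norm below r, and within r, so that the local uniqueness applies.
  set τ := min δ₁ (min δ₂ r)
  have hτ : 0 < τ := by positivity
  refine ⟨min (min δ₂ δ₃) (τ / (C + 1)), g, by positivity, hgC.mono fun u hu => ?_,
    fun u hu => ?_, fun u hu a v ha hk hv heq => ?_⟩
  · exact (show ‖u‖ < min (min δ₂ δ₃) (τ / (C + 1)) from hu).trans_le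
      ((min_le_left _ _).trans (min_le_right _ _))
  · obtain ⟨hd, hF⟩ := hge u (hu.trans_le ((min_le_left _ _).trans (min_le_right _ _)))
    have h1 : |(g u).1 - a₀| < ρ := lt_of_le_of_lt (le_max_left _ _) hd
    have h2 : ‖(g u).2‖ < ρ := by
      have : dist (g u).2 0 < ρ := lt_of_le_of_lt (le_max_right _ _) hd
      rwa [dist_zero_right] at this
    have h3 : |(g u).1 - a₀| < a₀ := h1.trans_le ((min_le_left _ _).trans (min_le_left _ _))
    have h4 : |(g u).1 - a₀| < δ₁ := h1.trans_le ((min_le_left _ _).trans (min_le_right _ _))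
    have h5 : |(g u).1 - a₀| < ε / (6 * a₀) :=
      h1.trans_le ((min_le_right _ _).trans (min_le_right _ _))
    have h6 := abs_lt.1 h3
    have hpos : 0 < (g u).1 := by linarith
    refine ⟨hpos, ?_, h2.trans_le ((min_le_right _ _).trans (min_le_left _ _)),
      (miuraF_eq_iff ha₀.le hpos.le hσ₀ (hae h4) u).1 hF⟩
    rw [lt_div_iff₀ (by positivity)] at h5
    rw [show 2 * (g u).1 ^ 2 - 2 * a₀ ^ 2 = ((g u).1 - a₀) * (2 * ((g u).1 + a₀)) by ring, abs_mul,
      abs_of_pos (show 0 < 2 * ((g u).1 + a₀) by linarith)]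
    refine lt_of_le_of_lt (mul_le_mul_of_nonneg_left ?_ (abs_nonneg _)) h5
    linarith
  · have h1 : |a - a₀| < τ := by
      refine (hamp a v u ha hk.le hv.le heq).trans_lt ?_
      have h2 := hu.trans_le (min_le_right _ _)
      rw [lt_div_iff₀ (by positivity)] at h2
      nlinarith [norm_nonneg u]
    have h4 : |a - a₀| < δ₁ := h1.trans_le (min_le_left _ _)
    have h5 : |a - a₀| < δ₂ := h1.trans_le ((min_le_right _ _).trans (min_le_left _ _))
    have h6 : |a - a₀| < r := h1.trans_le ((min_le_right _ _).trans (min_le_right _ _))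
    have hF := (miuraF_eq_iff (x := (a, v)) ha₀.le ha.le hσ₀ (hae h4) u).2 heq
    have h7 := hsmall a v u h5 hv.le (hu.trans_le ((min_le_left _ _).trans (min_le_left _ _))) hF
    refine hgu u (hu.trans_le ((min_le_left _ _).trans (min_le_right _ _))) (a, v) ?_ hF
    rw [Prod.dist_eq]
    exact max_lt h6 (by rwa [dist_zero_right])

end KPMiura

end

theorem proposition3p1 (c : ℝ) (hc : 0 < c) (ε : ℝ) (hε : 0 < ε) :
    ∃ δ : ℝ, 0 < δ ∧
      (∀ u : KPMiura.L2Cyl, ‖u‖ < δ →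
        ∃! kv : ℝ × KPMiura.EnergySpace,
          0 < kv.1 ∧ |kv.1 - c| < ε ∧ ‖kv.2‖ < ε ∧
          ∀ᵐ p : KPMiura.Cyl,
            KPMiura.miuraPlus kv.1 (KPMiura.kink kv.1) kv.2 p = KPMiura.soliton c p.1 + u p) ∧
      (∀ Φ : KPMiura.L2Cyl → ℝ × KPMiura.EnergySpace,
        (∀ u : KPMiura.L2Cyl, ‖u‖ < δ →
          0 < (Φ u).1 ∧ |(Φ u).1 - c| < ε ∧ ‖(Φ u).2‖ < ε ∧
          ∀ᵐ p : KPMiura.Cyl,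
            KPMiura.miuraPlus (Φ u).1 (KPMiura.kink (Φ u).1) (Φ u).2 p =
              KPMiura.soliton c p.1 + u p) →
        ContDiffOn ℝ 1 Φ {u : KPMiura.L2Cyl | ‖u‖ < δ}) := by
  have ha₀ : 0 < Real.sqrt (c / 2) := Real.sqrt_pos.2 (by positivity)
  obtain ⟨δ, g, hδ, hgC, hg, hu⟩ := KPMiura.exists_solution_map ha₀ hε
  simp only [KPMiura.two_mul_sqrt_sq hc.le] at hg hu
  -- For positive k, the amplitude √(k/2) translates every solution back to the parametrization k =
  -- 2a².
  have huniq : ∀ u : KPMiura.L2Cyl, ‖u‖ < δ → ∀ kv : ℝ × KPMiura.EnergySpace,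
      (0 < kv.1 ∧ |kv.1 - c| < ε ∧ ‖kv.2‖ < ε ∧ ∀ᵐ p : KPMiura.Cyl,
        KPMiura.miuraPlus kv.1 (KPMiura.kink kv.1) kv.2 p = KPMiura.soliton c p.1 + u p) →
      kv = (2 * (g u).1 ^ 2, (g u).2) := by
    rintro u hu' ⟨k, v⟩ ⟨h1, h2, h3, h4⟩
    have e := KPMiura.two_mul_sqrt_sq (k := k) h1.le
    have := hu u hu' (Real.sqrt (k / 2)) v (Real.sqrt_pos.2 (half_pos h1)) (by rwa [e]) h3
      (by rwa [e])
    rw [← this, e]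
  refine ⟨δ, hδ, fun u hu' => ⟨(2 * (g u).1 ^ 2, (g u).2), ?_, huniq u hu'⟩, fun Φ hΦ => ?_⟩
  · obtain ⟨h1, h2, h3, h4⟩ := hg u hu'
    exact ⟨by positivity, h2, h3, h4⟩
  -- By uniqueness, any selection of solutions coincides on the ball with the one from the inverse
  -- function theorem, composed with a ↦ 2a².
  · refine ContDiffOn.congr ?_ fun u hu' => huniq u hu' (Φ u) (hΦ u hu')
    exact (contDiffOn_const.mul (hgC.fst.pow 2)).prodMk hgC.snd
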